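/- **Setting.** Let $h>0$, $\hbar=h/2\pi$, and let $(V,\Omega)$ be a finite-dimensional real symplectic vector space with a positive compatible complex structure $j$; put $G_j(v,w)=\Omega(v,jw)$ and $\langle v,w\rangle_j=\Omega(v,jw)-i\Omega(v,w)$. The Heisenberg group acts on the Fock space $\mathcal H(V,\Omega,j)$ of holomorphic functions on $(V,j)$ with $\|f\|_j^2=h^{-n}\int_V|f(z)|^2e^{-|z|_j^2/2\hbar}\,dz<\infty$ (where $n=\frac12\dim V$) by $$(U_j(v,t)f)(z)=e^{-it/\hbar+\langle z,v\rangle_j/2\hbar-|v|_j^2/4\hbar}f(z-v).$$ $Mp^c=Mp^c(V,\Omega,j)$ is the Lie group of pairs $(U,g)$, with $g\in Sp(V,\Omega)$ and $U$ a unitary operator on $\mathcal H(V,\Omega,j)$, such that $U_j(gv,t)=U\,U_j(v,t)\,U^{-1}$ for all $v,t$; $\sigma(U,g)=g$, and $U(1)\subset Mp^c$ is the central subgroup of the $(cI,I)$. For $g\in Sp(V,\Omega)$ let $C_g=\frac12(g-jgj)$ and $Z_g=\frac12C_g^{-1}(g+jgj)$. With $e_v(z)=e^{\langle z,v\rangle_j/2\hbar}$,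 write $U_{g,\lambda}$ for the unitary operator (when it exists) satisfying $$(U_{g,\lambda}e_v)(z)=\lambda\exp\tfrac1{4\hbar}\{2\langle C_g^{-1}z,v\rangle_j-\langle z,Z_{g^{-1}}z\rangle_j-\langle Z_gv,v\rangle_j\}.$$ Let $(M,\omega)$ be a symplectic manifold and $G$ a (second countable) Lie group acting smoothly, transitively and symplectically on $M$. A $G$-invariant $Mp^c$-structure is a smooth principal $Mp^c$-bundle $P\to M$ with a smooth fibre-preserving map $\phi$ from $P$ to the symplectic frame bundle of $M$ such that $\phi(p\cdot A)=\phi(p)\circ\sigma(A)$, and a smooth action of $G$ on $P$ which covers the action on $M$, commutes with the right action of $Mp^c$ and satisfies $\phi(gp)=g_*\circ\phi(p)$. Given a symplectic frame $f_0:V\to T_{p_0}M$, let $K$ be the stabilizer of $p_0$ and $\tau(k)=f_0^{-1}\circ k_{*p_0}\circ f_0$. For a homomorphism $\mu:K\to Mp^c$ with $\sigma\circ\mu=\tau$, $G\times_{K,\mu}Mp^c$ is the quotient of $G\times Mp^c$ by $(g,A)\sim(gk,\mu(k)^{-1}A)$, with $G$ and $Mp^c$ acting by left and right multiplication, $[g,A]\mapsto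 gp_0$ as projection, and $\phi([g,A])=g_{*p_0}\circ f_0\circ\sigma(A)$. **1. Pseudo-Hermitean case.** Let $\tilde\jmath$ be a compatible complex structure on $(V,\Omega)$, not necessarily positive, which commutes with $j$. Put $U(V,\Omega,\tilde\jmath)=\{g\in Sp(V,\Omega): g\tilde\jmath=\tilde\jmath g\}$, $V_-=\{v:\tilde\jmath v=-jv\}$ and $C_g^-=C_g|_{V_-}$. Then $F_{\tilde\jmath,j}(g)=(U_{g,\lambda},g)$ with $\lambda=(\operatorname{Det}_jC_g^-)^{-1}$ defines a homomorphism $F_{\tilde\jmath,j}:U(V,\Omega,\tilde\jmath)\to Mp^c$. Let $\tilde J$ be a $G$-invariant compatible almost complex structure on $(M,\omega)$ and let the symplectic frame $f_0:V\to T_{p_0}M$ satisfy $f_0\tilde\jmath=\tilde J_{p_0}f_0$. Then for every $G$-invariant $Mp^c$-structure $P$ there is a unitary character $\chi:K\to U(1)$ such that, as $G$-invariant $Mp^c$-structures, $$P\cong G\times_{K,\,\chi\times(F_{\tilde\jmath,j}\circ\tau)}Mp^c(V,\Omega,j).$$ **2. Bi-Lagrangian case.** Let $F\subset V$ be a Lagrangian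 subspace. For $C\in GL(F)$ let $\tau_F(C)$ be the symplectic map $a+jb\mapsto Ca+j(C^T)^{-1}b$ ($a,b\in F$; transposes relative to $G_j$) and $$f_F(C)=|\operatorname{Det}_FC|^{-1/2}\exp\left(-\tfrac12\log\operatorname{Det}_F\left(\tfrac12(\mathrm{Id}_F+(C^TC)^{-1})\right)\right).$$ Then $\widetilde{\tau_F}(C)=(U_{\tau_F(C),f_F(C)},\tau_F(C))$ defines a homomorphism $\widetilde{\tau_F}:GL(F)\to Mp^c$. Let $A$ be a $G$-invariant smooth field of endomorphisms of $TM$ with $A_x\in\mathfrak{sp}(T_xM,\omega_x)$ and $A_x^2=\mathrm{Id}$ for all $x$, let $T_\pm$ be the $\pm1$ eigenspaces of $A_{p_0}$, let $f_{+0}:F\to T_+$ be a linear isomorphism, and let $f_0:V\to T_{p_0}M$ be the symplectic frame extending $f_{+0}$ with $f_0(jF)=T_-$. Put $\rho_+(k)=f_{+0}^{-1}\circ(k_{*p_0})|_{T_+}\circ f_{+0}$. Then for every $G$-invariant $Mp^c$-structure $P$ there is a unitary character $\chi:K\to U(1)$ such that, as $G$-invariant $Mp^c$-structures, $$P\cong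 G\times_{K,\,\chi\times(\widetilde{\tau_F}\circ\rho_+)}Mp^c(V,\Omega,j).$$ -/

import Mathlib

open scoped Manifold ContDiff InnerProductSpace
open MeasureTheory Set

noncomputable section

namespace MpcGeom

/-! ## The symplectic model space

A finite-dimensional real symplectic vector space `(V, Ω)` together with a positive compatible
complex structure `j` is the same thing as a finite-dimensional complex inner product space `V`:
`j` is multiplication by `i`, and `⟨v, w⟩_j = Ω(v, j w) - i Ω(v, w)` is the Hermitian product which
is linear in `v` and antilinear in `w`, so that `Ω = - Im ⟨·,·⟩_j`. Mathlib's inner product is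
antilinear in its *first* argument, hence the exchange of arguments in `herm`. -/

section Model

variable {V : Type*} [NormedAddCommGroup V] [InnerProductSpace ℂ V]

/-- The Hermitian product `⟨v, w⟩_j`, linear in `v`, antilinear in `w`. -/
def herm (v w : V) : ℂ := inner ℂ w v

/-- The symplectic form `Ω`. -/
def Om (v w : V) : ℝ := -(herm v w).im

theorem herm_eq (v w : V) :
    herm v w = (Om v (Complex.I • w) : ℂ) - Complex.I * (Om v w : ℂ) := by
  apply Complex.ext <;> simp [Om, herm]

theorem Om_self_pos (v : V) (hv : v ≠ 0) : 0 < Om v (Complex.I • v) := by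
  have h1 : Om v (Complex.I • v) = ‖v‖ ^ 2 := by
    have h2 := inner_self_eq_norm_sq (𝕜 := ℂ) v
    simp only [RCLike.re_to_complex] at h2
    simpa [Om, herm, inner_smul_left] using h2
  rw [h1]
  positivity

variable (V) in
/-- The real symplectic group `Sp(V, Ω)`. -/
def Sp : Subgroup (V ≃L[ℝ] V) where
  carrier := {g | ∀ v w, Om (g v) (g w) = Om v w}
  one_mem' := fun _ _ => rfl
  mul_mem' := fun {a b} ha hb v w => (ha (b v) (b w)).trans (hb v w)
  inv_mem' := fun {a} ha v w => by
    have h := ha (a⁻¹ v) (a⁻¹ w)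
    have e : ∀ x, a (a⁻¹ x) = x := fun x => a.apply_symm_apply x
    rw [e, e] at h
    exact h.symm

/-- The `j`-linear part `C_g = (g - j g j) / 2` of a real linear map. -/
def linPart (g : V ≃L[ℝ] V) : V →ₗ[ℂ] V where
  toFun v := (1 / 2 : ℂ) • (g v - Complex.I • g (Complex.I • v))
  map_add' v w := by simp only [smul_add, map_add]; module
  map_smul' c v := by
    have h1 : ∀ w : V, g (c • w) = c.re • g w + c.im • g (Complex.I • w) := by
      intro w
      conv_lhs => rw [← Complex.re_add_im c]
      rw [add_smul, map_add, mul_smul, Complex.coe_smul, Complex.coe_smul, map_smul, map_smul]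
    have h2 : g (Complex.I • c • v) = c.re • g (Complex.I • v) - c.im • g v := by
      rw [smul_comm, h1, smul_smul Complex.I Complex.I, Complex.I_mul_I, neg_one_smul, map_neg,
        smul_neg, sub_eq_add_neg]
    rw [h1, h2, RingHom.id_apply]
    have h3 : ∀ (r : ℝ) (w : V), r • w = (r : ℂ) • w := fun r w => (Complex.coe_smul r w).symm
    simp only [h3]
    conv_rhs => rw [← Complex.re_add_im c]
    simp only [smul_sub, smul_add, smul_smul]
    have h4 : Complex.I * Complex.I = -1 := Complex.I_mul_I
    match_scalars
    · ring
    · ring_nf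
      simp
      ring

/-- The `j`-antilinear part `D_g = (g + j g j) / 2`. -/
def antiPart (g : V ≃L[ℝ] V) (v : V) : V :=
  (1 / 2 : ℂ) • (g v + Complex.I • g (Complex.I • v))

/-- `C_g⁻¹`; for symplectic `g` the map `C_g` is invertible. -/
def linPartInv (g : V ≃L[ℝ] V) : V →ₗ[ℂ] V := Ring.inverse (linPart g : Module.End ℂ V)

/-- `Z_g = C_g⁻¹ D_g`. -/
def Zmap (g : V ≃L[ℝ] V) (v : V) : V := linPartInv g (antiPart g v)

end Model

/-! ## The Fock representation of the Heisenberg group and the group `Mp^c` -/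

section Fock

variable (V : Type*) [NormedAddCommGroup V] [InnerProductSpace ℂ V] [FiniteDimensional ℂ V]
  [MeasurableSpace V] [BorelSpace V]

/-- Lebesgue measure on `V`, normalised by the Euclidean norm `|·|_j`. -/
def lebesgue : Measure V :=
  letI : InnerProductSpace ℝ V := InnerProductSpace.complexToReal
  volume

/-- `ħ = h / 2π`. -/
def hbar (h : ℝ) : ℝ := h / (2 * Real.pi)

/-- The Fock space `ℋ(V, Ω, j)`: holomorphic functions which are square integrable for the
Gaussian weight. -/
def Fock (h : ℝ) : Submodule ℂ (V → ℂ) where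
  carrier := {f | Differentiable ℂ f ∧
    Integrable (fun z => ‖f z‖ ^ 2 * Real.exp (-(‖z‖ ^ 2 / (2 * hbar h)))) (lebesgue V)}
  zero_mem' := ⟨differentiable_const 0, by simp⟩
  add_mem' := by
    rintro f g ⟨hf, hf'⟩ ⟨hg, hg'⟩
    refine ⟨hf.add hg, ((hf'.const_mul 2).add (hg'.const_mul 2)).mono' ?_ ?_⟩
    · have h1 := hf.continuous
      have h2 := hg.continuous
      refine Continuous.aestronglyMeasurable ?_
      have h3 : Continuous fun z => ‖f z + g z‖ := (h1.add h2).norm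
      exact (h3.pow 2).mul (by fun_prop)
    · refine Filter.Eventually.of_forall fun z => ?_
      have h1 : ‖f z + g z‖ ^ 2 ≤ 2 * ‖f z‖ ^ 2 + 2 * ‖g z‖ ^ 2 := by
        have := norm_add_le (f z) (g z)
        nlinarith [norm_nonneg (f z + g z), sq_nonneg (‖f z‖ - ‖g z‖)]
      have h2 := Real.exp_nonneg (-(‖z‖ ^ 2 / (2 * hbar h)))
      rw [Real.norm_of_nonneg (by positivity)]
      simp only [Pi.add_apply]
      nlinarith
  smul_mem' := by
    rintro c f ⟨hf, hf'⟩
    refine ⟨hf.const_smul c, ?_⟩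
    have := hf'.const_mul (‖c‖ ^ 2)
    refine this.congr (Filter.Eventually.of_forall fun z => ?_)
    simp only [Pi.smul_apply, smul_eq_mul, norm_mul]
    ring

variable {V}

/-- The square of the Fock norm, `‖f‖_j² = h^{-n} ∫ |f(z)|² exp(-|z|²/2ħ) dz`. -/
def normSq {h : ℝ} (f : Fock V h) : ℝ :=
  (h ^ Module.finrank ℂ V)⁻¹ *
    ∫ z, ‖f.1 z‖ ^ 2 * Real.exp (-(‖z‖ ^ 2 / (2 * hbar h))) ∂(lebesgue V)

instance : (lebesgue V).IsAddHaarMeasure :=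
  letI : InnerProductSpace ℝ V := InnerProductSpace.complexToReal
  inferInstanceAs (volume : Measure V).IsAddHaarMeasure

/-- The action `U_j(v, t)` of an element of the Heisenberg group on functions. -/
def heisFun (h : ℝ) (v : V) (t : ℝ) (f : V → ℂ) (z : V) : ℂ :=
  Complex.exp (-(Complex.I * t) / hbar h + herm z v / (2 * hbar h)
    - (‖v‖ ^ 2 : ℝ) / (4 * hbar h)) * f (z - v)

set_option linter.unusedSectionVars false in
theorem heisFun_weight (h : ℝ) (v : V) (t : ℝ) (f : V → ℂ) (z : V) :
    ‖heisFun h v t f z‖ ^ 2 * Real.exp (-(‖z‖ ^ 2 / (2 * hbar h)))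
      = ‖f (z - v)‖ ^ 2 * Real.exp (-(‖z - v‖ ^ 2 / (2 * hbar h))) := by
  have h1 : ‖z - v‖ ^ 2 = ‖z‖ ^ 2 - 2 * (herm z v).re + ‖v‖ ^ 2 := by
    have := norm_sub_sq (𝕜 := ℂ) z v
    rw [this, herm, ← inner_conj_symm v z, Complex.conj_re]
    rfl
  have h2 : (-(Complex.I * t) / hbar h + herm z v / (2 * hbar h)
      - (‖v‖ ^ 2 : ℝ) / (4 * hbar h)).re
      = (herm z v).re / (2 * hbar h) - ‖v‖ ^ 2 / (4 * hbar h) := by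
    have e1 : -(Complex.I * t) / (hbar h : ℂ) = Complex.I * ((-t / hbar h : ℝ) : ℂ) := by
      push_cast; ring
    have e2 : (2 * (hbar h : ℂ)) = ((2 * hbar h : ℝ) : ℂ) := by push_cast; ring
    have e3 : (4 * (hbar h : ℂ)) = ((4 * hbar h : ℝ) : ℂ) := by push_cast; ring
    rw [e1, e2, e3, Complex.sub_re, Complex.add_re, Complex.div_ofReal_re, Complex.div_ofReal_re,
      Complex.ofReal_re]
    simp
  rw [heisFun, norm_mul, Complex.norm_exp, h2, h1, mul_pow, ← Real.exp_nat_mul]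
  rw [mul_comm (Real.exp _), mul_assoc, ← Real.exp_add]
  congr 2
  push_cast
  ring

theorem heisFun_mem {h : ℝ} (v : V) (t : ℝ) {f : V → ℂ} (hf : f ∈ Fock V h) :
    heisFun h v t f ∈ Fock V h := by
  refine ⟨?_, ?_⟩
  · have h1 : Differentiable ℂ fun z : V => herm z v :=
      (innerSL ℂ v).differentiable
    have h2 : Differentiable ℂ fun z : V => f (z - v) := hf.1.comp (differentiable_id.sub_const v)
    have h3 : Differentiable ℂ fun z : V => herm z v / (2 * hbar h) := by
      simpa only [div_eq_mul_inv] using h1.mul_const ((2 * (hbar h : ℂ))⁻¹)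
    exact (((h3.const_add _).sub_const _).cexp).mul h2
  · simp only [heisFun_weight]
    exact hf.2.comp_sub_right v

/-- The operator `U_j(v, t)` on the Fock space. -/
def heis {h : ℝ} (v : V) (t : ℝ) : Fock V h →ₗ[ℂ] Fock V h where
  toFun f := ⟨heisFun h v t f.1, heisFun_mem v t f.2⟩
  map_add' f g := by
    ext z
    simp [heisFun, mul_add]
  map_smul' c f := by
    ext z
    simp [heisFun]
    ring

/-- The coherent state `e_v(z) = exp(⟨z, v⟩_j / 2ħ)`. -/
def coherentFun (h : ℝ) (v : V) (z : V) : ℂ := Complex.exp (herm z v / (2 * hbar h))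

theorem coherent_mem {h : ℝ} (hh : 0 < h) (v : V) : coherentFun h v ∈ Fock V h := by
  have hb : 0 < hbar h := div_pos hh (by positivity)
  have h0 : (fun _ => 1 : V → ℂ) ∈ Fock V h := by
    refine ⟨differentiable_const 1, ?_⟩
    let _ : InnerProductSpace ℝ V := InnerProductSpace.complexToReal
    have key := GaussianFourier.integrable_cexp_neg_mul_sq_norm_add (V := V)
      (b := ((1 / (2 * hbar h) : ℝ) : ℂ)) (by rw [Complex.ofReal_re]; positivity) 0 0
    refine key.norm.congr (Filter.Eventually.of_forall fun z => ?_)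
    simp only [Complex.norm_exp]
    have : (-((1 / (2 * hbar h) : ℝ) : ℂ) * (‖z‖ : ℂ) ^ 2 + 0 * ((inner ℝ 0 z : ℝ) : ℂ))
        = ((-(‖z‖ ^ 2 / (2 * hbar h)) : ℝ) : ℂ) := by push_cast; ring
    rw [this, Complex.ofReal_re]
    simp
  have h1 := (Fock V h).smul_mem (Complex.exp ((‖v‖ ^ 2 : ℝ) / (4 * hbar h)))
    (heisFun_mem v 0 h0)
  convert h1 using 1
  ext z
  simp only [coherentFun, heisFun, Pi.smul_apply, smul_eq_mul, mul_one, ← Complex.exp_add]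
  congr 1
  simp

/-- The coherent states as elements of the Fock space. -/
def coherent (h : ℝ) [hh : Fact (0 < h)] (v : V) : Fock V h :=
  ⟨coherentFun h v, coherent_mem hh.out v⟩

variable (V) in
/-- The group `Mp^c(V, Ω, j)` of pairs `(U, g)`, where `g` is symplectic and `U` is a unitary
transformation (a norm preserving linear bijection) of the Fock space such that
`U_j(g v, t) = U U_j(v, t) U⁻¹`. -/
def Mpc (h : ℝ) : Subgroup ((Fock V h ≃ₗ[ℂ] Fock V h) × (V ≃L[ℝ] V)) where
  carrier := {A | (∀ f, normSq (A.1 f) = normSq f) ∧ A.2 ∈ Sp V ∧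
    ∀ v t f, heis (A.2 v) t f = A.1 (heis v t (A.1.symm f))}
  one_mem' := ⟨fun _ => rfl, (Sp V).one_mem, fun _ _ _ => rfl⟩
  mul_mem' := by
    rintro A B ⟨h1, h2, h3⟩ ⟨k1, k2, k3⟩
    refine ⟨fun f => (h1 _).trans (k1 f), (Sp V).mul_mem h2 k2, fun v t f => ?_⟩
    exact (h3 (B.2 v) t f).trans (congrArg A.1 (k3 v t (A.1.symm f)))
  inv_mem' := by
    rintro A ⟨h1, h2, h3⟩
    refine ⟨fun f => ?_, (Sp V).inv_mem h2, fun v t f => ?_⟩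
    · have := h1 (A.1.symm f)
      rw [LinearEquiv.apply_symm_apply] at this
      exact this.symm
    · have := h3 (A.2.symm v) t (A.1 f)
      rw [ContinuousLinearEquiv.apply_symm_apply, LinearEquiv.symm_apply_apply] at this
      change heis (A.2.symm v) t f = A.1.symm (heis v t (A.1 f))
      rw [this, LinearEquiv.symm_apply_apply]

variable {h : ℝ}

/-- The projection `σ : Mp^c(V, Ω, j) → Sp(V, Ω)`, `(U, g) ↦ g`. -/
def sig : Mpc V h →* Sp V where
  toFun A := ⟨A.1.2, A.2.2.1⟩
  map_one' := rfl
  map_mul' _ _ := rfl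

/-- The central subgroup `U(1) → Mp^c(V, Ω, j)`, `c ↦ (c · Id, Id)`. -/
def scalar : Circle →* Mpc V h where
  toFun c := ⟨(LinearEquiv.smulOfUnit (Circle.toUnits c), 1), by
    refine ⟨fun f => ?_, (Sp V).one_mem, fun v t f => ?_⟩
    · have e : (LinearEquiv.smulOfUnit (Circle.toUnits c) f : Fock V h) = (c : ℂ) • f := rfl
      simp only [normSq, e, Submodule.coe_smul, Pi.smul_apply, smul_eq_mul, norm_mul,
        Circle.norm_coe, one_mul]
    · change heis v t f = (LinearEquiv.smulOfUnit (Circle.toUnits c))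
        (heis v t ((LinearEquiv.smulOfUnit (Circle.toUnits c)).symm f))
      have e : ∀ f : Fock V h, LinearEquiv.smulOfUnit (Circle.toUnits c) f = (c : ℂ) • f :=
        fun _ => rfl
      rw [e, ← map_smul, ← e, LinearEquiv.apply_symm_apply]⟩
  map_one' := by
    apply Subtype.ext
    refine Prod.ext ?_ rfl
    ext f : 1
    exact one_smul ℂ f
  map_mul' a b := by
    apply Subtype.ext
    refine Prod.ext ?_ (one_mul _).symm
    ext f : 1
    exact mul_smul (a : ℂ) (b : ℂ) f

theorem scalar_comm (c : Circle) (A : Mpc V h) : scalar c * A = A * scalar c := by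
  apply Subtype.ext
  refine Prod.ext ?_ ((one_mul _).trans (mul_one _).symm)
  ext f : 1
  exact (map_smul A.1.1 (c : ℂ) f).symm

variable [Fact (0 < h)]

/-- The Berezin kernel `(U e_v)(z)` of the operator `U` of an element of `Mp^c`. -/
def kernel (A : Mpc V h) (z v : V) : ℂ := (A.1.1 (coherent h v)).1 z

/-- `(g, l)` are the parameters of the element `A` of `Mp^c`, i.e. `A = (U_{g,l}, g)` where
`U_{g,l}` is the unitary operator with Berezin kernel
`l exp (1/4ħ) {2⟨C_g⁻¹ z, v⟩_j - ⟨z, Z_{g⁻¹} z⟩_j - ⟨Z_g v, v⟩_j}`. -/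
def HasParameters (A : Mpc V h) (g : V ≃L[ℝ] V) (l : ℂ) : Prop :=
  (sig A : V ≃L[ℝ] V) = g ∧ ∀ z v, kernel A z v =
    l * Complex.exp ((1 / (4 * hbar h)) *
      (2 * herm (linPartInv g z) v - herm z (Zmap g⁻¹ z) - herm (Zmap g v) v))

/-- The parameter `l = (U e_0)(0)` of an element of `Mp^c`. -/
def param (A : Mpc V h) : ℂ := kernel A 0 0

/-- Smoothness of a map into the Lie group `Mp^c(V, Ω, j)`. The manifold structure of `Mp^c` is the
one for which the parameters `A ↦ (g, l) ∈ End(V) × ℂ` are an embedding, so a map into `Mp^c` is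
smooth precisely when its two parameters are. -/
def MpcSmoothOn {E H N : Type*} [NormedAddCommGroup E] [NormedSpace ℝ E] [TopologicalSpace H]
    (I : ModelWithCorners ℝ E H) [TopologicalSpace N] [ChartedSpace H N]
    (a : N → Mpc V h) (O : Set N) : Prop :=
  (∀ v : V, ContMDiffOn I 𝓘(ℝ, V) ∞ (fun x => (sig (a x) : V ≃L[ℝ] V) v) O) ∧
    ContMDiffOn I 𝓘(ℝ, ℂ) ∞ (fun x => param (a x)) O

end Fock

/-! ## The pseudo-unitary group and the data of its lift -/

section PseudoUnitary

variable {V : Type*} [NormedAddCommGroup V] [InnerProductSpace ℂ V]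

variable (V) in
/-- A compatible complex structure on `(V, Ω)` (not necessarily positive) which commutes with `j`,
i.e. which is complex linear. -/
structure CommutingCCS where
  toLin : V →ₗ[ℂ] V
  symp : ∀ v w, Om (toLin v) (toLin w) = Om v w
  sq : ∀ v, toLin (toLin v) = -v

/-- The pseudo-unitary group `U(V, Ω, j̃)`. -/
def pseudoUnitary (jt : CommutingCCS V) : Subgroup (V ≃L[ℝ] V) where
  carrier := {g | g ∈ Sp V ∧ ∀ v, g (jt.toLin v) = jt.toLin (g v)}
  one_mem' := ⟨(Sp V).one_mem, fun _ => rfl⟩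
  mul_mem' := by
    rintro a b ⟨ha, ha'⟩ ⟨hb, hb'⟩
    refine ⟨(Sp V).mul_mem ha hb, fun v => ?_⟩
    change a (b (jt.toLin v)) = jt.toLin (a (b v))
    rw [hb', ha']
  inv_mem' := by
    rintro a ⟨ha, ha'⟩
    refine ⟨(Sp V).inv_mem ha, fun v => ?_⟩
    change a.symm (jt.toLin v) = jt.toLin (a.symm v)
    rw [ContinuousLinearEquiv.symm_apply_eq, ha', ContinuousLinearEquiv.apply_symm_apply]

/-- `V_- = {v | j̃ v = - j v}`, a complex subspace of `(V, j)`. -/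
def minusSpace (jt : CommutingCCS V) : Submodule ℂ V :=
  LinearMap.ker (jt.toLin + Complex.I • LinearMap.id)

theorem linPart_minusSpace (jt : CommutingCCS V) (g : pseudoUnitary jt) :
    ∀ v ∈ minusSpace jt, linPart (g : V ≃L[ℝ] V) v ∈ minusSpace jt := by
  intro v hv
  have h1 : jt.toLin v = -(Complex.I • v) := by
    have : jt.toLin v + Complex.I • v = 0 := hv
    exact eq_neg_of_add_eq_zero_left this
  have h2 : jt.toLin (linPart (g : V ≃L[ℝ] V) v) = linPart (g : V ≃L[ℝ] V) (jt.toLin v) := by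
    change jt.toLin ((1 / 2 : ℂ) • (g.1 v - Complex.I • g.1 (Complex.I • v)))
      = (1 / 2 : ℂ) • (g.1 (jt.toLin v) - Complex.I • g.1 (Complex.I • jt.toLin v))
    rw [← map_smul jt.toLin Complex.I v, g.2.2, g.2.2]
    simp only [map_smul, map_sub]
  change jt.toLin (linPart (g : V ≃L[ℝ] V) v) + Complex.I • linPart (g : V ≃L[ℝ] V) v = 0
  rw [h2, h1, map_neg, map_smul, neg_add_cancel]

/-- `Det_j C_g^-`, the complex determinant of the restriction of `C_g` to `V_-`. -/
def detMinus (jt : CommutingCCS V) (g : pseudoUnitary jt) : ℂ :=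
  LinearMap.det ((linPart (g : V ≃L[ℝ] V)).restrict (linPart_minusSpace jt g))

end PseudoUnitary

/-! ## The group `GL(F)` of a Lagrangian subspace and the data of its lift -/

section Lagrangian

variable {V : Type*} [NormedAddCommGroup V] [InnerProductSpace ℂ V] [FiniteDimensional ℂ V]

/-- `F = F^⊥` with respect to `Ω`. -/
def IsLagrangian (F : Submodule ℝ V) : Prop := ∀ v, v ∈ F ↔ ∀ w ∈ F, Om v w = 0

/-- `(Cᵀ)⁻¹`, where the transpose is taken relative to the inner product `G_j = Re ⟨·,·⟩_j`. -/
def invTranspose {F : Submodule ℝ V} (C : F ≃ₗ[ℝ] F) : F →ₗ[ℝ] F :=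
  letI : InnerProductSpace ℝ V := InnerProductSpace.complexToReal
  LinearMap.adjoint (C.symm : F →ₗ[ℝ] F)

/-- The projection of `V = F ⊕ jF` on `F`; this sum is `G_j`-orthogonal for Lagrangian `F`. -/
def projF (F : Submodule ℝ V) : V →ₗ[ℝ] F :=
  letI : InnerProductSpace ℝ V := InnerProductSpace.complexToReal
  (F.orthogonalProjectionOnto : V →L[ℝ] F).toLinearMap

/-- `τ_F(C) (a + j b) = C a + j (Cᵀ)⁻¹ b` for `a, b ∈ F`. -/
def tauF {F : Submodule ℝ V} (C : F ≃ₗ[ℝ] F) (v : V) : V :=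
  (C (projF F v) : V) +
    Complex.I • (invTranspose C (projF F (-(Complex.I • v))) : V)

/-- `f_F(C) = |Det_F C|^{-1/2} exp(-½ a_F(½ (Id + (Cᵀ C)⁻¹)))`. The operator in the argument of
`a_F` is real, symmetric and positive definite for `G_j`, and on such operators the branch `a_F`
of the logarithm of the determinant with `a_F(Id) = 0` is the real logarithm of the determinant. -/
def fF {F : Submodule ℝ V} (C : F ≃ₗ[ℝ] F) : ℝ :=
  |LinearMap.det (C : F →ₗ[ℝ] F)| ^ (-(1 / 2) : ℝ) *
    Real.exp (-(1 / 2) * Real.log (LinearMap.det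
      ((1 / 2 : ℝ) • (LinearMap.id + (C.symm : F →ₗ[ℝ] F) ∘ₗ invTranspose C))))

end Lagrangian

/-! ## Symplectic manifolds -/

section Manifold

variable {E : Type*} [NormedAddCommGroup E] [NormedSpace ℝ E]
  {M : Type*} [TopologicalSpace M] [ChartedSpace E M] [IsManifold 𝓘(ℝ, E) ∞ M]

variable (E M) in
/-- A smooth field of endomorphisms of the tangent bundle. -/
structure EndoField where
  toFun : ∀ x : M, TangentSpace 𝓘(ℝ, E) x →L[ℝ] TangentSpace 𝓘(ℝ, E) x
  smooth : ContMDiff 𝓘(ℝ, E) (𝓘(ℝ, E).prod 𝓘(ℝ, E →L[ℝ] E)) ∞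
    (fun x => Bundle.TotalSpace.mk' (E →L[ℝ] E)
      (E := fun x : M => TangentSpace 𝓘(ℝ, E) x →L[ℝ] TangentSpace 𝓘(ℝ, E) x) x (toFun x))

/-- The coordinate expression, in the chart at `x₀`, of a field of bilinear forms. -/
def chartForm
    (w : ∀ x : M, TangentSpace 𝓘(ℝ, E) x →L[ℝ] TangentSpace 𝓘(ℝ, E) x →L[ℝ] ℝ)
    (x₀ : M) (u v : E) (y : E) : ℝ :=
  w ((extChartAt 𝓘(ℝ, E) x₀).symm y)
    (mfderiv 𝓘(ℝ, E) 𝓘(ℝ, E) (extChartAt 𝓘(ℝ, E) x₀).symm y u)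
    (mfderiv 𝓘(ℝ, E) 𝓘(ℝ, E) (extChartAt 𝓘(ℝ, E) x₀).symm y v)

variable (E M) in
/-- A symplectic form on `M`: a smooth, alternating, non-degenerate and closed two-form. Closedness
is `(dω)(u, v, w) = ∂_u ω(v, w) + ∂_v ω(w, u) + ∂_w ω(u, v) = 0` in the preferred charts, which
cover `M`. -/
structure SymplecticForm where
  toFun : ∀ x : M, TangentSpace 𝓘(ℝ, E) x →L[ℝ] TangentSpace 𝓘(ℝ, E) x →L[ℝ] ℝ
  smooth : ContMDiff 𝓘(ℝ, E) (𝓘(ℝ, E).prod 𝓘(ℝ, E →L[ℝ] E →L[ℝ] ℝ)) ∞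
    (fun x => Bundle.TotalSpace.mk' (E →L[ℝ] E →L[ℝ] ℝ)
      (E := fun x : M => TangentSpace 𝓘(ℝ, E) x →L[ℝ] TangentSpace 𝓘(ℝ, E) x →L[ℝ] ℝ) x (toFun x))
  alternating : ∀ x u, toFun x u u = 0
  nondegenerate : ∀ x u, (∀ v, toFun x u v = 0) → u = 0
  closed : ∀ x₀ : M, ∀ y ∈ (extChartAt 𝓘(ℝ, E) x₀).target, ∀ u v w : E,
    fderiv ℝ (chartForm toFun x₀ v w) y u + fderiv ℝ (chartForm toFun x₀ w u) y v
      + fderiv ℝ (chartForm toFun x₀ u v) y w = 0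

/-- A point of the symplectic frame bundle `Sp(M, ω)`: a symplectic isomorphism
`b : (V, Ω) → (T_x M, ω_x)`, where `x` is the base point. -/
structure SympFrame (w : SymplecticForm E M) (V : Type*) [NormedAddCommGroup V]
    [InnerProductSpace ℂ V] where
  base : M
  iso : V ≃L[ℝ] TangentSpace 𝓘(ℝ, E) base
  symp : ∀ u v, w.toFun base (iso u) (iso v) = Om u v

/-- The value `b v` of a symplectic frame as a point of the tangent bundle. A frame is determined
by these values. -/
def SympFrame.app {w : SymplecticForm E M} {V : Type*} [NormedAddCommGroup V]
    [InnerProductSpace ℂ V] (b : SympFrame w V) (v : V) : TangentBundle 𝓘(ℝ, E) M :=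
  ⟨b.base, b.iso v⟩

/-! ## `Mp^c`-structures -/

/-- An `Mp^c`-structure on `(M, ω)`: a smooth principal `Mp^c(V, Ω, j)`-bundle `P → M` together
with a smooth fibre-preserving map `φ : P → Sp(M, ω)` such that `φ (p · A) = φ p · σ A`.

The smooth structure of the principal bundle `P` is given by an atlas of local sections `(U, s)`,
`s : U → P`, which cover `M`, i.e. by the local trivialisations `(x, A) ↦ s x · A` of
`P` over `U`, with smooth transition functions `U ∩ U' → Mp^c(V, Ω, j)`. -/
structure MpcStructure (w : SymplecticForm E M) (V : Type*) [NormedAddCommGroup V]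
    [InnerProductSpace ℂ V] [FiniteDimensional ℂ V] [MeasurableSpace V] [BorelSpace V]
    (h : ℝ) [Fact (0 < h)] (P : Type*) where
  proj : P → M
  act : P → Mpc V h → P
  act_one : ∀ p, act p 1 = p
  act_mul : ∀ p A B, act p (A * B) = act (act p A) B
  proj_act : ∀ p A, proj (act p A) = proj p
  simply_transitive : ∀ p q, proj p = proj q → ∃! A, act p A = q
  atlas : Set (Set M × (M → P))
  isOpen_of_mem : ∀ c ∈ atlas, IsOpen c.1
  proj_section : ∀ c ∈ atlas, ∀ x ∈ c.1, proj (c.2 x) = x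
  cover : ∀ x, ∃ c ∈ atlas, x ∈ c.1
  smooth_transition : ∀ c ∈ atlas, ∀ c' ∈ atlas, ∀ a : M → Mpc V h,
    (∀ x ∈ c.1 ∩ c'.1, c'.2 x = act (c.2 x) (a x)) → MpcSmoothOn 𝓘(ℝ, E) a (c.1 ∩ c'.1)
  phi : P → SympFrame w V
  phi_base : ∀ p, (phi p).base = proj p
  phi_act : ∀ p A v, (phi (act p A)).app v = (phi p).app ((sig A : V ≃L[ℝ] V) v)
  phi_smooth : ∀ c ∈ atlas, ∀ v : V,
    ContMDiffOn 𝓘(ℝ, E) 𝓘(ℝ, E).tangent ∞ (fun x => (phi (c.2 x)).app v) c.1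

variable {w : SymplecticForm E M} {V : Type*} [NormedAddCommGroup V]
  [InnerProductSpace ℂ V] [FiniteDimensional ℂ V] [MeasurableSpace V] [BorelSpace V]
  {h : ℝ} [Fact (0 < h)]

/-- Smoothness, on an open set `O` of a manifold `N`, of a map `f : N → P` into the total space of
an `Mp^c`-structure: its projection to `M` is smooth, and so is its `Mp^c`-component in each of
the local trivialisations. -/
def MpcStructure.SmoothOn {P : Type*} (S : MpcStructure w V h P)
    {E' H' N : Type*} [NormedAddCommGroup E'] [NormedSpace ℝ E'] [TopologicalSpace H']
    (I' : ModelWithCorners ℝ E' H') [TopologicalSpace N] [ChartedSpace H' N]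
    (f : N → P) (O : Set N) : Prop :=
  ContMDiffOn I' 𝓘(ℝ, E) ∞ (fun y => S.proj (f y)) O ∧
    ∀ c ∈ S.atlas, ∀ a : N → Mpc V h,
      (∀ y ∈ O, S.proj (f y) ∈ c.1 → f y = S.act (c.2 (S.proj (f y))) (a y)) →
      MpcSmoothOn I' a (O ∩ {y | S.proj (f y) ∈ c.1})

/-! ## Homogeneous symplectic manifolds -/

variable {EG : Type*} [NormedAddCommGroup EG] [NormedSpace ℝ EG]
  {G : Type*} [Group G] [TopologicalSpace G] [ChartedSpace EG G] [MulAction G M]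

variable (G) in
/-- The action of `G` on `M` preserves the symplectic form. -/
def IsSymplecticAction (w : SymplecticForm E M) : Prop :=
  ∀ (g : G) (x : M) (u v : TangentSpace 𝓘(ℝ, E) x),
    w.toFun (g • x) (mfderiv 𝓘(ℝ, E) 𝓘(ℝ, E) (fun y : M => g • y) x u)
      (mfderiv 𝓘(ℝ, E) 𝓘(ℝ, E) (fun y : M => g • y) x v) = w.toFun x u v

variable (G) in
/-- The field of endomorphisms `A` is invariant under the action of `G`. -/
def EndoField.IsInvariant (A : EndoField E M) : Prop :=
  ∀ (g : G) (x : M) (u : TangentSpace 𝓘(ℝ, E) x),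
    mfderiv 𝓘(ℝ, E) 𝓘(ℝ, E) (fun y : M => g • y) x (A.toFun x u)
      = A.toFun (g • x) (mfderiv 𝓘(ℝ, E) 𝓘(ℝ, E) (fun y : M => g • y) x u)

/-- `A` is a compatible almost complex structure on `(M, ω)` (not necessarily positive). -/
structure EndoField.IsCompatibleACS (A : EndoField E M) (w : SymplecticForm E M) : Prop where
  sq : ∀ x u, A.toFun x (A.toFun x u) = -u
  symp : ∀ x u v, w.toFun x (A.toFun x u) (A.toFun x v) = w.toFun x u v

/-- `A` is a bi-Lagrangian structure on `(M, ω)`: `A_x ∈ sp(T_x M, ω_x)` and `A_x² = Id`. -/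
structure EndoField.IsBiLagrangian (A : EndoField E M) (w : SymplecticForm E M) : Prop where
  sq : ∀ x u, A.toFun x (A.toFun x u) = u
  mem_sp : ∀ x u v, w.toFun x (A.toFun x u) v + w.toFun x u (A.toFun x v) = 0

/-- The `Mp^c`-structure `S`, with the given action of `G` on its total space, is `G`-invariant:
the action is smooth, covers the action on `M`, commutes with the right action of `Mp^c`, and
`φ (g p) = g_* ∘ φ p`. -/
structure MpcStructure.IsInvariant {P : Type*} [MulAction G P] (S : MpcStructure w V h P) :
    Prop where
  proj_smul : ∀ (g : G) p, S.proj (g • p) = g • S.proj p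
  smul_act : ∀ (g : G) p A, g • S.act p A = S.act (g • p) A
  phi_smul : ∀ (g : G) p v, (S.phi (g • p)).app v
    = tangentMap 𝓘(ℝ, E) 𝓘(ℝ, E) (fun y : M => g • y) ((S.phi p).app v)
  smooth : ∀ c ∈ S.atlas, S.SmoothOn (𝓘(ℝ, EG).prod 𝓘(ℝ, E))
    (fun y : G × M => y.1 • c.2 y.2) (univ ×ˢ c.1)

section Isotropy

theorem mdifferentiable_smul (E EG G M : Type*) [NormedAddCommGroup E] [NormedSpace ℝ E]
    [TopologicalSpace M] [ChartedSpace E M] [NormedAddCommGroup EG] [NormedSpace ℝ EG] [Group G]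
    [TopologicalSpace G] [ChartedSpace EG G] [MulAction G M]
    [ContMDiffSMul 𝓘(ℝ, EG) 𝓘(ℝ, E) ∞ G M] (g : G) :
    MDifferentiable 𝓘(ℝ, E) 𝓘(ℝ, E) (fun y : M => g • y) := by
  have h1 : ContMDiff 𝓘(ℝ, E) 𝓘(ℝ, E) ∞ (fun y : M => g • y) :=
    (ContMDiffSMul.contMDiff_smul (I := 𝓘(ℝ, EG)) (I' := 𝓘(ℝ, E)) (n := ∞) (G := G)
      (M := M)).comp (contMDiff_const.prodMk contMDiff_id)
  exact h1.mdifferentiable (by simp)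

/-- The differential `g_{*x}`, as an endomorphism of the vector space `E` which underlies all
tangent spaces. -/
def dAct (E : Type*) [NormedAddCommGroup E] [NormedSpace ℝ E] {M : Type*} [TopologicalSpace M]
    [ChartedSpace E M] {G : Type*} [Group G] [MulAction G M] (g : G) (x : M) : E →L[ℝ] E :=
  mfderiv 𝓘(ℝ, E) 𝓘(ℝ, E) (fun y : M => g • y) x

variable (EG) in
/-- The isotropy representation `k ↦ k_{*x}` of the stabilizer of `x` on `T_x M`. The target
`T_{k x} M` of the differential is `T_x M`, since `k x = x`. -/
def isotropy [ContMDiffSMul 𝓘(ℝ, EG) 𝓘(ℝ, E) ∞ G M] (x : M) : MulAction.stabilizer G x →*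
    (TangentSpace 𝓘(ℝ, E) x ≃L[ℝ] TangentSpace 𝓘(ℝ, E) x) :=
  (ContinuousLinearEquiv.unitsEquiv ℝ (TangentSpace 𝓘(ℝ, E) x)).toMonoidHom.comp
    (MonoidHom.toHomUnits
      ({ toFun := fun k => dAct E (k : G) x
         map_one' := by
          have e : (fun y : M => ((1 : MulAction.stabilizer G x) : G) • y) = id := by
            funext y; simp
          rw [dAct, e]
          exact mfderiv_id
         map_mul' := fun a b => by
          have e : (fun y : M => ((a * b : MulAction.stabilizer G x) : G) • y)
              = (fun y : M => (a : G) • y) ∘ (fun y : M => (b : G) • y) := by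
            funext y; simp [mul_smul]
          have hc := mfderiv_comp x
            (mdifferentiable_smul E EG G M (a : G) ((b : G) • x))
            (mdifferentiable_smul E EG G M (b : G) x)
          have hb : (b : G) • x = x := b.2
          rw [← e] at hc
          have h2 : dAct E ((a * b : MulAction.stabilizer G x) : G) x
            = (dAct E (a : G) ((b : G) • x)).comp (dAct E (b : G) x) := hc
          rw [hb] at h2
          exact h2 } :
        MulAction.stabilizer G x →* (TangentSpace 𝓘(ℝ, E) x →L[ℝ] TangentSpace 𝓘(ℝ, E) x)))

variable [ContMDiffSMul 𝓘(ℝ, EG) 𝓘(ℝ, E) ∞ G M]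

theorem isotropy_symp (hw : IsSymplecticAction G w) (x : M) (k : MulAction.stabilizer G x)
    (u v : TangentSpace 𝓘(ℝ, E) x) :
    w.toFun x (isotropy EG x k u) (isotropy EG x k v) = w.toFun x u v := by
  have h1 := hw (k : G) x u v
  have key : ∀ (y : M), y = x → ∀ a b : E,
      (show E →L[ℝ] E →L[ℝ] ℝ from w.toFun y) a b
        = (show E →L[ℝ] E →L[ℝ] ℝ from w.toFun x) a b := by
    rintro y rfl a b; rfl
  exact (key _ k.2 _ _).symm.trans h1

theorem isotropy_field {A : EndoField E M} (hA : A.IsInvariant G) (x : M)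
    (k : MulAction.stabilizer G x) (u : TangentSpace 𝓘(ℝ, E) x) :
    isotropy EG x k (A.toFun x u) = A.toFun x (isotropy EG x k u) := by
  have h1 := hA (k : G) x u
  have key : ∀ (y : M), y = x → ∀ a : E,
      (show E →L[ℝ] E from A.toFun y) a = (show E →L[ℝ] E from A.toFun x) a := by
    rintro y rfl a; rfl
  exact h1.trans (key _ k.2 _)

variable (EG) in
/-- The isotropy representation `τ(k) = f₀⁻¹ ∘ k_{*p₀} ∘ f₀` in the frame `f₀` at `p₀`. -/
def tau (f₀ : SympFrame w V) : MulAction.stabilizer G f₀.base →* (V ≃L[ℝ] V) where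
  toFun k := (f₀.iso.trans (isotropy EG f₀.base k)).trans f₀.iso.symm
  map_one' := by
    ext v
    rw [map_one]
    exact f₀.iso.symm_apply_apply v
  map_mul' a b := by
    ext v
    rw [map_mul]
    change f₀.iso.symm (isotropy EG f₀.base a (isotropy EG f₀.base b (f₀.iso v)))
      = f₀.iso.symm (isotropy EG f₀.base a (f₀.iso (f₀.iso.symm
          (isotropy EG f₀.base b (f₀.iso v)))))
    rw [f₀.iso.apply_symm_apply]

/-- `f₀` is a pseudo-unitary frame: it intertwines `j̃` and the almost complex structure. -/
def IsPseudoUnitaryFrame (f₀ : SympFrame w V) (jt : CommutingCCS V) (J : EndoField E M) : Prop :=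
  ∀ v, f₀.iso (jt.toLin v) = J.toFun f₀.base (f₀.iso v)

variable (EG) in
/-- The isotropy representation of a pseudo-Hermitean homogeneous space in a pseudo-unitary
frame, as a homomorphism `τ : K → U(V, Ω, j̃)`. -/
def tauPU (hw : IsSymplecticAction G w) {J : EndoField E M} (hJ : J.IsInvariant G)
    (jt : CommutingCCS V) (f₀ : SympFrame w V) (hf : IsPseudoUnitaryFrame f₀ jt J) :
    MulAction.stabilizer G f₀.base →* pseudoUnitary jt :=
  (tau EG f₀).codRestrict (pseudoUnitary jt) (by
    intro k
    refine ⟨fun u v => ?_, fun v => ?_⟩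
    · rw [← f₀.symp, ← f₀.symp u v]
      simp only [tau, MonoidHom.coe_mk, OneHom.coe_mk, ContinuousLinearEquiv.trans_apply,
        ContinuousLinearEquiv.apply_symm_apply]
      exact isotropy_symp hw _ k _ _
    · simp only [tau, MonoidHom.coe_mk, OneHom.coe_mk, ContinuousLinearEquiv.trans_apply]
      rw [ContinuousLinearEquiv.symm_apply_eq, hf, hf, ContinuousLinearEquiv.apply_symm_apply]
      exact isotropy_field hJ _ k _)

/-- `T_+`, the `+1` eigenspace of `A` at `x`. -/
def plusSpace (A : EndoField E M) (x : M) : Submodule ℝ (TangentSpace 𝓘(ℝ, E) x) :=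
  LinearMap.ker ((A.toFun x).toLinearMap - LinearMap.id)

variable (EG) in
/-- The restriction of the isotropy representation to `T_+`. -/
def isotropyPlus {A : EndoField E M} (hA : A.IsInvariant G) (x : M) :
    MulAction.stabilizer G x →* (plusSpace A x ≃ₗ[ℝ] plusSpace A x) :=
  have hmem : ∀ (k : MulAction.stabilizer G x), ∀ u ∈ plusSpace A x,
      isotropy EG x k u ∈ plusSpace A x := by
    intro k u hu
    have h1 : A.toFun x u = u := sub_eq_zero.1 hu
    have h2 : A.toFun x (isotropy EG x k u) = isotropy EG x k u := by
      rw [← isotropy_field hA, h1]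
    exact sub_eq_zero.2 h2
  { toFun := fun k => LinearEquiv.ofLinearMap
      ((isotropy EG x k).toLinearEquiv.toLinearMap.restrict (hmem k))
      ((isotropy EG x k⁻¹).toLinearEquiv.toLinearMap.restrict (hmem k⁻¹))
      (by
        refine LinearMap.ext fun u => Subtype.ext ?_
        change isotropy EG x k (isotropy EG x k⁻¹ (u : TangentSpace 𝓘(ℝ, E) x)) = u
        rw [map_inv]
        exact (isotropy EG x k).apply_symm_apply _)
      (by
        refine LinearMap.ext fun u => Subtype.ext ?_
        change isotropy EG x k⁻¹ (isotropy EG x k (u : TangentSpace 𝓘(ℝ, E) x)) = u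
        rw [map_inv]
        exact (isotropy EG x k).symm_apply_apply _)
    map_one' := by
      refine LinearEquiv.ext fun u => Subtype.ext ?_
      change isotropy EG x 1 (u : TangentSpace 𝓘(ℝ, E) x) = u
      rw [map_one]
      rfl
    map_mul' := fun a b => by
      refine LinearEquiv.ext fun u => Subtype.ext ?_
      change isotropy EG x (a * b) (u : TangentSpace 𝓘(ℝ, E) x)
        = isotropy EG x a (isotropy EG x b (u : TangentSpace 𝓘(ℝ, E) x))
      rw [map_mul]
      rfl }

variable (EG) in
/-- `ρ_+(k) = f_+⁻¹ ∘ (k_{*p₀})|_{T_+} ∘ f_+` for a frame `f_+ : F → T_+`. -/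
def rhoPlus {A : EndoField E M} (hA : A.IsInvariant G) {F : Submodule ℝ V} (x : M)
    (fp : F ≃ₗ[ℝ] plusSpace A x) : MulAction.stabilizer G x →* (F ≃ₗ[ℝ] F) where
  toFun k := (fp.trans (isotropyPlus EG hA x k)).trans fp.symm
  map_one' := by ext v; simp
  map_mul' a b := by ext v; simp

end Isotropy

/-! ## Associated bundles `G ×_{K, μ} Mp^c` -/

section Associated

variable {K : Subgroup G}

/-- The homomorphism `χ × ℓ : K → Mp^c`, `k ↦ χ(k) ℓ(k)`. -/
def twist (chi : K →* Circle) (l : K →* Mpc V h) : K →* Mpc V h where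
  toFun k := scalar (chi k) * l k
  map_one' := by simp
  map_mul' a b := by
    rw [map_mul, map_mul, map_mul, mul_assoc, mul_assoc]
    congr 1
    rw [← mul_assoc, ← mul_assoc, scalar_comm]

/-- The equivalence relation `(g, A) ∼ (g k, μ(k)⁻¹ A)`, `k ∈ K`, on `G × Mp^c`. -/
def assocSetoid (mu : K →* Mpc V h) : Setoid (G × Mpc V h) where
  r a b := ∃ k : K, b = (a.1 * k, (mu k)⁻¹ * a.2)
  iseqv :=
    { refl := fun a => ⟨1, by simp⟩
      symm := by
        rintro a b ⟨k, rfl⟩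
        exact ⟨k⁻¹, by simp⟩
      trans := by
        rintro a b c ⟨k, rfl⟩ ⟨l, rfl⟩
        exact ⟨k * l, by simp [mul_assoc]⟩ }

/-- The set `G ×_{K, μ} Mp^c(V, Ω, j)`. -/
def AssocBundle (mu : K →* Mpc V h) : Type _ := Quotient (assocSetoid mu)

/-- The class `[g, A]`. -/
def AssocBundle.mk (mu : K →* Mpc V h) (g : G) (A : Mpc V h) : AssocBundle mu :=
  Quotient.mk (assocSetoid mu) (g, A)

variable (EG) in
/-- Smoothness of a map `s` from `M` to the quotient manifold `G ×_{K, μ} Mp^c` on an open set: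
locally, `s` has a smooth lift to `G × Mp^c`. -/
def AssocBundle.SmoothOn (E : Type*) [NormedAddCommGroup E] [NormedSpace ℝ E] {M : Type*}
    [TopologicalSpace M] [ChartedSpace E M] {mu : K →* Mpc V h} (s : M → AssocBundle mu)
    (O : Set M) : Prop :=
  ∀ x ∈ O, ∃ W : Set M, IsOpen W ∧ x ∈ W ∧ ∃ (g : M → G) (a : M → Mpc V h),
    ContMDiffOn 𝓘(ℝ, E) 𝓘(ℝ, EG) ∞ g W ∧ MpcSmoothOn 𝓘(ℝ, E) a W ∧
      ∀ y ∈ W ∩ O, s y = AssocBundle.mk mu (g y) (a y)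

variable (EG) in
/-- The bijection `Ψ : G ×_{K, μ} Mp^c → P` is an isomorphism of `G`-invariant `Mp^c`-structures.
Here `G ×_{K, μ} Mp^c` carries the projection `[g, A] ↦ g p₀`, the right action
`[g, A] · B = [g, A B]` of `Mp^c`, the left action `g' [g, A] = [g' g, A]` of `G`, and the map
`[g, A] ↦ g_{*p₀} ∘ f₀ ∘ σ(A)` to the symplectic frame bundle. That `Ψ` is a diffeomorphism is
expressed by: `s` is a smooth local section of `G ×_{K, μ} Mp^c` if and only if `Ψ ∘ s` is a
smooth local section of `P`. -/
structure IsAssocIso {P : Type*} [MulAction G P] (S : MpcStructure w V h P) (f₀ : SympFrame w V)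
    (mu : MulAction.stabilizer G f₀.base →* Mpc V h) (Psi : AssocBundle mu ≃ P) : Prop where
  proj : ∀ g A, S.proj (Psi (AssocBundle.mk mu g A)) = g • f₀.base
  act : ∀ g A B, S.act (Psi (AssocBundle.mk mu g A)) B = Psi (AssocBundle.mk mu g (A * B))
  smul : ∀ (g' : G) g A, g' • Psi (AssocBundle.mk mu g A) = Psi (AssocBundle.mk mu (g' * g) A)
  phi : ∀ (g : G) A v, (S.phi (Psi (AssocBundle.mk mu g A))).app v
    = tangentMap 𝓘(ℝ, E) 𝓘(ℝ, E) (fun y : M => g • y) (f₀.app ((sig A : V ≃L[ℝ] V) v))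
  smooth : ∀ (O : Set M) (s : M → AssocBundle mu), IsOpen O →
    (∀ x ∈ O, S.proj (Psi (s x)) = x) →
    (AssocBundle.SmoothOn EG E s O ↔ S.SmoothOn 𝓘(ℝ, E) (fun x => Psi (s x)) O)

end Associated

end Manifold

end MpcGeom

end

open scoped Manifold ContDiff InnerProductSpace
open MeasureTheory Set

noncomputable section

namespace MpcGeom

/-! ### Complex linear and antilinear parts of symplectic maps -/

section LinearAlgebra

variable {V : Type*} [NormedAddCommGroup V] [InnerProductSpace ℂ V]

/-! An invariant structure `P` is recovered from a single fibre. Since `σ` is onto, some `q` over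
`p₀` satisfies `φ(q) = f₀`. For `k ∈ K` the point `k q` lies in the same fibre, so `k q = q · μ(k)`.
Because the two actions commute, `μ` is a homomorphism; equivariance of `φ` gives `σ ∘ μ = τ`; and
`[g, A] ↦ (g q) · A` is the required isomorphism from `G ×_{K,μ} Mp^c`. If `l` is another
homomorphism over `τ`, then `μ(k)` and `l(k)` differ by a unit scalar (Schur's lemma). These scalars
are central, so they form a character, which is continuous as a quotient of parameters
(`MpcStructure.IsInvariant.exists_isAssocIso`). What remains is to construct the two explicit lifts.

Every symplectic `g` is `C_g (1 + Z_g)` with `Z_g` in the Siegel disc of antilinear symmetric strict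
contractions. The operator with parameters `(g, λ)` sends the vacuum to `λ` times a Gaussian vector,
and it exists as a unitary operator when `|λ|² |det C_g| = 1` (`exists_hasParameters`). Parameters
multiply up to the inner product of two Gaussian vectors with `W = Z_g` and `Z = Z_{k⁻¹}`
(`param_mul`), and the square of that inner product is `det (1 - W Z)⁻¹` (`sq_gaussInner_mul_sdet`).
A lift of a subgroup of `Sp` is therefore a consistent choice of square root (`exists_lift_hom`).

In the pseudo-Hermitean case `1 - W Z` splits into two blocks whose determinants have the same
modulus, and the inner product is exactly the inverse of the `V_-` block
(`gaussInner_mul_minusDet`). In the bi-Lagrangian case the Gaussians are real for the conjugation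
that fixes `F`, so the inner product is positive (`gaussInner_pos`) and the moduli decide
everything. The phases are settled by deforming `W` to `t W`: a holomorphic function of modulus one
which equals 1 at `t = 0` is 1, and a real function without zeros keeps its sign.

Two facts about smoothness are needed. Multiplication in `Mp^c` is smooth, because the Gaussian
inner product is a continuous square root of a smooth function. The map `G → M` has smooth local
sections: by homogeneity the rank of the orbit map is maximal at the identity, and a deficient rank
would give its image too small a Hausdorff dimension for an open map (`exists_smooth_section`). -/

theorem Om_eq_im (v w : V) : Om v w = (inner ℂ v w : ℂ).im := by
  rw [Om, herm, ← inner_conj_symm v w, Complex.conj_im]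

theorem inner_eq_Om (v w : V) :
    (inner ℂ v w : ℂ) = (Om v (Complex.I • w) : ℂ) + Complex.I * (Om v w : ℂ) := by
  apply Complex.ext <;> simp [Om_eq_im]

theorem Om_smul_I_left (v w : V) : Om (Complex.I • v) w = -Om v (Complex.I • w) := by
  simp [Om_eq_im]

/-- The complex linear part of a real linear map. -/
def cpart (T : V →L[ℝ] V) : V →ₗ[ℂ] V where
  toFun v := (1 / 2 : ℂ) • (T v - Complex.I • T (Complex.I • v))
  map_add' v w := by simp only [smul_add, map_add]; module
  map_smul' c v := by
    have h1 : ∀ w : V, T (c • w) = c.re • T w + c.im • T (Complex.I • w) := by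
      intro w
      conv_lhs => rw [← Complex.re_add_im c]
      rw [add_smul, map_add, mul_smul, Complex.coe_smul, Complex.coe_smul, map_smul, map_smul]
    have h2 : T (Complex.I • c • v) = c.re • T (Complex.I • v) - c.im • T v := by
      rw [smul_comm, h1, smul_smul Complex.I Complex.I, Complex.I_mul_I, neg_one_smul, map_neg,
        smul_neg, sub_eq_add_neg]
    rw [h1, h2, RingHom.id_apply]
    have h3 : ∀ (r : ℝ) (w : V), r • w = (r : ℂ) • w := fun r w => (Complex.coe_smul r w).symm
    simp only [h3]
    conv_rhs => rw [← Complex.re_add_im c]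
    simp only [smul_sub, smul_add, smul_smul]
    have h4 : Complex.I * Complex.I = -1 := Complex.I_mul_I
    match_scalars
    · ring
    · ring_nf
      simp
      ring

theorem cpart_apply (T : V →L[ℝ] V) (v : V) :
    cpart T v = (1 / 2 : ℂ) • (T v - Complex.I • T (Complex.I • v)) := rfl

theorem linPart_apply (g : V ≃L[ℝ] V) (v : V) :
    linPart g v = (1 / 2 : ℂ) • (g v - Complex.I • g (Complex.I • v)) := rfl

theorem cpart_apply_of_comm {T : V →L[ℝ] V} (hT : ∀ v, T (Complex.I • v) = Complex.I • T v)
    (v : V) : cpart T v = T v := by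
  rw [cpart_apply, hT, smul_smul, Complex.I_mul_I]
  match_scalars
  norm_num

theorem linPart_add_antiPart (g : V ≃L[ℝ] V) (v : V) : linPart g v + antiPart g v = g v := by
  rw [linPart_apply, antiPart]
  module

/-- A real linear map is antilinear. -/
def IsAnti (T : V → V) : Prop := ∀ v, T (Complex.I • v) = -(Complex.I • T v)

theorem antiPart_I (g : V ≃L[ℝ] V) : IsAnti (antiPart g) := by
  intro v
  rw [antiPart, antiPart, smul_smul Complex.I Complex.I, Complex.I_mul_I, neg_one_smul, map_neg]
  simp only [smul_add, smul_neg]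
  have h4 : Complex.I * Complex.I = -1 := Complex.I_mul_I
  match_scalars
  · linear_combination (1 / 2 : ℂ) * h4
  · ring

theorem antiPart_add (g : V ≃L[ℝ] V) (v w : V) :
    antiPart g (v + w) = antiPart g v + antiPart g w := by
  simp only [antiPart, smul_add, map_add]
  module

theorem antiPart_real_smul (g : V ≃L[ℝ] V) (r : ℝ) (v : V) :
    antiPart g (r • v) = r • antiPart g v := by
  simp only [antiPart]
  rw [smul_comm Complex.I r v, map_smul, map_smul, smul_comm Complex.I r, ← smul_add, smul_comm]

theorem smul_of_isAnti {T : V →L[ℝ] V} (hT : IsAnti T) (c : ℂ) (v : V) :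
    T (c • v) = (starRingEnd ℂ c) • T v := by
  conv_lhs => rw [← Complex.re_add_im c]
  rw [add_smul, map_add, mul_smul, Complex.coe_smul, Complex.coe_smul, map_smul, map_smul, hT]
  have : (starRingEnd ℂ) c = c.re - c.im * Complex.I := by
    apply Complex.ext <;> simp
  rw [this, sub_smul, mul_smul, Complex.coe_smul, Complex.coe_smul]
  module

/-- A decomposition into a linear and an antilinear part is unique. -/
theorem linear_anti_unique {S T : V → V} (hS : ∀ v, S (Complex.I • v) = Complex.I • S v)
    (hT : IsAnti T) (h : ∀ v, S v + T v = 0) (v : V) : S v = 0 ∧ T v = 0 := by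
  have h1 := h v
  have h2 := h (Complex.I • v)
  rw [hS, hT, ← smul_neg, ← smul_add] at h2
  have h3 : S v + -T v = 0 := (smul_eq_zero.1 h2).resolve_left Complex.I_ne_zero
  have h4 : S v = T v := by rwa [← sub_eq_add_neg, sub_eq_zero] at h3
  rw [h4] at h1
  have h5 : T v = 0 := by
    have : (2 : ℂ) • T v = 0 := by rw [two_smul]; exact h1
    exact (smul_eq_zero.1 this).resolve_left two_ne_zero
  exact ⟨h4.trans h5, h5⟩

/-- Of the four products of parts in `g ∘ k`, two are complex linear and two antilinear, and the
decomposition into such parts is unique. -/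
theorem mul_parts (g k : V ≃L[ℝ] V) (v : V) :
    linPart (g * k) v = linPart g (linPart k v) + antiPart g (antiPart k v) ∧
    antiPart (g * k) v = linPart g (antiPart k v) + antiPart g (linPart k v) := by
  have h1 : ∀ v, (linPart (g * k) v - (linPart g (linPart k v) + antiPart g (antiPart k v)))
      + (antiPart (g * k) v - (linPart g (antiPart k v) + antiPart g (linPart k v))) = 0 := by
    intro v
    have e : g (k v) = (g * k) v := rfl
    rw [← linPart_add_antiPart (g * k), ← linPart_add_antiPart g, ← linPart_add_antiPart k,
      map_add, antiPart_add] at e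
    rw [← sub_eq_zero] at e
    rw [← neg_eq_zero, ← e]
    abel
  have := linear_anti_unique ?_ ?_ h1 v
  · exact ⟨sub_eq_zero.1 this.1, sub_eq_zero.1 this.2⟩
  · intro v
    simp only [map_smul, antiPart_I k v, smul_sub, smul_add]
    rw [← neg_one_smul ℝ (Complex.I • _), antiPart_real_smul, antiPart_I g]
    simp
  · intro v
    simp only [map_smul, antiPart_I k v, antiPart_I (g * k) v, map_neg, smul_sub, smul_add]
    rw [antiPart_I g (linPart k v)]
    abel

theorem Om_apply_left {g : V ≃L[ℝ] V} (hg : g ∈ Sp V) (v w : V) :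
    Om (g v) w = Om v (g⁻¹ w) := by
  have := hg v (g⁻¹ w)
  rwa [show g (g⁻¹ w) = w from g.apply_symm_apply w] at this

theorem Om_add_right (u v w : V) : Om u (v + w) = Om u v + Om u w := by
  simp [Om_eq_im]
theorem Om_add_left (u v w : V) : Om (u + v) w = Om u w + Om v w := by
  simp [Om_eq_im]
theorem Om_sub_right (u v w : V) : Om u (v - w) = Om u v - Om u w := by
  simp [Om_eq_im]
theorem Om_sub_left (u v w : V) : Om (u - v) w = Om u w - Om v w := by
  simp [Om_eq_im]

theorem Om_linPart {g : V ≃L[ℝ] V} (hg : g ∈ Sp V) (v w : V) :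
    Om (linPart g v) w = Om v (linPart g⁻¹ w) := by
  have e : ∀ x y : V, Om ((1 / 2 : ℂ) • x) y = 1 / 2 * Om x y := fun x y => by
    simp [Om_eq_im, mul_comm]
  have e' : ∀ x y : V, Om x ((1 / 2 : ℂ) • y) = 1 / 2 * Om x y := fun x y => by
    simp [Om_eq_im]
  rw [linPart_apply, linPart_apply, e, e', Om_sub_left, Om_sub_right, Om_smul_I_left,
    Om_apply_left hg, Om_apply_left hg, Om_smul_I_left]
  ring

theorem Om_antiPart {g : V ≃L[ℝ] V} (hg : g ∈ Sp V) (v w : V) :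
    Om (antiPart g v) w = Om v (antiPart g⁻¹ w) := by
  have e : ∀ x y : V, Om ((1 / 2 : ℂ) • x) y = 1 / 2 * Om x y := fun x y => by
    simp [Om_eq_im, mul_comm]
  have e' : ∀ x y : V, Om x ((1 / 2 : ℂ) • y) = 1 / 2 * Om x y := fun x y => by
    simp [Om_eq_im]
  rw [antiPart, antiPart, e, e', Om_add_left, Om_add_right, Om_smul_I_left,
    Om_apply_left hg, Om_apply_left hg, Om_smul_I_left]
  ring

/-- The `Ω`-adjoint of `g` is `g⁻¹`. Replacing `w` by `i w` recovers the real part of the Hermitian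
product, so the adjoint of `C_g` is `C_{g⁻¹}`. -/
theorem inner_linPart {g : V ≃L[ℝ] V} (hg : g ∈ Sp V) (v w : V) :
    (inner ℂ (linPart g v) w : ℂ) = inner ℂ v (linPart g⁻¹ w) := by
  rw [inner_eq_Om, inner_eq_Om v, Om_linPart hg, Om_linPart hg, map_smul]

/-- The sign, compared with the linear part, appears because `D_{g⁻¹}` anticommutes with `i`. -/
theorem inner_antiPart {g : V ≃L[ℝ] V} (hg : g ∈ Sp V) (v w : V) :
    (inner ℂ (antiPart g v) w : ℂ) = -inner ℂ (antiPart g⁻¹ w) v := by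
  rw [inner_eq_Om, ← inner_conj_symm, inner_eq_Om v, Om_antiPart hg, Om_antiPart hg, antiPart_I]
  have : ∀ x y : V, Om x (-y) = -Om x y := fun x y => by simp [Om_eq_im]
  rw [this]
  simp [add_comm]

theorem linPart_one : linPart (1 : V ≃L[ℝ] V) = 1 := by
  ext v
  exact cpart_apply_of_comm (T := ContinuousLinearMap.id ℝ V) (fun _ => rfl) v

theorem antiPart_one (v : V) : antiPart (1 : V ≃L[ℝ] V) v = 0 := by
  have := linPart_add_antiPart (1 : V ≃L[ℝ] V) v
  rw [linPart_one] at this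
  exact add_eq_left.1 this

theorem linPart_inv_mul (g : V ≃L[ℝ] V) (v : V) :
    linPart g⁻¹ (linPart g v) + antiPart g⁻¹ (antiPart g v) = v := by
  rw [← (mul_parts g⁻¹ g v).1, inv_mul_cancel, linPart_one]; rfl

theorem antiPart_inv_mul (g : V ≃L[ℝ] V) (v : V) :
    linPart g⁻¹ (antiPart g v) + antiPart g⁻¹ (linPart g v) = 0 := by
  rw [← (mul_parts g⁻¹ g v).2, inv_mul_cancel, antiPart_one]

/-- Pair `C_{g⁻¹} C_g + D_{g⁻¹} D_g = 1` with `v` and use the two adjoint formulas. Both the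
invertibility of `C_g` and the contractivity of `Z_g` come from this identity. -/
theorem norm_sq_linPart {g : V ≃L[ℝ] V} (hg : g ∈ Sp V) (v : V) :
    ‖linPart g v‖ ^ 2 = ‖v‖ ^ 2 + ‖antiPart g v‖ ^ 2 := by
  have h1 := inner_linPart hg v (linPart g v)
  have h2 := inner_antiPart hg v (antiPart g v)
  have h3 := congrArg (fun x => (inner ℂ v x : ℂ)) (linPart_inv_mul g v)
  simp only [inner_add_right] at h3
  have h4 : (inner ℂ v (antiPart g⁻¹ (antiPart g v)) : ℂ)
      = -(starRingEnd ℂ) (inner ℂ (antiPart g v) (antiPart g v)) := by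
    rw [h2, map_neg, inner_conj_symm, neg_neg]
  rw [← h1, h4, inner_self_eq_norm_sq_to_K, inner_self_eq_norm_sq_to_K,
    inner_self_eq_norm_sq_to_K] at h3
  have h5 := congrArg Complex.re h3
  simp only [Complex.coe_algebraMap, ← Complex.ofReal_pow, Complex.conj_ofReal, Complex.add_re,
    Complex.neg_re, Complex.ofReal_re] at h5
  linarith

/-- The Siegel disc: antilinear, symmetric, strictly contractive maps. -/
structure IsSiegel (Z : V →L[ℝ] V) : Prop where
  anti : IsAnti Z
  symm : ∀ v w, (inner ℂ (Z v) w : ℂ) = inner ℂ (Z w) v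
  norm_lt : ‖Z‖ < 1

variable [FiniteDimensional ℂ V]

theorem isUnit_linPart {g : V ≃L[ℝ] V} (hg : g ∈ Sp V) : IsUnit (linPart g) := by
  rw [LinearMap.isUnit_iff_ker_eq_bot, LinearMap.ker_eq_bot']
  intro v hv
  have := norm_sq_linPart hg v
  rw [hv, norm_zero] at this
  have h1 : ‖v‖ ^ 2 = 0 := by nlinarith [sq_nonneg ‖v‖, sq_nonneg ‖antiPart g v‖]
  simpa using h1

theorem linPart_linPartInv {g : V ≃L[ℝ] V} (hg : g ∈ Sp V) (v : V) :
    linPart g (linPartInv g v) = v :=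
  LinearMap.congr_fun (Ring.mul_inverse_cancel _ (isUnit_linPart hg)) v

theorem linPartInv_linPart {g : V ≃L[ℝ] V} (hg : g ∈ Sp V) (v : V) :
    linPartInv g (linPart g v) = v :=
  LinearMap.congr_fun (Ring.inverse_mul_cancel _ (isUnit_linPart hg)) v

theorem inner_linPartInv {g : V ≃L[ℝ] V} (hg : g ∈ Sp V) (v w : V) :
    (inner ℂ (linPartInv g v) w : ℂ) = inner ℂ v (linPartInv g⁻¹ w) := by
  have h := inner_linPart hg (linPartInv g v) (linPartInv g⁻¹ w)
  rw [linPart_linPartInv hg, linPart_linPartInv ((Sp V).inv_mem hg)] at h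
  exact h.symm

/-- `Z_g` as a continuous real linear map. -/
def ZL (g : V ≃L[ℝ] V) : V →L[ℝ] V :=
  haveI : FiniteDimensional ℝ V := FiniteDimensional.complexToReal V
  LinearMap.toContinuousLinearMap
    { toFun := Zmap g
      map_add' := fun v w => by simp [Zmap, antiPart_add]
      map_smul' := fun r v => by
        simp only [Zmap, antiPart_real_smul, RingHom.id_apply]
        rw [← Complex.coe_smul, map_smul, Complex.coe_smul] }

theorem ZL_apply (g : V ≃L[ℝ] V) (v : V) : ZL g v = Zmap g v := rfl

theorem linPart_ZL {g : V ≃L[ℝ] V} (hg : g ∈ Sp V) (v : V) :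
    linPart g (ZL g v) = antiPart g v := linPart_linPartInv hg _

/-- The antilinear part of `g⁻¹ g = 1`, divided by `C_{g⁻¹}`. It writes `D_g` with `C_g` on the
right, which brings `Z_{k⁻¹}` into the product formula. -/
theorem ZL_inv_linPart {g : V ≃L[ℝ] V} (hg : g ∈ Sp V) (v : V) :
    ZL g⁻¹ (linPart g v) = -antiPart g v := by
  have h := antiPart_inv_mul g v
  rw [← linPart_ZL ((Sp V).inv_mem hg), ← map_add] at h
  have h2 := (isUnit_linPart ((Sp V).inv_mem hg))
  have h3 := congrArg (linPartInv g⁻¹) h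
  rw [linPartInv_linPart ((Sp V).inv_mem hg), map_zero] at h3
  exact eq_neg_of_add_eq_zero_right h3

theorem ZL_linPart_inv {g : V ≃L[ℝ] V} (hg : g ∈ Sp V) (v : V) :
    ZL g (linPart g⁻¹ v) = -antiPart g⁻¹ v := by
  simpa using ZL_inv_linPart ((Sp V).inv_mem hg) v

theorem isAnti_ZL (g : V ≃L[ℝ] V) : IsAnti (ZL g) := fun v => by
  rw [ZL_apply, ZL_apply, Zmap, Zmap, antiPart_I, map_neg, map_smul]

theorem linPart_one_add_ZL {g : V ≃L[ℝ] V} (hg : g ∈ Sp V) (v : V) :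
    linPart g (v + ZL g v) = g v := by
  rw [map_add, linPart_ZL hg, linPart_add_antiPart]

theorem inner_ZL_symm {g : V ≃L[ℝ] V} (hg : g ∈ Sp V) (v w : V) :
    (inner ℂ (ZL g v) w : ℂ) = inner ℂ (ZL g w) v := by
  rw [ZL_apply, Zmap, inner_linPartInv hg, inner_antiPart hg,
    ← neg_neg (antiPart g⁻¹ _), ← ZL_linPart_inv hg, linPart_linPartInv ((Sp V).inv_mem hg),
    inner_neg_left, neg_neg]

/-- On `v = C_{g⁻¹} u` one has `|Z_g v|² = |D_{g⁻¹} u|² = |v|² - |u|²`, and `|u| ≥ |v| / c` makes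
the contraction strict uniformly in `v`. -/
theorem norm_ZL_lt {g : V ≃L[ℝ] V} (hg : g ∈ Sp V) : ‖ZL g‖ < 1 := by
  set T : V →L[ℂ] V := LinearMap.toContinuousLinearMap (linPart g⁻¹)
  -- The summand 1 keeps `c ≥ 1` even if `V = 0`, so that `1 - 1 / c²` is nonnegative.
  set c : ℝ := ‖T‖ + 1
  have hc : 0 < c := by positivity
  have hc1 : 1 ≤ c := by simp [c]
  have hk : 0 ≤ 1 - 1 / c ^ 2 := by
    have : 1 / c ^ 2 ≤ 1 := by
      rw [div_le_one (by positivity)]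
      nlinarith
    linarith
  have hk1 : √(1 - 1 / c ^ 2) < 1 := by
    rw [Real.sqrt_lt' one_pos]
    have : 0 < 1 / c ^ 2 := by positivity
    linarith
  refine lt_of_le_of_lt ((ZL g).opNorm_le_bound (Real.sqrt_nonneg (1 - 1 / c ^ 2)) ?_) hk1
  intro v
  obtain ⟨u, rfl⟩ : ∃ u, linPart g⁻¹ u = v :=
    ⟨linPartInv g⁻¹ v, linPart_linPartInv ((Sp V).inv_mem hg) v⟩
  rw [ZL_linPart_inv hg, norm_neg]
  have h1 := norm_sq_linPart ((Sp V).inv_mem hg) u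
  have h2 : ‖linPart g⁻¹ u‖ ≤ c * ‖u‖ := by
    have : ‖T u‖ ≤ ‖T‖ * ‖u‖ := T.le_opNorm u
    calc ‖linPart g⁻¹ u‖ ≤ ‖T‖ * ‖u‖ := this
      _ ≤ c * ‖u‖ := by gcongr; simp [c]
  refine le_of_sq_le_sq ?_ (by positivity)
  rw [mul_pow, Real.sq_sqrt hk, sub_mul, one_mul]
  have h3 : ‖linPart g⁻¹ u‖ ^ 2 ≤ c ^ 2 * ‖u‖ ^ 2 := by
    rw [← mul_pow]; gcongr
  have h4 : 1 / c ^ 2 * ‖linPart g⁻¹ u‖ ^ 2 ≤ ‖u‖ ^ 2 := by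
    rw [one_div, inv_mul_le_iff₀ (by positivity)]
    exact h3
  linarith

theorem isSiegel_ZL {g : V ≃L[ℝ] V} (hg : g ∈ Sp V) : IsSiegel (ZL g) :=
  ⟨isAnti_ZL g, inner_ZL_symm hg, norm_ZL_lt hg⟩

omit [FiniteDimensional ℂ V] in
theorem cpart_comp_apply {W Z : V →L[ℝ] V} (hW : IsAnti W) (hZ : IsAnti Z) (v : V) :
    cpart (W ∘L Z) v = W (Z v) := by
  refine cpart_apply_of_comm (fun v => ?_) v
  change W (Z (Complex.I • v)) = Complex.I • W (Z v)
  rw [hZ, map_neg, hW, neg_neg]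

/-- In `C_g C_k + D_g D_k` substitute `D_g = C_g Z_g` and `D_k = -Z_{k⁻¹} C_k`. The middle factor is
the source of every determinant below. -/
theorem linPart_mul {g k : V ≃L[ℝ] V} (hg : g ∈ Sp V) (hk : k ∈ Sp V) :
    linPart (g * k) = linPart g * (1 - cpart (ZL g ∘L ZL k⁻¹)) * linPart k := by
  ext v
  rw [(mul_parts g k v).1]
  simp only [Module.End.mul_apply, LinearMap.sub_apply, Module.End.one_apply, map_sub]
  rw [cpart_comp_apply (isAnti_ZL g) (isAnti_ZL k⁻¹), ZL_inv_linPart hk, map_neg, map_neg,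
    linPart_ZL hg, sub_neg_eq_add]

end LinearAlgebra

/-! ### Every point of the Siegel disc comes from a symplectic map -/

section SiegelSurjective

variable {V : Type*} [NormedAddCommGroup V] [InnerProductSpace ℂ V]

theorem IsSiegel.neg {Z : V →L[ℝ] V} (hZ : IsSiegel Z) : IsSiegel (-Z) where
  anti v := by simp [hZ.anti v]
  symm v w := by simp [hZ.symm v w]
  norm_lt := by simpa using hZ.norm_lt

theorem IsSiegel.norm_apply_lt {Z : V →L[ℝ] V} (hZ : IsSiegel Z) {v : V} (hv : v ≠ 0) :
    ‖Z v‖ < ‖v‖ :=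
  (Z.le_opNorm v).trans_lt (by
    have := hZ.norm_lt
    have h2 : 0 < ‖v‖ := norm_pos_iff.2 hv
    nlinarith)

theorem IsSiegel.injective_one_add {Z : V →L[ℝ] V} (hZ : IsSiegel Z) :
    Function.Injective (1 + Z : V →L[ℝ] V) := by
  rw [injective_iff_map_eq_zero]
  intro v hv
  by_contra h
  have h1 : v + Z v = 0 := hv
  have h2 := hZ.norm_apply_lt h
  rw [← neg_eq_of_add_eq_zero_right h1, norm_neg] at h2
  exact lt_irrefl _ h2

theorem IsSiegel.Om_apply {Z : V →L[ℝ] V} (hZ : IsSiegel Z) (v w : V) :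
    Om (Z v) w = -Om v (Z w) := by
  rw [Om_eq_im, Om_eq_im, hZ.symm, ← inner_conj_symm, Complex.conj_im]

variable [FiniteDimensional ℂ V]

theorem IsSiegel.bijective_one_add {Z : V →L[ℝ] V} (hZ : IsSiegel Z) :
    Function.Bijective (1 + Z : V →L[ℝ] V) := by
  have : FiniteDimensional ℝ V := FiniteDimensional.complexToReal V
  exact ⟨hZ.injective_one_add,
    (LinearMap.injective_iff_surjective (f := ((1 + Z : V →L[ℝ] V) : V →ₗ[ℝ] V))).1
      hZ.injective_one_add⟩

/-- A positive definite operator is the square of an invertible self-adjoint operator. -/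
theorem exists_inverse_sqrt (T : V →ₗ[ℂ] V) (hT : T.IsPositive) (hinj : Function.Injective T) :
    ∃ C : V ≃ₗ[ℂ] V, (∀ v, C (C (T v)) = v) ∧
      ∀ v w, (inner ℂ (C v) w : ℂ) = inner ℂ v (C w) := by
  have : CompleteSpace V := FiniteDimensional.complete ℂ V
  set T' : V →L[ℂ] V := LinearMap.toContinuousLinearMap T
  have hT' : 0 ≤ T' := (ContinuousLinearMap.nonneg_iff_isPositive T').2
    ((LinearMap.isPositive_toContinuousLinearMap_iff T).2 hT)
  set S : V →L[ℂ] V := CFC.sqrt T'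
  have hS : S * S = T' := CFC.sqrt_mul_sqrt_self T' hT'
  have hSa : IsSelfAdjoint S := (CFC.sqrt_nonneg T').isSelfAdjoint
  have hSS : ∀ v, S (S v) = T v := fun v => by
    change (S * S) v = T v
    rw [hS]; rfl
  have hSi : Function.Injective (S : V →ₗ[ℂ] V) := by
    intro a b hab
    apply hinj
    rw [← hSS, ← hSS]
    exact congrArg S hab
  let e : V ≃ₗ[ℂ] V := LinearEquiv.ofInjectiveEndo (S : V →ₗ[ℂ] V) hSi
  have he : ∀ v, e v = S v := fun v => rfl
  refine ⟨e.symm, fun v => ?_, fun v w => ?_⟩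
  · rw [LinearEquiv.symm_apply_eq, LinearEquiv.symm_apply_eq, he, he, hSS]
  · obtain ⟨a, rfl⟩ := e.surjective v
    obtain ⟨b, rfl⟩ := e.surjective w
    rw [e.symm_apply_apply, e.symm_apply_apply, he, he]
    exact (hSa.isSymmetric a b).symm

/-- Every point of the Siegel disc is of the form `Z_g`. -/
theorem IsSiegel.exists_ZL_eq {Z : V →L[ℝ] V} (hZ : IsSiegel Z) : ∃ g ∈ Sp V, ZL g = Z := by
  have : FiniteDimensional ℝ V := FiniteDimensional.complexToReal V
  -- If `Z_g = Z` then `g = C (1 + Z)` with `C* C = (1 - Z²)⁻¹`. The self-adjoint choice of `C` is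
  -- the inverse square root of `T = 1 - Z²`, which is positive because `Z` is a symmetric
  -- contraction.
  set T : V →ₗ[ℂ] V := 1 - cpart (Z ∘L Z)
  have hTa : ∀ v, T v = v - Z (Z v) := fun v => by
    simp only [T, LinearMap.sub_apply, Module.End.one_apply]
    rw [cpart_comp_apply hZ.anti hZ.anti]
  have hin : ∀ v, (inner ℂ (T v) v : ℂ) = ((‖v‖ ^ 2 - ‖Z v‖ ^ 2 : ℝ) : ℂ) := fun v => by
    rw [hTa, inner_sub_left, hZ.symm (Z v) v, inner_self_eq_norm_sq_to_K,
      inner_self_eq_norm_sq_to_K]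
    push_cast
    rfl
  have hle : ∀ v, ‖Z v‖ ≤ ‖v‖ := fun v => (Z.le_opNorm v).trans
    (by nlinarith [hZ.norm_lt, norm_nonneg v])
  have hTp : T.IsPositive := by
    rw [LinearMap.isPositive_iff_complex]
    intro v
    rw [hin]
    refine ⟨rfl, ?_⟩
    change 0 ≤ ‖v‖ ^ 2 - ‖Z v‖ ^ 2
    have := hle v
    nlinarith [norm_nonneg (Z v)]
  have hTi : Function.Injective T := by
    rw [injective_iff_map_eq_zero]
    intro v hv
    by_contra h
    have h1 := hZ.norm_apply_lt h
    have h2 := hin v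
    rw [hv, inner_zero_left] at h2
    have h3 : (0 : ℝ) = ‖v‖ ^ 2 - ‖Z v‖ ^ 2 := by exact_mod_cast h2
    nlinarith [norm_nonneg (Z v)]
  obtain ⟨C, hC1, hC2⟩ := exists_inverse_sqrt T hTp hTi
  let e1 : V ≃ₗ[ℝ] V := LinearEquiv.ofBijective ((1 + Z : V →L[ℝ] V) : V →ₗ[ℝ] V)
    hZ.bijective_one_add
  let g : V ≃L[ℝ] V := (e1.trans (C.restrictScalars ℝ)).toContinuousLinearEquiv
  have hg : ∀ v, g v = C (v + Z v) := fun v => rfl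
  have hgs : g ∈ Sp V := by
    intro v w
    -- With `w = (1 - Z) w'` the vector `g w` becomes `C T w'`, and the two factors `C` then cancel
    -- `T`.
    obtain ⟨w', rfl⟩ := hZ.neg.bijective_one_add.2 w
    have e2 : (1 + -Z) w' = w' - Z w' := by simp [sub_eq_add_neg]
    rw [e2, hg, hg]
    have e3 : w' - Z w' + Z (w' - Z w') = T w' := by
      rw [hTa, map_sub]; abel
    rw [e3, Om_eq_im, hC2, hC1, ← Om_eq_im, Om_add_left, Om_sub_right, hZ.Om_apply]
    ring
  refine ⟨g, hgs, ?_⟩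
  have h1 : ∀ v, linPart g v = C v := fun v => by
    rw [linPart_apply, hg, hg, hZ.anti, map_add, map_add, map_neg, map_smul, map_smul, smul_add,
      smul_neg, smul_smul, smul_smul, Complex.I_mul_I]
    module
  ext v
  apply C.injective
  rw [← h1, linPart_ZL hgs]
  have h2 := linPart_add_antiPart g v
  rw [h1, hg, map_add] at h2
  exact add_left_cancel h2

end SiegelSurjective

/-! ### The Fock space inside `L²` of a Gaussian measure, and its reproducing kernel -/

section FockHilbert

open Filter Topology ComplexConjugate

variable {V : Type*} [NormedAddCommGroup V] [InnerProductSpace ℂ V] [FiniteDimensional ℂ V]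
  [MeasurableSpace V] [BorelSpace V]

theorem hbar_pos (h : ℝ) [hh : Fact (0 < h)] : 0 < hbar h := div_pos hh.out (by positivity)

variable (V) in
/-- The Gaussian weight, as a `ℝ≥0`-valued density. -/
def gaussDensity (h : ℝ) (z : V) : NNReal :=
  Real.toNNReal ((h ^ Module.finrank ℂ V)⁻¹ * Real.exp (-(‖z‖ ^ 2 / (2 * hbar h))))

variable (V) in
/-- The Gaussian measure on `V` for which `ℋ(V, Ω, j)` is the space of square integrable
holomorphic functions. -/
def gauss (h : ℝ) : Measure V := (lebesgue V).withDensity fun z => gaussDensity V h z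

omit [FiniteDimensional ℂ V] in
theorem measurable_gaussDensity (h : ℝ) : Measurable (gaussDensity V h) := by
  unfold gaussDensity
  fun_prop

variable {h : ℝ} [hh : Fact (0 < h)]

omit [FiniteDimensional ℂ V] [MeasurableSpace V] [BorelSpace V] in
theorem coe_gaussDensity (z : V) : (gaussDensity V h z : ℝ)
    = (h ^ Module.finrank ℂ V)⁻¹ * Real.exp (-(‖z‖ ^ 2 / (2 * hbar h))) := by
  have := hh.out
  exact Real.coe_toNNReal _ (by positivity)

theorem integral_gauss {F : Type*} [NormedAddCommGroup F] [NormedSpace ℝ F] (f : V → F) :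
    ∫ z, f z ∂(gauss V h) = (h ^ Module.finrank ℂ V)⁻¹ •
      ∫ z, Real.exp (-(‖z‖ ^ 2 / (2 * hbar h))) • f z ∂(lebesgue V) := by
  rw [gauss, integral_withDensity_eq_integral_smul (measurable_gaussDensity h), ← integral_smul]
  congr 1
  ext z
  rw [NNReal.smul_def, coe_gaussDensity, mul_smul]

theorem integrable_gauss_iff {F : Type*} [NormedAddCommGroup F] [NormedSpace ℝ F] (f : V → F) :
    Integrable f (gauss V h) ↔
      Integrable (fun z => Real.exp (-(‖z‖ ^ 2 / (2 * hbar h))) • f z) (lebesgue V) := by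
  have := hh.out
  rw [gauss, integrable_withDensity_iff_integrable_smul (measurable_gaussDensity h)]
  have e : (fun z => gaussDensity V h z • f z) = fun z =>
      (h ^ Module.finrank ℂ V)⁻¹ • (Real.exp (-(‖z‖ ^ 2 / (2 * hbar h))) • f z) := by
    ext z
    rw [NNReal.smul_def, coe_gaussDensity, mul_smul]
  rw [e]
  exact integrable_fun_smul_iff (by positivity) _

omit [MeasurableSpace V] [BorelSpace V] [FiniteDimensional ℂ V] in
theorem finrank_real_eq : Module.finrank ℝ V = 2 * Module.finrank ℂ V :=
  finrank_real_of_complex V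

theorem integral_gaussian_lebesgue {b : ℝ} (hb : 0 < b) :
    ∫ z, Real.exp (-b * ‖z‖ ^ 2) ∂(lebesgue V) = (Real.pi / b) ^ Module.finrank ℂ V := by
  let _ : InnerProductSpace ℝ V := InnerProductSpace.complexToReal
  have : FiniteDimensional ℝ V := FiniteDimensional.complexToReal V
  have h1 := GaussianFourier.integral_rexp_neg_mul_sq_norm (V := V) hb
  rw [finrank_real_eq] at h1
  rw [Nat.cast_mul, Nat.cast_ofNat, mul_div_cancel_left₀ _ two_ne_zero, Real.rpow_natCast] at h1
  exact h1

theorem integrable_gaussian_lebesgue {b : ℝ} (hb : 0 < b) :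
    Integrable (fun z : V => Real.exp (-b * ‖z‖ ^ 2)) (lebesgue V) := by
  refine MeasureTheory.Integrable.of_integral_ne_zero ?_
  rw [integral_gaussian_lebesgue hb]
  positivity

/-- The total mass of the weight is `(2πħ)^n = h^n`, which the factor `h^{-n}` removes. -/
instance : IsProbabilityMeasure (gauss V h) := by
  have hb := hbar_pos h
  have := hh.out
  have h1 : ∫ _z, (1 : ℝ) ∂(gauss V h) = 1 := by
    rw [integral_gauss]
    have e : ∀ z : V, Real.exp (-(‖z‖ ^ 2 / (2 * hbar h))) • (1 : ℝ)
        = Real.exp (-(1 / (2 * hbar h)) * ‖z‖ ^ 2) := fun z => by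
      rw [smul_eq_mul, mul_one]; congr 1; ring
    simp only [e]
    rw [integral_gaussian_lebesgue (by positivity)]
    have : Real.pi / (1 / (2 * hbar h)) = h := by
      rw [hbar]; field_simp
    rw [this, smul_eq_mul, inv_mul_cancel₀ (by positivity)]
  rw [integral_const, smul_eq_mul, mul_one] at h1
  refine ⟨?_⟩
  rw [measureReal_def] at h1
  have h2 := ENNReal.ofReal_toReal (a := (gauss V h) univ) (by
    intro h3; rw [h3, ENNReal.toReal_top] at h1; exact zero_ne_one h1)
  rw [← h2, h1, ENNReal.ofReal_one]

theorem gauss_absolutelyContinuous : lebesgue V ≪ gauss V h := by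
  have := hh.out
  refine withDensity_absolutelyContinuous' (measurable_gaussDensity h).coe_nnreal_ennreal.aemeasurable
    (Eventually.of_forall fun z => ?_)
  have : 0 < (gaussDensity V h z : ℝ) := by
    rw [coe_gaussDensity]; positivity
  have h2 : 0 < gaussDensity V h z := by exact_mod_cast this
  exact ENNReal.coe_ne_zero.2 h2.ne'

instance : (gauss V h).IsOpenPosMeasure := gauss_absolutelyContinuous.isOpenPosMeasure

omit hh in
-- Applied to the rotations `z ↦ e^{iθ} z` in the mean value argument and to the conjugation which
-- fixes a Lagrangian subspace; the weight depends on the norm alone.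
theorem measurePreserving_gauss (e : V ≃ₗᵢ[ℝ] V) :
    MeasurePreserving e (gauss V h) (gauss V h) := by
  have h1 : MeasurePreserving e (lebesgue V) (lebesgue V) := by
    let _ : InnerProductSpace ℝ V := InnerProductSpace.complexToReal
    have : FiniteDimensional ℝ V := FiniteDimensional.complexToReal V
    exact e.measurePreserving
  refine ⟨h1.measurable, ?_⟩
  ext s hs
  rw [Measure.map_apply h1.measurable hs, gauss, withDensity_apply _ hs,
    withDensity_apply _ (h1.measurable hs)]
  have e2 : (fun z => (gaussDensity V h z : ENNReal)) = fun z => (gaussDensity V h (e z) : ENNReal) := by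
    ext z
    simp [gaussDensity]
  rw [e2]
  refine Eq.trans ?_ (h1.setLIntegral_comp_preimage hs
    (f := fun z => (gaussDensity V h (e z) : ENNReal)) (by
      exact (measurable_gaussDensity h).coe_nnreal_ennreal.comp h1.measurable))
  have e3 : ∀ z, (gaussDensity V h (e (e z)) : ENNReal) = gaussDensity V h (e z) := fun z => by
    simp [gaussDensity]
  exact lintegral_congr fun z => (e3 z).symm

theorem memLp_fock (f : Fock V h) : MemLp f.1 2 (gauss V h) := by
  rw [memLp_two_iff_integrable_sq_norm f.2.1.continuous.aestronglyMeasurable,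
    integrable_gauss_iff]
  exact f.2.2.congr (Eventually.of_forall fun z => mul_comm _ _)

theorem mem_fock_iff {f : V → ℂ} : f ∈ Fock V h ↔ Differentiable ℂ f ∧ MemLp f 2 (gauss V h) := by
  refine ⟨fun hf => ⟨hf.1, memLp_fock ⟨f, hf⟩⟩, fun hf => ⟨hf.1, ?_⟩⟩
  have := hf.2
  rw [memLp_two_iff_integrable_sq_norm hf.1.continuous.aestronglyMeasurable,
    integrable_gauss_iff] at this
  exact this.congr (Eventually.of_forall fun z => mul_comm _ _)

/-- The inclusion of the Fock space in `L²`. -/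
def toL2 : Fock V h →ₗ[ℂ] Lp ℂ 2 (gauss V h) where
  toFun f := (memLp_fock f).toLp f.1
  map_add' _ _ := rfl
  map_smul' _ _ := rfl

theorem toL2_ae (f : Fock V h) : toL2 f =ᵐ[gauss V h] f.1 := (memLp_fock f).coeFn_toLp

theorem inner_toL2 (f g : Fock V h) :
    (inner ℂ (toL2 f) (toL2 g) : ℂ) = ∫ z, g.1 z * conj (f.1 z) ∂(gauss V h) := by
  rw [L2.inner_def]
  refine integral_congr_ae ?_
  filter_upwards [toL2_ae f, toL2_ae g] with z h1 h2
  rw [h1, h2]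
  rfl

theorem norm_toL2_sq (f : Fock V h) : ‖toL2 f‖ ^ 2 = normSq f := by
  have h1 := inner_self_eq_norm_sq (𝕜 := ℂ) (toL2 f)
  rw [← h1, inner_toL2, integral_gauss, normSq]
  have e : ∀ z, Real.exp (-(‖z‖ ^ 2 / (2 * hbar h))) • (f.1 z * conj (f.1 z))
      = ((‖f.1 z‖ ^ 2 * Real.exp (-(‖z‖ ^ 2 / (2 * hbar h))) : ℝ) : ℂ) := fun z => by
    rw [Complex.mul_conj, Complex.real_smul, Complex.normSq_eq_norm_sq]
    push_cast; ring
  simp only [e]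
  rw [integral_complex_ofReal]
  simp only [RCLike.re_to_complex, Complex.real_smul, ← Complex.ofReal_mul, Complex.ofReal_re]

theorem toL2_injective : Function.Injective (toL2 (V := V) (h := h)) := by
  intro f g hfg
  have h1 : f.1 =ᵐ[gauss V h] g.1 := (toL2_ae f).symm.trans (hfg ▸ toL2_ae g)
  exact Subtype.ext (f.2.1.continuous.ae_eq_iff_eq _ g.2.1.continuous |>.1 h1)

variable (V h) in
/-- The Fock space as a subspace of `L²`. -/
def FockL2 : Submodule ℂ (Lp ℂ 2 (gauss V h)) := LinearMap.range toL2

variable (V h) in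
/-- The Fock space as a Hilbert space. -/
def FockH : Type _ := FockL2 V h

instance : NormedAddCommGroup (FockH V h) := Submodule.normedAddCommGroup (FockL2 V h)

instance : InnerProductSpace ℂ (FockH V h) := Submodule.innerProductSpace (FockL2 V h)

instance : Inner ℂ (FockH V h) := InnerProductSpace.toInner

/-- The identification of the Fock space with a Hilbert space. -/
def toH : Fock V h ≃ₗ[ℂ] FockH V h := LinearEquiv.ofInjective toL2 toL2_injective

theorem inner_toH (f g : Fock V h) :
    (inner ℂ (toH f) (toH g) : ℂ) = ∫ z, g.1 z * conj (f.1 z) ∂(gauss V h) := inner_toL2 f g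

theorem norm_toH_sq (f : Fock V h) : ‖toH f‖ ^ 2 = normSq f := norm_toL2_sq f

/-- By polarisation. The group `Mpc` and the Heisenberg operators are controlled through norms,
while the arguments below use inner products. -/
theorem isometry_inner (T S : Fock V h →ₗ[ℂ] Fock V h) (hT : ∀ f, normSq (T f) = normSq (S f))
    (f g : Fock V h) : (inner ℂ (toH (T f)) (toH (T g)) : ℂ) = inner ℂ (toH (S f)) (toH (S g)) := by
  have h1 : ∀ f, ‖toH (T f)‖ = ‖toH (S f)‖ := fun f => by
    have := hT f
    rw [← norm_toH_sq, ← norm_toH_sq] at this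
    exact (pow_left_inj₀ (norm_nonneg _) (norm_nonneg _) two_ne_zero).1 this
  rw [inner_eq_sum_norm_sq_div_four, inner_eq_sum_norm_sq_div_four]
  simp only [← map_smul, ← map_add, ← map_sub, h1]

omit hh in
theorem normSq_heis (v : V) (t : ℝ) (f : Fock V h) : normSq (heis v t f) = normSq f := by
  rw [normSq, normSq]
  congr 1
  change ∫ z, ‖heisFun h v t f.1 z‖ ^ 2 * Real.exp (-(‖z‖ ^ 2 / (2 * hbar h))) ∂(lebesgue V) = _
  simp only [heisFun_weight]
  exact integral_sub_right_eq_self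
    (fun z => ‖f.1 z‖ ^ 2 * Real.exp (-(‖z‖ ^ 2 / (2 * hbar h)))) v

theorem inner_heis (v : V) (t : ℝ) (f g : Fock V h) :
    (inner ℂ (toH (heis v t f)) (toH (heis v t g)) : ℂ) = inner ℂ (toH f) (toH g) :=
  isometry_inner (heis v t) LinearMap.id (normSq_heis v t) f g

omit [FiniteDimensional ℂ V] [MeasurableSpace V] [BorelSpace V] in
theorem circleAverage_eq (f : V → ℂ) (hf : Differentiable ℂ f) (z : V) :
    Real.circleAverage (fun s : ℂ => f (s • z)) 0 1 = f 0 := by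
  have h1 : Differentiable ℂ fun s : ℂ => f (s • z) :=
    hf.comp (differentiable_id.smul_const z)
  rw [DiffContOnCl.circleAverage h1.diffContOnCl, zero_smul]

/-- By rotation invariance, `f` may be replaced by its mean over the circles `e^{iθ} z`, after an
exchange of integrals; this mean is `f 0` because `f` is holomorphic. -/
theorem integral_fock (f : Fock V h) : ∫ z, f.1 z ∂(gauss V h) = f.1 0 := by
  have hc : Continuous f.1 := f.2.1.continuous
  have hi : Integrable f.1 (gauss V h) := (memLp_fock f).integrable (by norm_num)
  have hmp : ∀ θ : ℝ, MeasurePreserving (fun z : V => circleMap 0 1 θ • z)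
      (gauss V h) (gauss V h) := fun θ => by
    have hn : ‖circleMap 0 1 θ‖ = 1 := by simp
    have hne : circleMap 0 1 θ ≠ 0 := by
      intro h0; rw [h0] at hn; simp at hn
    let e : V ≃ₗᵢ[ℝ] V :=
      { (LinearEquiv.smulOfNeZero ℂ V _ hne).restrictScalars ℝ with
        norm_map' := fun z => by
          change ‖circleMap 0 1 θ • z‖ = ‖z‖
          rw [norm_smul, hn, one_mul] }
    exact measurePreserving_gauss e
  have hemb : ∀ θ : ℝ, MeasurableEmbedding (fun z : V => circleMap 0 1 θ • z) := fun θ =>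
    measurableEmbedding_const_smul₀ (by
      intro h0
      have hn : ‖circleMap 0 1 θ‖ = 1 := by simp
      rw [h0] at hn; simp at hn)
  have h1 : ∀ θ : ℝ, ∫ z, f.1 (circleMap 0 1 θ • z) ∂(gauss V h) = ∫ z, f.1 z ∂(gauss V h) :=
    fun θ => (hmp θ).integral_comp (hemb θ) f.1
  have h2 : ∀ θ : ℝ, ∫ z, ‖f.1 (circleMap 0 1 θ • z)‖ ∂(gauss V h)
      = ∫ z, ‖f.1 z‖ ∂(gauss V h) := fun θ => (hmp θ).integral_comp (hemb θ) fun z => ‖f.1 z‖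
  have hcont : Continuous fun p : ℝ × V => f.1 (circleMap 0 1 p.1 • p.2) :=
    hc.comp (((continuous_circleMap 0 1).comp continuous_fst).smul continuous_snd)
  have hint : Integrable (fun p : ℝ × V => f.1 (circleMap 0 1 p.1 • p.2))
      ((volume.restrict (Ioc 0 (2 * Real.pi))).prod (gauss V h)) := by
    rw [integrable_prod_iff hcont.aestronglyMeasurable]
    refine ⟨Eventually.of_forall fun θ => ((hmp θ).integrable_comp_emb (hemb θ)).2 hi, ?_⟩
    simp only [h2]
    exact integrable_const _
  have h3 : ∀ z, f.1 0 = (2 * Real.pi)⁻¹ •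
      ∫ θ in Ioc 0 (2 * Real.pi), f.1 (circleMap 0 1 θ • z) := fun z => by
    rw [← circleAverage_eq f.1 f.2.1 z, Real.circleAverage,
      intervalIntegral.integral_of_le (by positivity)]
  have h4 : ∫ _z, f.1 0 ∂(gauss V h) = f.1 0 := by simp
  rw [← h4]
  calc ∫ z, f.1 z ∂(gauss V h)
      = (2 * Real.pi)⁻¹ • ∫ θ in Ioc (0 : ℝ) (2 * Real.pi),
          (∫ z, f.1 (circleMap 0 1 θ • z) ∂(gauss V h)) := by
        simp only [h1]
        rw [setIntegral_const, smul_smul, measureReal_def, Real.volume_Ioc, sub_zero,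
          ENNReal.toReal_ofReal (by positivity), inv_mul_cancel₀ (by positivity), one_smul]
    _ = (2 * Real.pi)⁻¹ • ∫ z, (∫ θ in Ioc (0 : ℝ) (2 * Real.pi),
          f.1 (circleMap 0 1 θ • z)) ∂(gauss V h) := by
        rw [integral_integral_swap hint]
    _ = ∫ z, f.1 0 ∂(gauss V h) := by
        rw [← integral_smul]
        refine integral_congr_ae (Eventually.of_forall fun z => ?_)
        exact (h3 z).symm

theorem coherent_apply (v z : V) :
    (coherent h v).1 z = Complex.exp (inner ℂ v z / (2 * hbar h)) := rfl

omit hh in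
theorem heis_apply (v : V) (t : ℝ) (f : Fock V h) (z : V) : (heis v t f).1 z =
    Complex.exp (-(Complex.I * t) / hbar h + inner ℂ v z / (2 * hbar h)
    - (‖v‖ ^ 2 : ℝ) / (4 * hbar h)) * f.1 (z - v) := rfl

theorem inner_coherent_zero (f : Fock V h) :
    (inner ℂ (toH (coherent h 0)) (toH f) : ℂ) = f.1 0 := by
  rw [inner_toH, ← integral_fock]
  simp [coherent_apply]

theorem heis_coherent (v w : V) (t : ℝ) : heis v t (coherent h w)
    = Complex.exp (-(Complex.I * t) / hbar h - (‖v‖ ^ 2 : ℝ) / (4 * hbar h)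
      - inner ℂ w v / (2 * hbar h)) • coherent h (v + w) := by
  refine Subtype.ext (funext fun z => ?_)
  rw [heis_apply, coherent_apply]
  change _ = Complex.exp _ * (coherent h (v + w)).1 z
  rw [coherent_apply, ← Complex.exp_add, ← Complex.exp_add, inner_add_left, inner_sub_right]
  congr 1
  ring

/-- The reproducing property of the coherent states. -/
theorem inner_coherent (z : V) (f : Fock V h) :
    (inner ℂ (toH (coherent h z)) (toH f) : ℂ) = f.1 z := by
  -- Translating by `-z` turns `e_z` into a multiple of `e_0`, where the claim is the mean value
  -- property.
  rw [← inner_heis (-z) 0, heis_coherent, neg_add_cancel, map_smul, inner_smul_left,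
    inner_coherent_zero, heis_apply, ← Complex.exp_conj, ← mul_assoc, ← Complex.exp_add]
  have : (inner ℂ z z : ℂ) = ((‖z‖ ^ 2 : ℝ) : ℂ) := by
    rw [inner_self_eq_norm_sq_to_K]; push_cast; rfl
  simp only [inner_neg_right, this, norm_neg, inner_zero_right, sub_neg_eq_add,
    zero_add]
  conv_rhs => rw [← one_mul (f.1 z), ← Complex.exp_zero]
  congr 2
  have h4 : conj (4 : ℂ) = 4 := map_ofNat _ 4
  have h2 : conj (2 : ℂ) = 2 := map_ofNat _ 2
  simp [h2, h4]
  ring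

end FockHilbert

/-! ### Completeness of the Fock space and density of the coherent states -/

section Completeness

open Filter Topology ComplexConjugate

/-- A locally uniform limit of entire functions, with uniform control on balls, is entire. -/
theorem differentiable_of_tendsto_ball {X : Type*} [NormedAddCommGroup X] [NormedSpace ℂ X]
    {f : ℕ → X → ℂ} {F : X → ℂ} (hf : ∀ n, Differentiable ℂ (f n)) {a : ℕ → ℕ → ℝ} {B : ℝ → ℝ}
    (ha : Tendsto (fun p : ℕ × ℕ => a p.1 p.2) atTop (𝓝 0)) (ha0 : ∀ n m, 0 ≤ a n m)
    (hB : Monotone B)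
    (hfa : ∀ n m z, ‖f n z - f m z‖ ≤ B ‖z‖ * a n m)
    (hF : ∀ z, Tendsto (fun n => f n z) atTop (𝓝 (F z))) : Differentiable ℂ F := by
  have hd : ∀ n m z, ‖fderiv ℂ (f n) z - fderiv ℂ (f m) z‖ ≤ 2 * B (‖z‖ + 1) * a n m := by
    intro n m z
    have h1 : ∀ w ∈ Metric.ball z 1, ‖f n w - f m w‖ ≤ B (‖z‖ + 1) * a n m := by
      intro w hw
      refine (hfa n m w).trans (mul_le_mul_of_nonneg_right (hB ?_) (ha0 n m))
      have h2 := norm_le_norm_add_norm_sub' w z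
      have h3 : ‖w - z‖ < 1 := mem_ball_iff_norm.1 hw
      linarith
    -- Cauchy's estimate on the unit ball. The factor 2 comes from comparing a value with the value
    -- at the centre.
    have h4 := Complex.norm_fderiv_le_div_of_mapsTo_ball (f := fun w => f n w - f m w) (c := z)
      (R₁ := 1) (R₂ := 2 * B (‖z‖ + 1) * a n m)
      (((hf n).sub (hf m)).differentiableOn) (by
        intro w hw
        rw [mem_closedBall_iff_norm]
        have h5 := norm_sub_le (f n w - f m w) (f n z - f m z)
        have h6 := h1 w hw
        have h7 := h1 z (Metric.mem_ball_self one_pos)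
        linarith) one_pos
    rw [div_one, fderiv_fun_sub (hf n z) (hf m z)] at h4
    exact h4
  have hC : ∀ z, CauchySeq fun n => fderiv ℂ (f n) z := by
    intro z
    rw [cauchySeq_iff_tendsto_dist_atTop_0]
    refine squeeze_zero (fun _ => dist_nonneg) (fun p => ?_)
      (by simpa using ha.const_mul (2 * B (‖z‖ + 1)))
    rw [dist_eq_norm]
    exact hd p.1 p.2 z
  choose g hg using fun z => cauchySeq_tendsto_of_complete (hC z)
  intro x
  refine (hasFDerivAt_of_tendstoLocallyUniformlyOn (f := f) (f' := fun n => fderiv ℂ (f n))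
    (g' := g) (l := atTop) isOpen_univ ?_ (fun n z _ => (hf n z).hasFDerivAt) (fun z _ => hF z)
    (mem_univ x)).differentiableAt
  rw [tendstoLocallyUniformlyOn_univ, Metric.tendstoLocallyUniformly_iff]
  intro ε hε z
  refine ⟨Metric.ball z 1, Metric.ball_mem_nhds z one_pos, ?_⟩
  have h1 : Tendsto (fun p : ℕ × ℕ => 2 * B (‖z‖ + 1 + 1) * a p.1 p.2) atTop (𝓝 0) := by
    simpa using ha.const_mul (2 * B (‖z‖ + 1 + 1))
  obtain ⟨N, hN⟩ := (h1.eventually (gt_mem_nhds (half_pos hε))).exists_forall_of_atTop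
  filter_upwards [eventually_ge_atTop N.1] with n hn w hw
  rw [dist_comm, dist_eq_norm]
  have h2 : ∀ᶠ m in atTop, ‖fderiv ℂ (f n) w - fderiv ℂ (f m) w‖ ≤ ε / 2 := by
    filter_upwards [eventually_ge_atTop N.2] with m hm
    refine (hd n m w).trans (le_trans ?_ (hN (n, m) ⟨hn, hm⟩).le)
    refine mul_le_mul_of_nonneg_right (mul_le_mul_of_nonneg_left (hB ?_) two_pos.le) (ha0 _ _)
    have h3 := norm_le_norm_add_norm_sub' w z
    have h4 : ‖w - z‖ < 1 := mem_ball_iff_norm.1 hw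
    linarith
  have h3 := le_of_tendsto ((tendsto_const_nhds.sub (hg w)).norm) h2
  linarith

variable {V : Type*} [NormedAddCommGroup V] [InnerProductSpace ℂ V] [FiniteDimensional ℂ V]
  [MeasurableSpace V] [BorelSpace V] {h : ℝ} [hh : Fact (0 < h)]

theorem norm_coherent (z : V) :
    ‖toH (coherent h z)‖ = Real.exp (‖z‖ ^ 2 / (4 * hbar h)) := by
  have h1 := inner_coherent z (coherent h z)
  rw [coherent_apply, inner_self_eq_norm_sq_to_K, inner_self_eq_norm_sq_to_K] at h1
  have h2 : ‖toH (coherent h z)‖ ^ 2 = Real.exp (‖z‖ ^ 2 / (2 * hbar h)) := by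
    refine Complex.ofReal_injective ?_
    push_cast
    exact h1
  rw [← abs_of_nonneg (norm_nonneg (toH (coherent h z))), ← Real.sqrt_sq_eq_abs, h2,
    Real.sqrt_eq_iff_mul_self_eq (Real.exp_nonneg _) (Real.exp_nonneg _), ← Real.exp_add]
  congr 1
  ring

theorem norm_apply_le (f : Fock V h) (z : V) :
    ‖f.1 z‖ ≤ Real.exp (‖z‖ ^ 2 / (4 * hbar h)) * ‖toH f‖ := by
  rw [← inner_coherent, ← norm_coherent]
  exact norm_inner_le_norm _ _

/-- Point evaluations are bounded by `norm_apply_le`, so `L²` convergence forces convergence with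
uniform control on balls and the limit is entire. Almost everywhere convergence of a subsequence
identifies it with the `L²` limit. -/
theorem isClosed_range_toL2 : IsClosed (FockL2 V h : Set (Lp ℂ 2 (gauss V h))) := by
  have hb := hbar_pos h
  refine IsSeqClosed.isClosed ?_
  intro x y hx hxy
  choose f hf using hx
  -- The truncation at 0 makes the bound monotone on the whole line.
  set B : ℝ → ℝ := fun r => Real.exp (max r 0 ^ 2 / (4 * hbar h))
  have hB : Monotone B := fun r s hrs => by
    refine Real.exp_le_exp.2 ?_
    gcongr
  have hBn : ∀ z : V, B ‖z‖ = Real.exp (‖z‖ ^ 2 / (4 * hbar h)) := fun z => by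
    simp [B]
  have hfx : ∀ n m z, ‖(f n).1 z - (f m).1 z‖ ≤ B ‖z‖ * ‖x n - x m‖ := fun n m z => by
    rw [hBn, ← hf, ← hf, ← map_sub]
    exact norm_apply_le (f n - f m) z
  have ha : Tendsto (fun p : ℕ × ℕ => ‖x p.1 - x p.2‖) atTop (𝓝 0) := by
    have := cauchySeq_iff_tendsto_dist_atTop_0.1 hxy.cauchySeq
    simpa only [dist_eq_norm] using this
  have hlim : ∀ z, ∃ c, Tendsto (fun n => (f n).1 z) atTop (𝓝 c) := fun z => by
    refine cauchySeq_tendsto_of_complete (cauchySeq_iff_tendsto_dist_atTop_0.2 ?_)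
    refine squeeze_zero (fun _ => dist_nonneg) (fun p => ?_)
      (by simpa using ha.const_mul (B ‖z‖))
    rw [dist_eq_norm]
    exact hfx p.1 p.2 z
  choose F hF using hlim
  have hd : Differentiable ℂ F := differentiable_of_tendsto_ball (fun n => (f n).2.1)
    (a := fun n m => ‖x n - x m‖) ha (fun _ _ => norm_nonneg _) hB
    hfx hF
  obtain ⟨φ, hφ, hae⟩ := (tendstoInMeasure_of_tendsto_Lp hxy).exists_seq_tendsto_ae
  have hFy : y =ᵐ[gauss V h] F := by
    have h1 : ∀ᵐ z ∂(gauss V h), ∀ n, x n z = (f n).1 z := by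
      rw [ae_all_iff]
      intro n
      rw [← hf n]
      exact toL2_ae (f n)
    filter_upwards [hae, h1] with z hz1 hz2
    simp only [hz2] at hz1
    exact tendsto_nhds_unique hz1 ((hF z).comp hφ.tendsto_atTop)
  have hmem : F ∈ Fock V h := mem_fock_iff.2 ⟨hd, (Lp.memLp y).ae_eq hFy⟩
  refine ⟨⟨F, hmem⟩, ?_⟩
  exact Lp.ext ((toL2_ae _).trans hFy.symm)

instance : CompleteSpace (FockH V h) := isClosed_range_toL2.completeSpace_coe

theorem apply_toH_symm (x : FockH V h) (z : V) :
    (toH.symm x).1 z = inner ℂ (toH (coherent h z)) x := by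
  rw [← inner_coherent, LinearEquiv.apply_symm_apply]

theorem ext_inner_coherent {x y : FockH V h}
    (hxy : ∀ z, (inner ℂ (toH (coherent h z)) x : ℂ) = inner ℂ (toH (coherent h z)) y) : x = y := by
  apply toH.symm.injective
  refine Subtype.ext (funext fun z => ?_)
  rw [apply_toH_symm, apply_toH_symm, hxy]

variable (V h) in
/-- Finite linear combinations of coherent states. -/
def coherentSum : (V →₀ ℂ) →ₗ[ℂ] FockH V h :=
  Finsupp.linearCombination ℂ fun v => toH (coherent h v)

/-- A vector orthogonal to all coherent states is a function which vanishes at every point; in a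
complete space a trivial orthogonal complement means density. -/
theorem denseRange_coherentSum : DenseRange (coherentSum V h) := by
  have h1 : (LinearMap.range (coherentSum V h)).topologicalClosure = ⊤ := by
    rw [Submodule.topologicalClosure_eq_top_iff, Submodule.eq_bot_iff]
    intro x hx
    refine ext_inner_coherent fun z => ?_
    rw [inner_zero_right]
    refine (Submodule.mem_orthogonal _ _).1 hx _ ⟨Finsupp.single z 1, ?_⟩
    simp [coherentSum]
  intro x
  have h2 : x ∈ (LinearMap.range (coherentSum V h)).topologicalClosure := by rw [h1]; trivial
  exact h2

/-- A locally bounded family of vectors which is antiholomorphic when tested against the coherent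
states is antiholomorphic. -/
theorem differentiableOn_inner_of_coherent {O : Set ℂ} (hO : IsOpen O) (k : ℂ → FockH V h)
    (hb : ∀ K ⊆ O, IsCompact K → ∃ B, ∀ t ∈ K, ‖k t‖ ≤ B)
    (hk : ∀ v, DifferentiableOn ℂ (fun t => (inner ℂ (k t) (toH (coherent h v)) : ℂ)) O)
    (f : FockH V h) : DifferentiableOn ℂ (fun t => (inner ℂ (k t) f : ℂ)) O := by
  obtain ⟨x, hx, hxf⟩ := mem_closure_iff_seq_limit.1 (denseRange_coherentSum f)
  choose c hc using hx
  -- Local boundedness of `k` makes the approximation of `f` by combinations of coherent states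
  -- locally uniform in `t`.
  refine TendstoLocallyUniformlyOn.differentiableOn (φ := atTop)
    (F := fun n t => (inner ℂ (k t) (x n) : ℂ)) ?_ (Eventually.of_forall fun n => ?_) hO
  · rw [tendstoLocallyUniformlyOn_iff_forall_isCompact hO]
    intro K hKO hK
    obtain ⟨B, hB⟩ := hb K hKO hK
    rw [Metric.tendstoUniformlyOn_iff]
    intro ε hε
    have h1 : Tendsto (fun n => B * ‖f - x n‖) atTop (𝓝 0) := by
      have := (tendsto_const_nhds (x := f)).sub hxf
      rw [sub_self] at this
      simpa using this.norm.const_mul B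
    filter_upwards [h1.eventually (gt_mem_nhds hε)] with n hn t ht
    rw [dist_eq_norm, ← inner_sub_right]
    exact ((norm_inner_le_norm _ _).trans
      (mul_le_mul_of_nonneg_right (hB t ht) (norm_nonneg _))).trans_lt hn
  · have h2 : (fun t => (inner ℂ (k t) (x n) : ℂ))
        = fun t => (c n).sum fun v a => a * inner ℂ (k t) (toH (coherent h v)) := by
      ext t
      rw [← hc n, coherentSum, Finsupp.linearCombination_apply, Finsupp.inner_sum]
      simp [inner_smul_right]
    rw [h2]
    exact DifferentiableOn.fun_sum fun v _ => (hk v).const_mul _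

end Completeness

/-! ### Gaussian integrals on Euclidean spaces -/

section GaussianIntegral

/-- The integral of a Gaussian function on a Euclidean space. -/
theorem sq_integral_gaussian_mul_det {X : Type*} [NormedAddCommGroup X] [InnerProductSpace ℝ X]
    [FiniteDimensional ℝ X] [MeasurableSpace X] [BorelSpace X] {A : X →ₗ[ℝ] X}
    (hA : A.IsSymmetric) (hpos : ∀ x, x ≠ 0 → 0 < inner ℝ (A x) x) {b : ℝ} (hb : 0 < b) :
    (∫ x, Real.exp (-(b * inner ℝ (A x) x))) ^ 2 * LinearMap.det A
      = (Real.pi / b) ^ Module.finrank ℝ X := by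
  set n := Module.finrank ℝ X
  have hn : Module.finrank ℝ X = n := rfl
  set B := hA.eigenvectorBasis hn
  set l := hA.eigenvalues hn
  have hl : ∀ i, 0 < l i := fun i => by
    have h1 := hpos (B i) (B.orthonormal.ne_zero i)
    rw [hA.apply_eigenvectorBasis hn i, inner_smul_left, real_inner_self_eq_norm_sq,
      B.orthonormal.1 i] at h1
    simpa using h1
  have h1 : ∀ y : EuclideanSpace ℝ (Fin n), Real.exp (-(b * inner ℝ (A (B.repr.symm y))
      (B.repr.symm y))) = ∏ i, Real.exp (-(b * l i) * y i ^ 2) := fun y => by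
    rw [← Real.exp_sum]
    congr 1
    rw [← B.repr.inner_map_map, PiLp.inner_apply, Finset.mul_sum, ← Finset.sum_neg_distrib]
    refine Finset.sum_congr rfl fun i _ => ?_
    rw [hA.eigenvectorBasis_apply_self_apply hn, LinearIsometryEquiv.apply_symm_apply]
    simp only [RCLike.inner_apply, conj_trivial, RCLike.ofReal_real_eq_id, id]
    ring
  -- In an orthonormal eigenbasis the integral is a product of one-dimensional Gaussian integrals.
  have h2 : ∫ x, Real.exp (-(b * inner ℝ (A x) x)) = ∏ i, √(Real.pi / (b * l i)) := by
    rw [← B.measurePreserving_repr_symm.integral_comp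
      B.repr.symm.toHomeomorph.measurableEmbedding]
    simp only [h1]
    rw [← (PiLp.volume_preserving_toLp (Fin n)).integral_comp
      (MeasurableEquiv.toLp 2 _).measurableEmbedding]
    rw [integral_fintype_prod_volume_eq_prod (fun i (t : ℝ) => Real.exp (-(b * l i) * t ^ 2))]
    simp only [integral_gaussian]
  rw [h2, hA.det_eq_prod_eigenvalues hn, ← Finset.prod_pow]
  have h3 : ∀ i, √(Real.pi / (b * l i)) ^ 2 = Real.pi / (b * l i) := fun i =>
    Real.sq_sqrt (by have := hl i; positivity)
  simp only [h3, RCLike.ofReal_real_eq_id, id, ← Finset.prod_mul_distrib]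
  rw [Finset.prod_congr rfl (g := fun _ => Real.pi / b) fun i _ => ?_]
  · simp [div_pow]
  · have := (hl i).ne'
    change Real.pi / (b * l i) * l i = Real.pi / b
    field_simp

end GaussianIntegral

/-! ### Determinants of linear parts -/

section Determinants

open ComplexConjugate

variable {V : Type*} [NormedAddCommGroup V] [InnerProductSpace ℂ V] [FiniteDimensional ℂ V]

theorem det_of_adjoint {f f' : V →ₗ[ℂ] V} (hf : ∀ v w, (inner ℂ (f v) w : ℂ) = inner ℂ v (f' w)) :
    LinearMap.det f' = conj (LinearMap.det f) := by
  have h1 : f' = LinearMap.adjoint f := (LinearMap.eq_adjoint_iff _ _).2 fun v w => by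
    rw [← inner_conj_symm, ← hf, inner_conj_symm]
  classical
  set b := stdOrthonormalBasis ℂ V
  rw [h1, ← LinearMap.det_toMatrix b.toBasis, LinearMap.toMatrix_adjoint b b,
    Matrix.det_conjTranspose, LinearMap.det_toMatrix]
  rfl

theorem det_linPart_inv {g : V ≃L[ℝ] V} (hg : g ∈ Sp V) :
    LinearMap.det (linPart g⁻¹) = conj (LinearMap.det (linPart g)) :=
  det_of_adjoint (inner_linPart hg)

theorem det_linPart_ne_zero {g : V ≃L[ℝ] V} (hg : g ∈ Sp V) : LinearMap.det (linPart g) ≠ 0 :=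
  (LinearMap.isUnit_det _ (isUnit_linPart hg)).ne_zero

/-- The determinant `Det_j (1 - W Z)`. -/
def sdet (W Z : V →L[ℝ] V) : ℂ := LinearMap.det (1 - cpart (W ∘L Z))

theorem det_linPart_mul {g k : V ≃L[ℝ] V} (hg : g ∈ Sp V) (hk : k ∈ Sp V) :
    LinearMap.det (linPart (g * k))
      = LinearMap.det (linPart g) * sdet (ZL g) (ZL k⁻¹) * LinearMap.det (linPart k) := by
  rw [linPart_mul hg hk, map_mul, map_mul, sdet]

/-- The product formula for `k = g⁻¹`, where `C_{g⁻¹}` is the adjoint of `C_g`. -/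
theorem det_linPart_mul_conj {g : V ≃L[ℝ] V} (hg : g ∈ Sp V) :
    LinearMap.det (linPart g) * sdet (ZL g) (ZL g) * conj (LinearMap.det (linPart g)) = 1 := by
  have h1 := det_linPart_mul hg ((Sp V).inv_mem hg)
  rw [mul_inv_cancel, inv_inv, det_linPart_inv hg, linPart_one, map_one] at h1
  exact h1.symm

theorem det_real_restrict (f : V →ₗ[ℂ] V) :
    LinearMap.det (f.restrictScalars ℝ) = ‖LinearMap.det f‖ ^ 2 := by
  rw [LinearMap.det_restrictScalars, Algebra.norm_complex_apply, Complex.normSq_eq_norm_sq]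

omit [FiniteDimensional ℂ V] in
-- Conjugating with multiplication by `i` changes the sign of an antilinear map.
theorem det_one_add_anti {Z : V →L[ℝ] V} (hZ : IsAnti Z) :
    LinearMap.det ((1 + Z : V →L[ℝ] V) : V →ₗ[ℝ] V) = LinearMap.det ((1 - Z : V →L[ℝ] V) : V →ₗ[ℝ] V) := by
  let e : V ≃ₗ[ℝ] V := (LinearEquiv.smulOfNeZero ℂ V Complex.I Complex.I_ne_zero).restrictScalars ℝ
  rw [← LinearMap.det_conj ((1 + Z : V →L[ℝ] V) : V →ₗ[ℝ] V) e]
  congr 1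
  ext v
  obtain ⟨w, rfl⟩ := e.surjective v
  have he : ∀ w, e w = Complex.I • w := fun _ => rfl
  change e (e.symm (e w) + Z (e.symm (e w))) = e w - Z (e w)
  rw [e.symm_apply_apply, he, he, hZ w, smul_add, sub_neg_eq_add]

/-- `(1 + Z) (1 - Z) = 1 - Z²` is complex linear, and the real determinant of a complex linear map
is the squared modulus of its complex determinant. -/
theorem sq_det_one_add_anti {Z : V →L[ℝ] V} (hZ : IsAnti Z) :
    LinearMap.det ((1 + Z : V →L[ℝ] V) : V →ₗ[ℝ] V) ^ 2 = ‖sdet Z Z‖ ^ 2 := by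
  rw [sq, sdet, ← det_real_restrict]
  conv_lhs => arg 2; rw [det_one_add_anti hZ]
  rw [← map_mul]
  congr 1
  ext v
  simp [cpart_comp_apply hZ hZ]

end Determinants

/-! ### Gaussian vectors and their norms -/

section GaussianVectors

open ComplexConjugate

variable {V : Type*} [NormedAddCommGroup V] [InnerProductSpace ℂ V] [FiniteDimensional ℂ V]
  [MeasurableSpace V] [BorelSpace V] {h : ℝ} [hh : Fact (0 < h)]

/-- The complex bilinear form `⟨z, Z w⟩_j` of an antilinear map `Z`. -/
def antiForm {Z : V →L[ℝ] V} (hZ : IsAnti Z) : V →L[ℂ] V →L[ℂ] ℂ :=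
  LinearMap.toContinuousLinearMap
    { toFun := fun z => innerSL ℂ (Z z)
      map_add' := fun z w => by simp
      map_smul' := fun c z => by
        ext w
        simp [smul_of_isAnti hZ] }

omit [MeasurableSpace V] [BorelSpace V] in
theorem differentiable_anti {Z : V →L[ℝ] V} (hZ : IsAnti Z) :
    Differentiable ℂ fun z : V => (inner ℂ (Z z) z : ℂ) :=
  (antiForm hZ).differentiable.clm_apply differentiable_id

/-- The Gaussian function `exp (-⟨z, Z z⟩_j / 4ħ)`. -/
def gaussFun (h : ℝ) (Z : V →L[ℝ] V) (z : V) : ℂ :=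
  Complex.exp (-(inner ℂ (Z z) z / (4 * hbar h)))

omit [FiniteDimensional ℂ V] [MeasurableSpace V] [BorelSpace V] hh in
theorem norm_gaussFun_sq (Z : V →L[ℝ] V) (z : V) :
    ‖gaussFun h Z z‖ ^ 2 = Real.exp (-((inner ℂ (Z z) z : ℂ).re / (2 * hbar h))) := by
  rw [gaussFun, Complex.norm_exp, ← Real.exp_nat_mul]
  congr 1
  have : (4 * (hbar h : ℂ)) = ((4 * hbar h : ℝ) : ℂ) := by push_cast; rfl
  rw [this, Complex.neg_re, Complex.div_ofReal_re]
  push_cast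
  ring

omit [FiniteDimensional ℂ V] [MeasurableSpace V] [BorelSpace V] in
theorem norm_gaussFun_sq_le (Z : V →L[ℝ] V) (z : V) {r : ℝ} (hr : ‖Z‖ ≤ r) :
    ‖gaussFun h Z z‖ ^ 2 * Real.exp (-(‖z‖ ^ 2 / (2 * hbar h)))
      ≤ Real.exp (-((1 - r) / (2 * hbar h)) * ‖z‖ ^ 2) := by
  have hb := hbar_pos h
  rw [norm_gaussFun_sq, ← Real.exp_add]
  refine Real.exp_le_exp.2 ?_
  have h1 : -(inner ℂ (Z z) z : ℂ).re ≤ r * ‖z‖ ^ 2 := by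
    have h2 := (abs_le.1 ((Complex.abs_re_le_norm _).trans (norm_inner_le_norm (𝕜 := ℂ) (Z z) z))).1
    have h3 := Z.le_opNorm z
    have h4 : ‖Z z‖ * ‖z‖ ≤ r * ‖z‖ * ‖z‖ := by gcongr; exact h3.trans (by gcongr)
    nlinarith
  have h5 : -((inner ℂ (Z z) z : ℂ).re / (2 * hbar h)) + -(‖z‖ ^ 2 / (2 * hbar h))
      = (-(inner ℂ (Z z) z : ℂ).re - ‖z‖ ^ 2) / (2 * hbar h) := by ring
  have h6 : -((1 - r) / (2 * hbar h)) * ‖z‖ ^ 2 = (r * ‖z‖ ^ 2 - ‖z‖ ^ 2) / (2 * hbar h) := by ring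
  rw [h5, h6]
  gcongr

theorem gaussFun_mem {Z : V →L[ℝ] V} (hZ : IsSiegel Z) : gaussFun h Z ∈ Fock V h := by
  have hb := hbar_pos h
  have hd : Differentiable ℂ (gaussFun h Z) := by
    have := (differentiable_anti hZ.anti).mul_const ((4 * (hbar h : ℂ))⁻¹)
    exact (this.neg).cexp
  refine ⟨hd, ?_⟩
  have h1 : 0 < (1 - ‖Z‖) / (2 * hbar h) := by
    have := hZ.norm_lt
    have h2 : 0 < 1 - ‖Z‖ := by linarith
    positivity
  refine (integrable_gaussian_lebesgue h1).mono' ?_ ?_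
  · have := hd.continuous
    exact (by fun_prop : Continuous fun z : V => ‖gaussFun h Z z‖ ^ 2 *
      Real.exp (-(‖z‖ ^ 2 / (2 * hbar h)))).aestronglyMeasurable
  · refine Filter.Eventually.of_forall fun z => ?_
    rw [Real.norm_of_nonneg (by positivity)]
    exact norm_gaussFun_sq_le Z z le_rfl

/-- The Gaussian vector `exp (-⟨z, Z z⟩_j / 4ħ)` of the Fock space. -/
def gaussVec (h : ℝ) [Fact (0 < h)] {Z : V →L[ℝ] V} (hZ : IsSiegel Z) : Fock V h :=
  ⟨gaussFun h Z, gaussFun_mem hZ⟩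

theorem gaussVec_apply {Z : V →L[ℝ] V} (hZ : IsSiegel Z) (z : V) :
    (gaussVec h hZ).1 z = Complex.exp (-(inner ℂ (Z z) z / (4 * hbar h))) := rfl

theorem normSq_gaussVec_le {Z : V →L[ℝ] V} (hZ : IsSiegel Z) {r : ℝ} (hr : ‖Z‖ ≤ r) (hr1 : r < 1) :
    normSq (gaussVec h hZ) ≤ ((1 - r)⁻¹) ^ Module.finrank ℂ V := by
  have hb := hbar_pos h
  have h0 := hh.out
  have h2 : 0 < 1 - r := by linarith
  have h1 : 0 < (1 - r) / (2 * hbar h) := by positivity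
  have h3 := integral_mono (gaussVec h hZ).2.2 (integrable_gaussian_lebesgue (V := V) h1)
    (fun z => norm_gaussFun_sq_le Z z hr)
  rw [integral_gaussian_lebesgue h1] at h3
  rw [normSq]
  refine (mul_le_mul_of_nonneg_left h3 (by positivity)).trans (le_of_eq ?_)
  have : Real.pi / ((1 - r) / (2 * hbar h)) = h * (1 - r)⁻¹ := by
    rw [hbar]; field_simp
  rw [this, mul_pow, ← mul_assoc, inv_mul_cancel₀ (by positivity), one_mul]

/-- The weighted square of the function is the real Gaussian of the operator `1 + Z`, which is
symmetric and positive definite for the real inner product. Squaring the norm avoids a root of the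
determinant. -/
theorem sq_normSq_gaussVec_mul {Z : V →L[ℝ] V} (hZ : IsSiegel Z) :
    normSq (gaussVec h hZ) ^ 2 * LinearMap.det ((1 + Z : V →L[ℝ] V) : V →ₗ[ℝ] V) = 1 := by
  have hb := hbar_pos h
  have h0 := hh.out
  let _ : InnerProductSpace ℝ V := InnerProductSpace.complexToReal
  have : FiniteDimensional ℝ V := FiniteDimensional.complexToReal V
  have hin : ∀ v w : V, inner ℝ v w = (inner ℂ v w : ℂ).re := fun v w => rfl
  set A : V →ₗ[ℝ] V := ((1 + Z : V →L[ℝ] V) : V →ₗ[ℝ] V)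
  have hAa : ∀ v, A v = v + Z v := fun v => rfl
  have hsym : A.IsSymmetric := fun v w => by
    rw [hAa, hAa, hin, hin, inner_add_left, inner_add_right, hZ.symm v w, Complex.add_re,
      Complex.add_re, ← inner_conj_symm v (Z w), Complex.conj_re]
  have hpos : ∀ x, x ≠ 0 → 0 < inner ℝ (A x) x := fun x hx => by
    rw [hAa, inner_add_left, real_inner_self_eq_norm_sq, hin]
    have h2 := (abs_le.1 ((Complex.abs_re_le_norm _).trans (norm_inner_le_norm (𝕜 := ℂ) (Z x) x))).1
    have h3 := hZ.norm_apply_lt hx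
    nlinarith [norm_pos_iff.2 hx]
  have h1 := sq_integral_gaussian_mul_det hsym hpos (b := 1 / (2 * hbar h)) (by positivity)
  have h2 : ∀ z, ‖(gaussVec h hZ).1 z‖ ^ 2 * Real.exp (-(‖z‖ ^ 2 / (2 * hbar h)))
      = Real.exp (-(1 / (2 * hbar h) * inner ℝ (A z) z)) := fun z => by
    change ‖gaussFun h Z z‖ ^ 2 * _ = _
    rw [norm_gaussFun_sq, ← Real.exp_add, hAa, inner_add_left, real_inner_self_eq_norm_sq, hin]
    congr 1
    ring
  have h3 : ∫ z, ‖(gaussVec h hZ).1 z‖ ^ 2 * Real.exp (-(‖z‖ ^ 2 / (2 * hbar h))) ∂(lebesgue V)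
      = ∫ z, Real.exp (-(1 / (2 * hbar h) * inner ℝ (A z) z)) := by
    simp only [h2]; rfl
  rw [normSq, h3, mul_pow, mul_assoc]
  have h4 : Real.pi / (1 / (2 * hbar h)) = h := by rw [hbar]; field_simp
  have h5 : Module.finrank ℝ V = 2 * Module.finrank ℂ V := finrank_real_of_complex V
  rw [h4] at h1
  refine (congrArg _ h1).trans ?_
  rw [h5, mul_comm 2, pow_mul, ← mul_pow, inv_mul_cancel₀ (by positivity), one_pow]

theorem normSq_nonneg (f : Fock V h) : 0 ≤ normSq f := by
  rw [← norm_toH_sq]; positivity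

/-- With `N` the squared norm: `N² det_ℝ (1 + Z) = 1`, `det_ℝ (1 + Z) = |det (1 - Z²)|` and `|det
C_g|² |det (1 - Z²)| = 1`. This is the origin of the condition `|λ|² |det C_g| = 1`. -/
theorem normSq_gaussVec_ZL {g : V ≃L[ℝ] V} (hg : g ∈ Sp V) :
    normSq (gaussVec h (isSiegel_ZL hg)) = ‖LinearMap.det (linPart g)‖ := by
  have h1 := sq_normSq_gaussVec_mul (h := h) (isSiegel_ZL hg)
  have h2 := sq_det_one_add_anti (isAnti_ZL g)
  have h3 := congrArg norm (det_linPart_mul_conj hg)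
  rw [norm_mul, norm_mul, RCLike.norm_conj, norm_one] at h3
  set N := normSq (gaussVec h (isSiegel_ZL hg))
  set D := LinearMap.det ((1 + ZL g : V →L[ℝ] V) : V →ₗ[ℝ] V)
  set c := ‖LinearMap.det (linPart g)‖
  have hN : 0 ≤ N := normSq_nonneg _
  have hD : 0 < D := by
    by_contra h; nlinarith [sq_nonneg N]
  have hDs : D = ‖sdet (ZL g) (ZL g)‖ :=
    (pow_left_inj₀ hD.le (norm_nonneg _) two_ne_zero).1 h2
  rw [← hDs] at h3
  have : N ^ 2 = c ^ 2 := mul_right_cancel₀ hD.ne' (by rw [h1]; linarith)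
  exact (pow_left_inj₀ hN (norm_nonneg _) two_ne_zero).1 this

end GaussianVectors

/-! ### The Heisenberg relations, Schur's lemma and unitary operators from kernels -/

section Schur

open Filter Topology ComplexConjugate

/-- A function which is both holomorphic and antiholomorphic is constant. -/
theorem eq_of_differentiable_conj {X : Type*} [NormedAddCommGroup X] [NormedSpace ℂ X] {f : X → ℂ}
    (hf : Differentiable ℂ f) (hf' : Differentiable ℂ fun x => conj (f x)) (x y : X) :
    f x = f y := by
  refine is_const_of_fderiv_eq_zero (𝕜 := ℂ) hf (fun x => ?_) x y
  have h1 : HasFDerivAt f ((fderiv ℂ f x).restrictScalars ℝ) x :=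
    (hf x).hasFDerivAt.restrictScalars ℝ
  have h2 : HasFDerivAt (fun x => conj (f x))
      ((fderiv ℂ (fun x => conj (f x)) x).restrictScalars ℝ) x :=
    (hf' x).hasFDerivAt.restrictScalars ℝ
  have h3 := (Complex.conjCLE : ℂ →L[ℝ] ℂ).hasFDerivAt.comp x h1
  have h4 := h2.unique h3
  ext v
  have h5 : ∀ v, fderiv ℂ (fun x => conj (f x)) x v = conj (fderiv ℂ f x v) := fun v =>
    congrArg (fun L : X →L[ℝ] ℂ => L v) h4
  have h6 := h5 (Complex.I • v)
  rw [map_smul, map_smul, h5, smul_eq_mul, smul_eq_mul, map_mul, Complex.conj_I] at h6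
  have h7 : conj (fderiv ℂ f x v) = 0 := by
    have : (2 * Complex.I) * conj (fderiv ℂ f x v) = 0 := by linear_combination h6
    exact (mul_eq_zero.1 this).resolve_left (by simp)
  simpa using h7

variable {V : Type*} [NormedAddCommGroup V] [InnerProductSpace ℂ V] [FiniteDimensional ℂ V]
  [MeasurableSpace V] [BorelSpace V] {h : ℝ}

theorem heis_heis (v w : V) (t s : ℝ) (f : Fock V h) :
    heis v t (heis w s f) = heis (v + w) (t + s - Om v w / 2) f := by
  refine Subtype.ext (funext fun z => ?_)
  rw [heis_apply, heis_apply, heis_apply, ← mul_assoc, ← Complex.exp_add, sub_sub]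
  congr 1
  have h1 : ((‖v + w‖ ^ 2 : ℝ) : ℂ) = (‖v‖ ^ 2 : ℝ) + (‖w‖ ^ 2 : ℝ)
      + (inner ℂ v w + inner ℂ w v) := by
    have e : ∀ x : V, ((‖x‖ ^ 2 : ℝ) : ℂ) = inner ℂ x x := fun x => by
      rw [inner_self_eq_norm_sq_to_K]; push_cast; rfl
    rw [e, e, e, inner_add_left, inner_add_right, inner_add_right]
    ring
  have h2 : ((Om v w : ℝ) : ℂ) * Complex.I = (inner ℂ v w - inner ℂ w v) / 2 := by
    have e : (inner ℂ w v : ℂ) = conj (inner ℂ v w : ℂ) := (inner_conj_symm w v).symm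
    rw [Om_eq_im, e, Complex.sub_conj]
    push_cast
    ring
  congr 1
  rw [h1, inner_sub_right, inner_add_left]
  push_cast
  linear_combination (-1 / (2 * (hbar h : ℂ))) * h2

theorem heis_zero_zero (f : Fock V h) : heis 0 0 f = f := by
  refine Subtype.ext (funext fun z => ?_)
  rw [heis_apply]
  simp

theorem heis_eq_smul (v : V) (t : ℝ) (f : Fock V h) :
    heis v t f = Complex.exp (-(Complex.I * t) / hbar h) • heis v 0 f := by
  refine Subtype.ext (funext fun z => ?_)
  change (heis v t f).1 z = Complex.exp _ * (heis v 0 f).1 z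
  rw [heis_apply, heis_apply, ← mul_assoc, ← Complex.exp_add]
  congr 2
  simp
  ring

omit [FiniteDimensional ℂ V] [MeasurableSpace V] [BorelSpace V] in
theorem Om_self (v : V) : Om v v = 0 := by
  rw [Om_eq_im, inner_self_eq_norm_sq_to_K, ← RCLike.ofReal_pow]
  exact Complex.ofReal_im _

omit [FiniteDimensional ℂ V] [MeasurableSpace V] [BorelSpace V] in
theorem Om_neg_left (v w : V) : Om (-v) w = -Om v w := by
  simp [Om_eq_im]

variable [hh : Fact (0 < h)]

theorem inner_heis_right (v : V) (t : ℝ) (f g : Fock V h) :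
    (inner ℂ (toH f) (toH (heis v t g)) : ℂ) = inner ℂ (toH (heis (-v) (-t) f)) (toH g) := by
  rw [← inner_heis (-v) (-t) f (heis v t g), heis_heis, Om_neg_left, Om_self]
  simp only [neg_add_cancel, neg_zero, zero_div, sub_zero, heis_zero_zero]

theorem inner_heis_heis (v w : V) (t s : ℝ) (f g : Fock V h) :
    (inner ℂ (toH (heis v t f)) (toH (heis w s g)) : ℂ)
      = inner ℂ (toH f) (toH (heis (w - v) (s - t + Om v w / 2) g)) := by
  rw [← neg_neg v, ← neg_neg t, ← inner_heis_right, heis_heis, Om_neg_left]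
  congr 4
  · abel
  · simp only [neg_neg]; ring

theorem coherent_eq_heis (v : V) : coherent h v
    = Complex.exp ((‖v‖ ^ 2 : ℝ) / (4 * hbar h)) • heis v 0 (coherent h 0) := by
  rw [heis_coherent, smul_smul, ← Complex.exp_add]
  simp

/-- Two bounded linear operators which agree on the coherent states are equal. -/
theorem linearMap_ext_coherent {S T : FockH V h →ₗ[ℂ] FockH V h} (hS : ∀ x, ‖S x‖ ≤ ‖x‖)
    (hT : ∀ x, ‖T x‖ ≤ ‖x‖) (hST : ∀ v, S (toH (coherent h v)) = T (toH (coherent h v))) : S = T := by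
  set S' : FockH V h →L[ℂ] FockH V h := S.mkContinuous 1 fun x => by simpa using hS x
  set T' : FockH V h →L[ℂ] FockH V h := T.mkContinuous 1 fun x => by simpa using hT x
  have h1 : (S' : FockH V h → FockH V h) = T' := by
    refine denseRange_coherentSum.equalizer S'.continuous T'.continuous (funext fun c => ?_)
    change S (coherentSum V h c) = T (coherentSum V h c)
    rw [coherentSum, Finsupp.linearCombination_apply, Finsupp.sum, map_sum, map_sum]
    simp only [map_smul, hST]
  exact LinearMap.ext fun x => congrFun h1 x

/-- An operator with an adjoint which commutes with the Heisenberg group is a scalar. -/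
theorem scalar_of_comm_heis (T T' : Fock V h →ₗ[ℂ] Fock V h)
    (hT : ∀ f g, (inner ℂ (toH (T f)) (toH g) : ℂ) = inner ℂ (toH f) (toH (T' g)))
    (hc : ∀ v f, T (heis v 0 f) = heis v 0 (T f)) : ∃ c : ℂ, ∀ f, T f = c • f := by
  have hcoh : ∀ v, T (coherent h v)
      = Complex.exp ((‖v‖ ^ 2 : ℝ) / (4 * hbar h)) • heis v 0 (T (coherent h 0)) := fun v => by
    rw [coherent_eq_heis, map_smul, hc]
  set p := T (coherent h 0)
  -- Commutation with translations makes the kernel of `T` that of the identity times a function of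
  -- `z - v`.
  have hval : ∀ v z, (T (coherent h v)).1 z = (coherent h v).1 z * p.1 (z - v) := fun v z => by
    rw [hcoh]
    change Complex.exp _ * (heis v 0 p).1 z = _
    rw [heis_apply, ← mul_assoc, ← Complex.exp_add, coherent_apply]
    congr 2
    simp
  have hadj : ∀ v z, (T (coherent h v)).1 z = conj ((T' (coherent h z)).1 v) := fun v z => by
    rw [← inner_coherent, ← inner_conj_symm, hT, inner_coherent]
  have hp : ∀ v, p.1 v = conj ((T' (coherent h 0)).1 (-v)) := fun v => by
    have h1 := hval (-v) 0
    rw [coherent_apply] at h1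
    rw [← hadj, h1]
    simp
  -- `p` is holomorphic as an element of the Fock space, and by the adjoint relation so is its
  -- complex conjugate.
  have hconst : ∀ v, p.1 v = p.1 0 := fun v => by
    refine eq_of_differentiable_conj p.2.1 ?_ v 0
    have : (fun x => conj (p.1 x)) = fun v => (T' (coherent h 0)).1 (-v) := by
      ext v
      rw [hp, Complex.conj_conj]
    rw [this]
    exact (T' (coherent h 0)).2.1.comp (differentiable_id.neg)
  refine ⟨p.1 0, fun f => ?_⟩
  refine toH.injective (ext_inner_coherent fun z => ?_)
  have hT'z : T' (coherent h z) = conj (p.1 0) • coherent h z := by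
    refine Subtype.ext (funext fun v => ?_)
    have := hadj v z
    rw [hval, hconst] at this
    rw [← Complex.conj_conj ((T' (coherent h z)).1 v), ← this, map_mul, coherent_apply,
      ← Complex.exp_conj]
    change _ = conj (p.1 0) * (coherent h z).1 v
    rw [coherent_apply, map_div₀, inner_conj_symm, mul_comm]
    congr 3
    rw [map_mul, Complex.conj_ofReal, map_ofNat]
  rw [← inner_conj_symm, hT, inner_conj_symm, hT'z, map_smul, map_smul, inner_smul_left,
    inner_smul_right, Complex.conj_conj]

/-- Two families with the Gram matrix of the coherent states, adjoint to each other, define a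
unitary operator. -/
theorem exists_unitary_of_kernel (K K' : V → FockH V h)
    (hK : ∀ v w, (inner ℂ (K v) (K w) : ℂ) = inner ℂ (toH (coherent h v)) (toH (coherent h w)))
    (hK' : ∀ v w, (inner ℂ (K' v) (K' w) : ℂ) = inner ℂ (toH (coherent h v)) (toH (coherent h w)))
    (hKK : ∀ v w, (inner ℂ (K v) (toH (coherent h w)) : ℂ) = inner ℂ (toH (coherent h v)) (K' w)) :
    ∃ U : FockH V h ≃ₗ[ℂ] FockH V h, (∀ x, ‖U x‖ = ‖x‖) ∧ ∀ v, U (toH (coherent h v)) = K v := by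
  -- Equal Gram matrices make `e_v ↦ J v` isometric on finite combinations, so it extends to the
  -- closure of their span, which is the whole space.
  have ext1 : ∀ J : V → FockH V h, (∀ v w, (inner ℂ (J v) (J w) : ℂ)
      = inner ℂ (toH (coherent h v)) (toH (coherent h w))) →
      ∃ U : FockH V h →L[ℂ] FockH V h, (∀ x, ‖U x‖ ≤ ‖x‖) ∧ ∀ v, U (toH (coherent h v)) = J v := by
    intro J hJ
    have hn : ∀ c : V →₀ ℂ, ‖Finsupp.linearCombination ℂ J c‖ = ‖coherentSum V h c‖ := fun c => by
      have h1 : (inner ℂ (Finsupp.linearCombination ℂ J c) (Finsupp.linearCombination ℂ J c) : ℂ)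
          = inner ℂ (coherentSum V h c) (coherentSum V h c) := by
        simp only [coherentSum, Finsupp.linearCombination_apply, Finsupp.sum_inner,
          Finsupp.inner_sum, hJ, inner_smul_left, inner_smul_right]
      rw [@norm_eq_sqrt_re_inner ℂ, @norm_eq_sqrt_re_inner ℂ _ _ _ _ (coherentSum V h c)]
      exact congrArg (fun x : ℂ => √x.re) h1
    have hb : ∀ c : V →₀ ℂ, ‖Finsupp.linearCombination ℂ J c‖ ≤ 1 * ‖coherentSum V h c‖ :=
      fun c => by rw [one_mul, hn]
    refine ⟨LinearMap.extendOfNorm (Finsupp.linearCombination ℂ J) (coherentSum V h),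
      fun x => ?_, fun v => ?_⟩
    · simpa using LinearMap.norm_extendOfNorm_apply_le denseRange_coherentSum 1 hb x
    · have := LinearMap.extendOfNorm_eq denseRange_coherentSum ⟨1, hb⟩ (Finsupp.single v 1)
      simpa [coherentSum] using this
  obtain ⟨U, hU1, hU2⟩ := ext1 K hK
  obtain ⟨U', hU1', hU2'⟩ := ext1 K' hK'
  -- The relation between `J` and `J'` says that `B` is the adjoint of the isometry `A`, hence its
  -- left inverse. It is used in both orders.
  have hinv : ∀ (A B : FockH V h →L[ℂ] FockH V h) (J J' : V → FockH V h), (∀ x, ‖A x‖ ≤ ‖x‖) →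
      (∀ x, ‖B x‖ ≤ ‖x‖) → (∀ v, A (toH (coherent h v)) = J v) →
      (∀ v, B (toH (coherent h v)) = J' v) →
      (∀ v w, (inner ℂ (J v) (J w) : ℂ) = inner ℂ (toH (coherent h v)) (toH (coherent h w))) →
      (∀ v w, (inner ℂ (J v) (toH (coherent h w)) : ℂ) = inner ℂ (toH (coherent h v)) (J' w)) →
      ∀ x, B (A x) = x := by
    intro A B J J' hA1 hB1 hA hB hJ hJJ x
    have h1 : (B.comp A : FockH V h →ₗ[ℂ] FockH V h) = LinearMap.id := by
      refine linearMap_ext_coherent (fun x => (hB1 _).trans (hA1 x)) (fun x => le_rfl) fun v => ?_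
      change B (A (toH (coherent h v))) = toH (coherent h v)
      refine ext_inner_coherent fun z => ?_
      rw [hA, ← hJ z v]
      have h2 : ∀ y, (inner ℂ (J z) y : ℂ) = inner ℂ (toH (coherent h z)) (B y) := by
        refine fun y => congrFun (DenseRange.equalizer (denseRange_coherentSum (V := V) (h := h))
          (g := fun y : FockH V h => (inner ℂ (J z) y : ℂ))
          (h := fun y : FockH V h => (inner ℂ (toH (coherent h z)) (B y) : ℂ))
          (by fun_prop) (by fun_prop) (funext fun c => ?_)) y
        simp only [Function.comp, coherentSum, Finsupp.linearCombination_apply, Finsupp.sum,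
          inner_sum, map_sum, map_smul, inner_smul_right, hJJ, hB]
      exact (h2 _).symm
    exact LinearMap.congr_fun h1 x
  have h1 : ∀ x, U' (U x) = x := hinv U U' K K' hU1 hU1' hU2 hU2' hK hKK
  have h2 : ∀ x, U (U' x) = x := hinv U' U K' K hU1' hU1 hU2' hU2 hK' fun v w => by
    rw [← inner_conj_symm, ← hKK, inner_conj_symm]
  refine ⟨LinearEquiv.ofLinearMap (U : FockH V h →ₗ[ℂ] FockH V h) (U' : FockH V h →ₗ[ℂ] FockH V h)
    (LinearMap.ext h2) (LinearMap.ext h1), fun x => ?_, hU2⟩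
  refine le_antisymm (hU1 x) ?_
  conv_lhs => rw [← h1 x]
  exact hU1' _

end Schur

/-! ### Existence of the unitary operators with parameters `(g, l)` -/

section Lifts

open Filter Topology ComplexConjugate

variable {V : Type*} [NormedAddCommGroup V] [InnerProductSpace ℂ V] [FiniteDimensional ℂ V]

omit [FiniteDimensional ℂ V] in
theorem inner_self_ofReal (v : V) : (inner ℂ v v : ℂ) = ((‖v‖ ^ 2 : ℝ) : ℂ) := by
  rw [inner_self_eq_norm_sq_to_K]; push_cast; rfl

/-- The kernel with parameters `(g, l)`. -/
def liftKer (h : ℝ) (g : V ≃L[ℝ] V) (l : ℂ) (z v : V) : ℂ :=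
  l * Complex.exp ((1 / (4 * hbar h)) *
      (2 * herm (linPartInv g z) v - herm z (Zmap g⁻¹ z) - herm (Zmap g v) v))

theorem liftKer_eq (h : ℝ) (g : V ≃L[ℝ] V) (l : ℂ) (z v : V) : liftKer h g l z v =
    l * Complex.exp ((1 / (4 * hbar h)) *
      (2 * inner ℂ v (linPartInv g z) - inner ℂ (ZL g⁻¹ z) z - inner ℂ v (ZL g v))) := by
  rw [liftKer, ZL_apply, ZL_apply]
  rfl

/-- The adjoint operator has parameters `(g⁻¹, conj l)`, because `C_{g⁻¹}` is the adjoint of `C_g`.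
This supplies the inverse when the operator is constructed. -/
theorem liftKer_conj {h : ℝ} {g : V ≃L[ℝ] V} (hg : g ∈ Sp V) (l : ℂ) (z v : V) :
    liftKer h g⁻¹ (conj l) v z = conj (liftKer h g l z v) := by
  rw [liftKer_eq, liftKer_eq, map_mul, ← Complex.exp_conj, inv_inv]
  congr 2
  simp only [map_mul, map_sub, map_div₀, map_one, map_ofNat, Complex.conj_ofReal, inner_conj_symm]
  rw [inner_linPartInv hg]
  ring

theorem linPartInv_inv_apply {g : V ≃L[ℝ] V} (hg : g ∈ Sp V) (v : V) :
    linPartInv g (g v) = v + ZL g v := by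
  rw [← linPart_one_add_ZL hg, linPartInv_linPart hg]

variable [MeasurableSpace V] [BorelSpace V] {h : ℝ} [hh : Fact (0 < h)]

/-- The vacuum vector of the operator with parameters `(g, l)`. -/
def liftVac (h : ℝ) [Fact (0 < h)] {g : V ≃L[ℝ] V} (hg : g ∈ Sp V) (l : ℂ) : Fock V h :=
  l • gaussVec h (isSiegel_ZL ((Sp V).inv_mem hg))

/-- The image of a coherent state under the operator with parameters `(g, l)`. -/
def liftVec (h : ℝ) [Fact (0 < h)] {g : V ≃L[ℝ] V} (hg : g ∈ Sp V) (l : ℂ) (v : V) : Fock V h :=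
  Complex.exp ((‖v‖ ^ 2 : ℝ) / (4 * hbar h)) • heis (g v) 0 (liftVac h hg l)

theorem liftVec_zero {g : V ≃L[ℝ] V} (hg : g ∈ Sp V) (l : ℂ) :
    liftVec h hg l 0 = liftVac h hg l := by
  simp [liftVec, heis_zero_zero]

/-- Since `e_v` is a multiple of the translate of `e_0` by `v`, intertwining forces its image to be
the translate by `g v` of the Gaussian vacuum. Expanding the quadratic form shows that this agrees
with the prescribed kernel. -/
theorem liftVec_apply {g : V ≃L[ℝ] V} (hg : g ∈ Sp V) (l : ℂ) (v z : V) :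
    (liftVec h hg l v).1 z = liftKer h g l z v := by
  have hg' : g⁻¹ ∈ Sp V := (Sp V).inv_mem hg
  change Complex.exp _ * (heis (g v) 0 (liftVac h hg l)).1 z = _
  rw [heis_apply]
  change _ * (_ * (l * (gaussVec h (isSiegel_ZL hg')).1 (z - g v))) = _
  rw [gaussVec_apply, liftKer_eq]
  have e : ∀ a b c : ℂ, Complex.exp a * (Complex.exp b * (l * Complex.exp c))
      = l * Complex.exp (a + b + c) := fun a b c => by
    rw [Complex.exp_add, Complex.exp_add]; ring
  rw [e]
  congr 2
  set u := g v
  have hu : g⁻¹ u = v := g.symm_apply_apply v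
  have h0 : u + ZL g⁻¹ u = linPartInv g⁻¹ v := by rw [← linPartInv_inv_apply hg', hu]
  have h1 : ∀ x, (inner ℂ (linPartInv g⁻¹ v) x : ℂ) = inner ℂ v (linPartInv g x) := fun x => by
    rw [inner_linPartInv hg', inv_inv]
  have h2 : (inner ℂ u z : ℂ) + inner ℂ (ZL g⁻¹ u) z = inner ℂ v (linPartInv g z) := by
    rw [← h1, ← h0, inner_add_left]
  have h3 : (inner ℂ u u : ℂ) + inner ℂ (ZL g⁻¹ u) u = inner ℂ v v + inner ℂ v (ZL g v) := by
    rw [← inner_add_left, h0, h1, linPartInv_inv_apply hg, inner_add_right]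
  have h4 : (inner ℂ (ZL g⁻¹ z) u : ℂ) = inner ℂ (ZL g⁻¹ u) z := inner_ZL_symm hg' z u
  rw [map_sub, inner_sub_left, inner_sub_right, inner_sub_right, h4, ← inner_self_ofReal,
    ← inner_self_ofReal]
  have hb : (hbar h : ℂ) ≠ 0 := by exact_mod_cast (hbar_pos h).ne'
  field_simp
  push_cast
  linear_combination 4 * h2 - 2 * h3

theorem norm_liftVac {g : V ≃L[ℝ] V} (hg : g ∈ Sp V) {l : ℂ}
    (hl : ‖l‖ ^ 2 * ‖LinearMap.det (linPart g)‖ = 1) : ‖toH (liftVac h hg l)‖ = 1 := by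
  have h1 : ‖toH (liftVac h hg l)‖ ^ 2 = 1 := by
    rw [liftVac, map_smul, norm_smul, mul_pow, norm_toH_sq, normSq_gaussVec_ZL ((Sp V).inv_mem hg), det_linPart_inv hg,
      Complex.norm_conj, hl]
  exact (pow_eq_one_iff_of_nonneg (norm_nonneg _) two_ne_zero).1 h1

theorem norm_heis (v : V) (t : ℝ) (f : Fock V h) : ‖toH (heis v t f)‖ = ‖toH f‖ := by
  have : ‖toH (heis v t f)‖ ^ 2 = ‖toH f‖ ^ 2 := by
    rw [norm_toH_sq, norm_toH_sq, normSq_heis]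
  exact (sq_eq_sq₀ (norm_nonneg _) (norm_nonneg _)).1 this

theorem norm_liftVec {g : V ≃L[ℝ] V} (hg : g ∈ Sp V) {l : ℂ}
    (hl : ‖l‖ ^ 2 * ‖LinearMap.det (linPart g)‖ = 1) (v : V) :
    ‖toH (liftVec h hg l v)‖ = Real.exp (‖v‖ ^ 2 / (4 * hbar h)) := by
  rw [liftVec, map_smul, norm_smul, norm_heis, norm_liftVac hg hl, mul_one, Complex.norm_exp]
  congr 1
  rw [show (((‖v‖ ^ 2 : ℝ) : ℂ) / (4 * hbar h)) = ((‖v‖ ^ 2 / (4 * hbar h) : ℝ) : ℂ) by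
    push_cast; ring, Complex.ofReal_re]

/-- No integral is computed. With `v` replaced by `s v`, the conjugate overlap `Φ s` is entire,
since the kernel is antiholomorphic in `v`. Moving the Heisenberg operator to the other side gives
`conj (Φ s) = Φ (-s)`, so `conj Φ` is entire too. Hence `Φ` is constant, equal to the squared norm
of the vacuum. -/
theorem inner_liftVac_liftVec {g : V ≃L[ℝ] V} (hg : g ∈ Sp V) {l : ℂ}
    (hl : ‖l‖ ^ 2 * ‖LinearMap.det (linPart g)‖ = 1) (v : V) :
    (inner ℂ (toH (liftVac h hg l)) (toH (liftVec h hg l v)) : ℂ) = 1 := by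
  set Φ : ℂ → ℂ := fun s => inner ℂ (toH (liftVec h hg l (s • v))) (toH (liftVac h hg l)) with hΦ
  have h1 : Differentiable ℂ Φ := by
    rw [← differentiableOn_univ]
    refine differentiableOn_inner_of_coherent isOpen_univ
      (fun s => toH (liftVec h hg l (s • v))) (fun K _ hK => ?_) (fun z => ?_) _
    · have hc : Continuous fun s : ℂ => Real.exp (‖s • v‖ ^ 2 / (4 * hbar h)) := by fun_prop
      obtain ⟨B, hB⟩ := (hK.image hc).bddAbove
      refine ⟨B, fun t ht => ?_⟩
      rw [norm_liftVec hg hl]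
      exact hB ⟨t, ht, rfl⟩
    · have : (fun t : ℂ => (inner ℂ (toH (liftVec h hg l (t • v))) (toH (coherent h z)) : ℂ))
          = fun t => conj l * Complex.exp ((1 / (4 * hbar h)) *
            (2 * (t * inner ℂ (linPartInv g z) v) - inner ℂ z (ZL g⁻¹ z)
              - t * (t * inner ℂ (ZL g v) v))) := by
        ext t
        rw [← inner_conj_symm, inner_coherent, liftVec_apply, liftKer_eq, map_mul,
          ← Complex.exp_conj, smul_of_isAnti (isAnti_ZL g)]
        simp only [map_mul, map_sub, map_div₀, map_one, map_ofNat, Complex.conj_ofReal,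
          inner_conj_symm, inner_smul_left, inner_smul_right, Complex.conj_conj]
      rw [this]
      fun_prop
  have h2 : ∀ s, conj (Φ s) = Φ (-s) := fun s => by
    simp only [hΦ, inner_conj_symm, liftVec, map_smul, inner_smul_left, inner_heis_right, neg_smul, map_neg, norm_neg, neg_zero, ← Complex.exp_conj, map_div₀, map_mul,
      map_ofNat, Complex.conj_ofReal]
  have h3 : Φ 1 = Φ 0 := eq_of_differentiable_conj h1 (by
    simp only [h2]
    exact h1.comp differentiable_neg) 1 0
  have h4 : Φ 0 = 1 := by
    simp only [hΦ, zero_smul, liftVec_zero]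
    rw [inner_self_eq_norm_sq_to_K, norm_liftVac hg hl]
    simp
  have h5 : conj (Φ 1) = 1 := by rw [h3, h4, map_one]
  simpa only [hΦ, one_smul, inner_conj_symm] using h5

theorem inner_liftVac_heis {g : V ≃L[ℝ] V} (hg : g ∈ Sp V) {l : ℂ}
    (hl : ‖l‖ ^ 2 * ‖LinearMap.det (linPart g)‖ = 1) (v : V) (t : ℝ) :
    (inner ℂ (toH (liftVac h hg l)) (toH (heis (g v) t (liftVac h hg l))) : ℂ)
      = inner ℂ (toH (coherent h 0)) (toH (heis v t (coherent h 0))) := by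
  have h1 := inner_liftVac_liftVec (h := h) hg hl v
  have h2 := inner_coherent_zero (h := h) (coherent h v)
  rw [coherent_apply, inner_zero_right, zero_div, Complex.exp_zero, ← h1, coherent_eq_heis v, liftVec,
    map_smul, map_smul, inner_smul_right, inner_smul_right] at h2
  rw [heis_eq_smul (g v), heis_eq_smul v, map_smul, map_smul, inner_smul_right, inner_smul_right,
    mul_left_cancel₀ (Complex.exp_ne_zero _) h2]

/-- The Heisenberg relations reduce all inner products to overlaps with a vacuum; the cocycles on
the two sides agree because `g` preserves `Ω`. -/
theorem inner_liftVec {g : V ≃L[ℝ] V} (hg : g ∈ Sp V) {l : ℂ}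
    (hl : ‖l‖ ^ 2 * ‖LinearMap.det (linPart g)‖ = 1) (v w : V) :
    (inner ℂ (toH (liftVec h hg l v)) (toH (liftVec h hg l w)) : ℂ)
      = inner ℂ (toH (coherent h v)) (toH (coherent h w)) := by
  rw [coherent_eq_heis v, coherent_eq_heis w, liftVec, liftVec]
  simp only [map_smul, inner_smul_left, inner_smul_right, inner_heis_heis, ← map_sub, hg v w,
    inner_liftVac_heis hg hl]

/-- The family `liftVec` has the Gram matrix of the coherent states, and the family for `(g⁻¹, conj
l)` is adjoint to it, so `exists_unitary_of_kernel` applies. -/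
theorem exists_hasParameters {g : V ≃L[ℝ] V} (hg : g ∈ Sp V) {l : ℂ}
    (hl : ‖l‖ ^ 2 * ‖LinearMap.det (linPart g)‖ = 1) : ∃ A : Mpc V h, HasParameters A g l := by
  have hg' : g⁻¹ ∈ Sp V := (Sp V).inv_mem hg
  have hl' : ‖conj l‖ ^ 2 * ‖LinearMap.det (linPart g⁻¹)‖ = 1 := by
    rw [det_linPart_inv hg, Complex.norm_conj, Complex.norm_conj, hl]
  obtain ⟨U, hU, hUK⟩ := exists_unitary_of_kernel (fun v => toH (liftVec h hg l v))
    (fun v => toH (liftVec h hg' (conj l) v)) (inner_liftVec hg hl) (inner_liftVec hg' hl')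
    (fun v w => by
      rw [inner_coherent, liftVec_apply, liftKer_conj hg, ← liftVec_apply hg, ← inner_coherent,
        inner_conj_symm])
  set U' : Fock V h ≃ₗ[ℂ] Fock V h := (toH.trans U).trans toH.symm
  have hU' : ∀ f, toH (U' f) = U (toH f) := fun f => toH.apply_symm_apply _
  have hcoh : ∀ v, U' (coherent h v) = liftVec h hg l v := fun v =>
    toH.injective ((hU' _).trans (hUK v))
  have hvac : ∀ w t, U' (heis w t (coherent h 0)) = heis (g w) t (liftVac h hg l) := fun w t => by
    have h1 := hcoh w
    rw [coherent_eq_heis, liftVec, map_smul] at h1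
    have h2 := smul_right_injective _ (Complex.exp_ne_zero _) h1
    rw [heis_eq_smul w, heis_eq_smul (g w), map_smul, h2]
  have hnorm : ∀ f, normSq (U' f) = normSq f := fun f => by
    rw [← norm_toH_sq, hU', hU, norm_toH_sq]
  -- Both sides are isometries, so it suffices to compare them on coherent states, where the
  -- Heisenberg relations decide.
  have hint : ∀ v t f, heis (g v) t (U' f) = U' (heis v t f) := fun v t f => by
    have h1 := linearMap_ext_coherent
      (S := toH.toLinearMap ∘ₗ heis (g v) t ∘ₗ U'.toLinearMap ∘ₗ toH.symm.toLinearMap)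
      (T := toH.toLinearMap ∘ₗ U'.toLinearMap ∘ₗ heis v t ∘ₗ toH.symm.toLinearMap)
      (fun x => by
        change ‖toH (heis (g v) t (U' (toH.symm x)))‖ ≤ _
        rw [norm_heis, hU', hU, toH.apply_symm_apply])
      (fun x => by
        change ‖toH (U' (heis v t (toH.symm x)))‖ ≤ _
        rw [hU', hU, norm_heis, toH.apply_symm_apply])
      (fun w => by
        change toH (heis (g v) t (U' (toH.symm (toH (coherent h w)))))
          = toH (U' (heis v t (toH.symm (toH (coherent h w)))))
        rw [toH.symm_apply_apply, coherent_eq_heis, map_smul U', map_smul (heis v t), map_smul U', map_smul (heis (g v) t),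
          hvac, heis_heis, heis_heis, hvac, hg v w, map_add])
    have h2 := LinearMap.congr_fun h1 (toH f)
    change toH (heis (g v) t (U' (toH.symm (toH f)))) = toH (U' (heis v t (toH.symm (toH f)))) at h2
    rw [toH.symm_apply_apply] at h2
    exact toH.injective h2
  refine ⟨⟨(U', g), hnorm, hg, fun v t f => ?_⟩, rfl, fun z v => ?_⟩
  · rw [← hint, LinearEquiv.apply_symm_apply]
  · change (U' (coherent h v)).1 z = _
    rw [hcoh, liftVec_apply]
    rfl

end Lifts

/-! ### Parameters on `Mp^c`, their product formula and Gaussian inner products -/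

section Parameters

open Filter Topology ComplexConjugate

variable {V : Type*} [NormedAddCommGroup V] [InnerProductSpace ℂ V] [FiniteDimensional ℂ V]
  [MeasurableSpace V] [BorelSpace V] {h : ℝ} [hh : Fact (0 < h)]

theorem hasParameters_iff {A : Mpc V h} {g : V ≃L[ℝ] V} {l : ℂ} : HasParameters A g l ↔
    (sig A : V ≃L[ℝ] V) = g ∧ ∀ z v, kernel A z v = liftKer h g l z v := Iff.rfl

theorem HasParameters.param {A : Mpc V h} {g : V ≃L[ℝ] V} {l : ℂ} (hA : HasParameters A g l) :
    param A = l := by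
  rw [MpcGeom.param, (hasParameters_iff.1 hA).2, liftKer_eq]
  simp

theorem kernel_scalar_mul (c : Circle) (A : Mpc V h) (z v : V) :
    kernel (scalar c * A) z v = c * kernel A z v := rfl

theorem param_scalar_mul (c : Circle) (A : Mpc V h) : param (scalar c * A) = c * param A := rfl

theorem inner_Mpc (A : Mpc V h) (f g : Fock V h) :
    (inner ℂ (toH (A.1.1 f)) (toH (A.1.1 g)) : ℂ) = inner ℂ (toH f) (toH g) :=
  isometry_inner A.1.1.toLinearMap LinearMap.id A.2.1 f g

theorem inner_Mpc_left (A : Mpc V h) (f g : Fock V h) :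
    (inner ℂ (toH (A.1.1 f)) (toH g) : ℂ) = inner ℂ (toH f) (toH ((A⁻¹).1.1 g)) := by
  rw [← inner_Mpc A f]
  congr 2
  exact (A.1.1.apply_symm_apply g).symm

/-- Schur's lemma: the operator commutes with the Heisenberg group, and its scalar has modulus one
by unitarity. -/
theorem exists_scalar_of_sig_eq_one {A : Mpc V h} (hA : sig A = 1) : ∃ c : Circle, A = scalar c := by
  have hs : ∀ v, A.1.2 v = v := fun v =>
    congrArg (fun g : V ≃L[ℝ] V => g v) (congrArg Subtype.val hA)
  obtain ⟨c, hc⟩ := scalar_of_comm_heis A.1.1.toLinearMap (A⁻¹).1.1.toLinearMap (inner_Mpc_left A)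
    (fun v f => by
      have := A.2.2.2 v 0 (A.1.1 f)
      rw [hs, LinearEquiv.symm_apply_apply] at this
      exact this.symm)
  have hn : ‖c‖ = 1 := by
    have h1 : ‖toH (A.1.1 (coherent h 0))‖ ^ 2 = ‖toH (coherent h (0 : V))‖ ^ 2 := by
      rw [norm_toH_sq, norm_toH_sq, A.2.1]
    have h2 : A.1.1 (coherent h 0) = c • coherent h 0 := hc _
    rw [h2, map_smul, norm_smul, norm_coherent] at h1
    exact (pow_eq_one_iff_of_nonneg (norm_nonneg c) two_ne_zero).1 (by simpa [mul_pow] using h1)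
  refine ⟨⟨c, mem_sphere_zero_iff_norm.2 hn⟩, Subtype.ext (Prod.ext ?_ (congrArg Subtype.val hA))⟩
  exact LinearEquiv.ext fun f => hc f

theorem exists_scalar_mul_of_sig_eq {A B : Mpc V h} (hAB : sig A = sig B) :
    ∃ c : Circle, A = scalar c * B := by
  obtain ⟨c, hc⟩ := exists_scalar_of_sig_eq_one (A := A * B⁻¹) (by rw [map_mul, map_inv, hAB,
    mul_inv_cancel])
  exact ⟨c, by rw [← hc, inv_mul_cancel_right]⟩

theorem sq_norm_inv_sqrt_mul {d : ℝ} (hd : 0 < d) : ‖(((√d)⁻¹ : ℝ) : ℂ)‖ ^ 2 * d = 1 := by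
  rw [Complex.norm_real, Real.norm_eq_abs, sq_abs, inv_pow, Real.sq_sqrt hd.le,
    inv_mul_cancel₀ hd.ne']

/-- One element over `σ(A)` with a known kernel exists, with parameter `|det C_g|^{-1/2}`. All
others differ from it by a unit scalar, which only rotates the parameter. -/
theorem hasParameters_self (A : Mpc V h) : HasParameters A (sig A : V ≃L[ℝ] V) (param A) ∧
    ‖param A‖ ^ 2 * ‖LinearMap.det (linPart (sig A : V ≃L[ℝ] V))‖ = 1 := by
  have hd := sq_norm_inv_sqrt_mul (norm_pos_iff.2 (det_linPart_ne_zero (sig A).2))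
  obtain ⟨B, hB⟩ := exists_hasParameters (h := h) (sig A).2 hd
  obtain ⟨c, rfl⟩ := exists_scalar_mul_of_sig_eq (A := A) (B := B) (Subtype.ext hB.1.symm)
  rw [param_scalar_mul, hB.param, norm_mul, Circle.norm_coe, one_mul]
  refine ⟨hasParameters_iff.2 ⟨rfl, fun z v => ?_⟩, hd⟩
  rw [kernel_scalar_mul, (hasParameters_iff.1 hB).2]
  simp only [liftKer, mul_assoc]

theorem param_ne_zero (A : Mpc V h) : param A ≠ 0 := fun h0 => by
  have := (hasParameters_self A).2
  simp [h0] at this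

theorem sq_norm_param (A : Mpc V h) :
    ‖param A‖ ^ 2 * ‖LinearMap.det (linPart (sig A : V ≃L[ℝ] V))‖ = 1 := (hasParameters_self A).2

theorem ext_param {A B : Mpc V h} (hs : sig A = sig B) (hp : param A = param B) : A = B := by
  obtain ⟨c, rfl⟩ := exists_scalar_mul_of_sig_eq hs
  rw [param_scalar_mul] at hp
  have hc : c = 1 := Subtype.ext (mul_right_cancel₀ (param_ne_zero B) (hp.trans (one_mul _).symm))
  rw [hc, map_one, one_mul]

variable (h) in
theorem sig_surjective : Function.Surjective (sig : Mpc V h →* Sp V) := fun g => by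
  obtain ⟨B, hB⟩ := exists_hasParameters (h := h) g.2
    (sq_norm_inv_sqrt_mul (norm_pos_iff.2 (det_linPart_ne_zero g.2)))
  exact ⟨B, Subtype.ext hB.1⟩

theorem param_inv (A : Mpc V h) : param A⁻¹ = conj (param A) := by
  rw [param, param, kernel, kernel, ← inner_coherent_zero, ← inner_coherent_zero, ← inner_Mpc_left,
    inner_conj_symm]

theorem apply_coherent_zero (A : Mpc V h) : A.1.1 (coherent h 0)
    = param A • gaussVec h (isSiegel_ZL ((Sp V).inv_mem (sig A).2)) := by
  refine Subtype.ext (funext fun z => ?_)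
  have h1 := (hasParameters_iff.1 (hasParameters_self A).1).2 z 0
  rw [liftKer_eq] at h1
  change kernel A z 0 = param A * (gaussVec h _).1 z
  rw [h1, gaussVec_apply]
  congr 2
  simp
  ring

/-- The inner product of two Gaussian vectors. -/
def gaussInner (h : ℝ) (W Z : V →L[ℝ] V) : ℂ :=
  ∫ z, gaussFun h Z z * conj (gaussFun h W z) ∂(gauss V h)

theorem inner_gaussVec {W Z : V →L[ℝ] V} (hW : IsSiegel W) (hZ : IsSiegel Z) :
    (inner ℂ (toH (gaussVec h hW)) (toH (gaussVec h hZ)) : ℂ) = gaussInner h W Z := inner_toH _ _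

/-- The parameter of `A B` is `⟨e_0, A B e_0⟩ = ⟨A⁻¹ e_0, B e_0⟩`, and both vectors are multiples of
Gaussian vectors. -/
theorem param_mul (A B : Mpc V h) : param (A * B) = param A * param B *
    gaussInner h (ZL (sig A : V ≃L[ℝ] V)) (ZL (sig B : V ≃L[ℝ] V)⁻¹) := by
  have h1 : param (A * B)
      = inner ℂ (toH ((A⁻¹).1.1 (coherent h 0))) (toH (B.1.1 (coherent h 0))) := by
    rw [inner_Mpc_left, inv_inv, inner_coherent_zero]
    rfl
  rw [h1, apply_coherent_zero, apply_coherent_zero, map_smul, map_smul, inner_smul_left,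
    inner_smul_right, inner_gaussVec, param_inv, Complex.conj_conj, mul_assoc]
  simp only [map_inv, Subgroup.coe_inv, inv_inv]

/-- `W` and `Z` come from symplectic maps, so the normalisation `|λ|² |det C| = 1` for two elements
and for their product can be compared with the product formula for the determinants. Again no
integral is evaluated. -/
theorem sq_norm_gaussInner {W Z : V →L[ℝ] V} (hW : IsSiegel W) (hZ : IsSiegel Z) :
    ‖gaussInner h W Z‖ ^ 2 * ‖sdet W Z‖ = 1 := by
  obtain ⟨g, hg, rfl⟩ := hW.exists_ZL_eq
  obtain ⟨k, hk, rfl⟩ := hZ.exists_ZL_eq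
  obtain ⟨A, hA⟩ := sig_surjective h ⟨g, hg⟩
  obtain ⟨B, hB⟩ := sig_surjective h ⟨k⁻¹, (Sp V).inv_mem hk⟩
  have hA' : (sig A : V ≃L[ℝ] V) = g := congrArg Subtype.val hA
  have hB' : (sig B : V ≃L[ℝ] V) = k⁻¹ := congrArg Subtype.val hB
  have h1 := sq_norm_param (A * B)
  have h2 := det_linPart_mul hg ((Sp V).inv_mem hk)
  rw [inv_inv] at h2
  have h3 := sq_norm_param A
  have h4 := sq_norm_param B
  rw [map_mul, Subgroup.coe_mul, hA', hB', h2, param_mul, hA', hB', inv_inv] at h1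
  rw [hA'] at h3
  rw [hB'] at h4
  simp only [norm_mul, mul_pow] at h1
  calc _ = (‖param A‖ ^ 2 * ‖LinearMap.det (linPart g)‖)
        * (‖param B‖ ^ 2 * ‖LinearMap.det (linPart k⁻¹)‖)
        * (‖gaussInner h (ZL g) (ZL k)‖ ^ 2 * ‖sdet (ZL g) (ZL k)‖) := by rw [h3, h4]; ring
    _ = 1 := by rw [← h1]; ring

theorem gaussInner_zero_left {Z : V →L[ℝ] V} (hZ : IsSiegel Z) : gaussInner h 0 Z = 1 := by
  have h0 : gaussInner h 0 Z = ∫ z, (gaussVec h hZ).1 z ∂(gauss V h) := by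
    refine integral_congr_ae (Eventually.of_forall fun z => ?_)
    simp [gaussFun, gaussVec]
  rw [h0, integral_fock, gaussVec_apply]
  simp

omit [FiniteDimensional ℂ V] [MeasurableSpace V] [BorelSpace V] in
theorem IsSiegel.smul {W : V →L[ℝ] V} (hW : IsSiegel W) {t : ℂ} (ht : ‖t‖ * ‖W‖ < 1) :
    IsSiegel (t • W) where
  anti v := by
    change t • W (Complex.I • v) = -(Complex.I • (t • W v))
    rw [hW.anti v, smul_neg, smul_comm]
  symm v w := by
    change (inner ℂ (t • W v) w : ℂ) = inner ℂ (t • W w) v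
    rw [inner_smul_left, inner_smul_left, hW.symm]
  norm_lt := (norm_smul_le t W).trans_lt ht

/-- `t ↦ ⟨E_{tW}, E_Z⟩` is holomorphic. -/
theorem differentiableOn_gaussInner {W Z : V →L[ℝ] V} (hW : IsSiegel W) (hZ : IsSiegel Z) :
    DifferentiableOn ℂ (fun t : ℂ => gaussInner h (t • W) Z) {t | ‖t‖ * ‖W‖ < 1} := by
  classical
  have hO : IsOpen {t : ℂ | ‖t‖ * ‖W‖ < 1} := isOpen_lt (by fun_prop) continuous_const
  -- Off the disc `t W` need not be a Siegel point; the value 0 there plays no role.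
  set k : ℂ → FockH V h := fun t =>
    if ht : IsSiegel (t • W) then toH (gaussVec h ht) else 0 with hkdef
  have hk : ∀ t : ℂ, ‖t‖ * ‖W‖ < 1 → ∃ ht : IsSiegel (t • W), k t = toH (gaussVec h ht) :=
    fun t ht => ⟨hW.smul ht, dif_pos _⟩
  refine (differentiableOn_inner_of_coherent hO k (fun K hK hKc => ?_) (fun v => ?_)
    (toH (gaussVec h hZ))).congr fun t ht => ?_
  · rcases K.eq_empty_or_nonempty with rfl | hne
    · exact ⟨0, by simp⟩
    obtain ⟨t0, ht0, hmax⟩ := hKc.exists_isMaxOn hne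
      (f := fun t : ℂ => ‖t‖ * ‖W‖) (by fun_prop)
    set r := ‖t0‖ * ‖W‖ with hr
    have hr1 : r < 1 := hK ht0
    refine ⟨√(((1 - r)⁻¹) ^ Module.finrank ℂ V), fun t ht => ?_⟩
    obtain ⟨hs, e⟩ := hk t (hK ht)
    rw [e]
    refine Real.le_sqrt_of_sq_le ?_
    rw [norm_toH_sq]
    exact normSq_gaussVec_le hs ((norm_smul_le _ _).trans (hmax ht)) hr1
  · have : DifferentiableOn ℂ (fun t : ℂ => Complex.exp (-(t * inner ℂ v (W v) / (4 * hbar h))))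
        {t | ‖t‖ * ‖W‖ < 1} := by fun_prop
    refine this.congr fun t ht => ?_
    obtain ⟨hs, e⟩ := hk t ht
    rw [e, ← inner_conj_symm, inner_coherent, gaussVec_apply, ← Complex.exp_conj]
    change Complex.exp (conj (-(inner ℂ (t • W v) v / (4 * hbar h)))) = _
    rw [inner_smul_left]
    simp only [map_neg, map_div₀, map_mul, inner_conj_symm, Complex.conj_ofReal, map_ofNat,
      Complex.conj_conj]
  · obtain ⟨hs, e⟩ := hk t ht
    rw [e, inner_gaussVec]

omit [FiniteDimensional ℂ V] [MeasurableSpace V] [BorelSpace V] in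
/-- A holomorphic function on a disc of constant absolute value is constant. -/
theorem eq_one_of_norm_eq_one {W : V →L[ℝ] V} (hW : ‖W‖ < 1) {f : ℂ → ℂ}
    (hf : DifferentiableOn ℂ f {t | ‖t‖ * ‖W‖ < 1}) (hn : ∀ t : ℂ, ‖t‖ * ‖W‖ < 1 → ‖f t‖ = 1)
    (h0 : f 0 = 1) : f 1 = 1 := by
  have hO : IsOpen {t : ℂ | ‖t‖ * ‖W‖ < 1} := isOpen_lt (by fun_prop) continuous_const
  have hc : IsPreconnected {t : ℂ | ‖t‖ * ‖W‖ < 1} := by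
    refine (StarConvex.isPathConnected (a := (0 : ℂ)) (s := {t : ℂ | ‖t‖ * ‖W‖ < 1}) ?_
      (by simp)).isConnected.isPreconnected
    intro t ht a b ha hb hab
    rw [smul_zero, zero_add]
    change ‖b • t‖ * ‖W‖ < 1
    rw [norm_smul, Real.norm_of_nonneg hb]
    have h1 : b ≤ 1 := by linarith
    have h2 : 0 ≤ ‖t‖ * ‖W‖ := by positivity
    have h3 : ‖t‖ * ‖W‖ < 1 := ht
    nlinarith
  have h0m : (0 : ℂ) ∈ {t : ℂ | ‖t‖ * ‖W‖ < 1} := by simp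
  have h1m : (1 : ℂ) ∈ {t : ℂ | ‖t‖ * ‖W‖ < 1} := by simpa using hW
  have := Complex.eqOn_of_isPreconnected_of_isMaxOn_norm hc hO hf h0m
    (fun t ht => by
      change ‖f t‖ ≤ ‖f 0‖
      rw [hn t ht, hn 0 h0m]) h1m
  rw [this]
  exact h0

omit [MeasurableSpace V] [BorelSpace V] in
variable (V) in
/-- The determinant is a polynomial in the images of a basis. -/
theorem exists_det_eq : ∃ (n : ℕ) (b : Fin n → V) (Q : (Fin n → V) → ℂ), ContDiff ℂ ∞ Q ∧
    ∀ L : V →ₗ[ℂ] V, LinearMap.det L = Q fun i => L (b i) := by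
  let b := Module.finBasis ℂ V
  refine ⟨_, b, fun x => ∑ s : Equiv.Perm (Fin (Module.finrank ℂ V)),
    (Equiv.Perm.sign s : ℂ) * ∏ i, (b.coord (s i)).toContinuousLinearMap (x i), ?_, fun L => ?_⟩
  · refine ContDiff.sum fun s _ => contDiff_const.mul (contDiff_prod fun i _ => ?_)
    exact (ContinuousLinearMap.contDiff _).comp (contDiff_apply ℂ V i)
  · rw [← LinearMap.det_toMatrix b, Matrix.det_apply']
    simp [LinearMap.toMatrix_apply]

omit [MeasurableSpace V] [BorelSpace V] in
theorem differentiable_sdet_smul (W Z : V →L[ℝ] V) :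
    Differentiable ℂ fun t : ℂ => LinearMap.det (1 - t • cpart (W ∘L Z)) := by
  obtain ⟨n, b, Q, hQ, hdet⟩ := exists_det_eq V
  simp only [hdet]
  refine (hQ.differentiable (by simp)).comp (differentiable_pi.2 fun i => ?_)
  change Differentiable ℂ fun t : ℂ => b i - t • cpart (W ∘L Z) (b i)
  fun_prop

omit [FiniteDimensional ℂ V] [MeasurableSpace V] [BorelSpace V] in
theorem cpart_smul_comp {W Z : V →L[ℝ] V} (hW : IsAnti W) (hZ : IsAnti Z) (t : ℂ) :
    cpart ((t • W) ∘L Z) = t • cpart (W ∘L Z) := by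
  refine LinearMap.ext fun v => ?_
  rw [LinearMap.smul_apply, cpart_comp_apply hW hZ, cpart_comp_apply _ hZ]
  · rfl
  · intro v
    change t • W (Complex.I • v) = -(Complex.I • (t • W v))
    rw [hW v, smul_neg, smul_comm]

/-- Along `t W` this product is holomorphic in `t`, of modulus one by `sq_norm_gaussInner`, and
equal to 1 at `t = 0`; so it is constant. -/
theorem sq_gaussInner_mul_sdet {W Z : V →L[ℝ] V} (hW : IsSiegel W) (hZ : IsSiegel Z) :
    gaussInner h W Z ^ 2 * sdet W Z = 1 := by
  have := eq_one_of_norm_eq_one (W := W) hW.norm_lt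
    (f := fun t : ℂ => gaussInner h (t • W) Z ^ 2 * sdet (t • W) Z) ?_ (fun t ht => ?_) ?_
  · simpa using this
  · refine ((differentiableOn_gaussInner hW hZ).pow 2).mul ?_
    simp only [sdet, cpart_smul_comp hW.anti hZ.anti]
    exact (differentiable_sdet_smul W Z).differentiableOn
  · rw [norm_mul, norm_pow, sq_norm_gaussInner (hW.smul ht) hZ]
  · have : cpart (0 : V →L[ℝ] V) = 0 := LinearMap.ext fun v => by simp [cpart_apply]
    simp [gaussInner_zero_left hZ, sdet, this]

theorem gaussInner_ne_zero {W Z : V →L[ℝ] V} (hW : IsSiegel W) (hZ : IsSiegel Z) :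
    gaussInner h W Z ≠ 0 := fun h0 => by
  have := sq_gaussInner_mul_sdet (h := h) hW hZ
  simp [h0] at this

end Parameters

/-! ### Lifting homomorphisms by a cocycle of parameters -/

section LiftHom

variable {V : Type*} [NormedAddCommGroup V] [InnerProductSpace ℂ V] [FiniteDimensional ℂ V]
  [MeasurableSpace V] [BorelSpace V] {h : ℝ} [hh : Fact (0 < h)]

/-- A cocycle of parameters defines a lift of a homomorphism to the symplectic group. -/
theorem exists_lift_hom {Γ : Type*} [Group Γ] (i : Γ →* Sp V) (l : Γ → ℂ)
    (hl : ∀ g, ‖l g‖ ^ 2 * ‖LinearMap.det (linPart (i g : V ≃L[ℝ] V))‖ = 1)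
    (hmul : ∀ g k, l (g * k) = l g * l k *
      gaussInner h (ZL (i g : V ≃L[ℝ] V)) (ZL (i k : V ≃L[ℝ] V)⁻¹)) :
    ∃ F : Γ →* Mpc V h, ∀ g, HasParameters (F g) (i g : V ≃L[ℝ] V) (l g) := by
  choose F hF using fun g => exists_hasParameters (h := h) (i g).2 (hl g)
  have hs : ∀ g, sig (F g) = i g := fun g => Subtype.ext (hF g).1
  refine ⟨MonoidHom.mk' F fun g k => ext_param ?_ ?_, hF⟩
  · rw [map_mul, hs, hs, hs, map_mul]
  · rw [param_mul, (hF _).param, (hF _).param, (hF _).param, hs, hs, hmul]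

end LiftHom

/-! ### The lift of the pseudo-unitary group -/

section PseudoUnitaryLift

open ComplexConjugate

variable {V : Type*} [NormedAddCommGroup V] [InnerProductSpace ℂ V]

/-- The orthogonal projection on `V_-`. -/
def minusProj (jt : CommutingCCS V) : V →ₗ[ℂ] V :=
  (1 / 2 : ℂ) • (LinearMap.id + Complex.I • jt.toLin)

theorem minusProj_apply (jt : CommutingCCS V) (v : V) :
    minusProj jt v = (1 / 2 : ℂ) • (v + Complex.I • jt.toLin v) := rfl

theorem toLin_minusProj (jt : CommutingCCS V) (v : V) :
    jt.toLin (minusProj jt v) = -(Complex.I • minusProj jt v) := by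
  have h1 : Complex.I • Complex.I • jt.toLin v = -jt.toLin v := by
    rw [smul_smul, Complex.I_mul_I, neg_one_smul]
  rw [minusProj_apply, map_smul, map_add, map_smul, jt.sq, smul_comm Complex.I (1 / 2 : ℂ),
    smul_add Complex.I, h1]
  module

theorem minusProj_mem (jt : CommutingCCS V) (v : V) : minusProj jt v ∈ minusSpace jt := by
  change jt.toLin (minusProj jt v) + Complex.I • minusProj jt v = 0
  rw [toLin_minusProj, neg_add_cancel]

theorem minusProj_of_mem (jt : CommutingCCS V) {v : V} (hv : v ∈ minusSpace jt) :
    minusProj jt v = v := by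
  have h1 : jt.toLin v = -(Complex.I • v) := eq_neg_of_add_eq_zero_left hv
  rw [minusProj_apply, h1, smul_neg, smul_smul, Complex.I_mul_I]
  module

theorem minusProj_minusProj (jt : CommutingCCS V) (v : V) :
    minusProj jt (minusProj jt v) = minusProj jt v := minusProj_of_mem jt (minusProj_mem jt v)

theorem inner_toLin (jt : CommutingCCS V) (v w : V) :
    (inner ℂ (jt.toLin v) w : ℂ) = -inner ℂ v (jt.toLin w) := by
  have h1 : (inner ℂ (jt.toLin v) (jt.toLin (jt.toLin w)) : ℂ) = inner ℂ v (jt.toLin w) := by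
    rw [inner_eq_Om, inner_eq_Om v, ← map_smul, jt.symp, jt.symp]
  rw [jt.sq, inner_neg_right] at h1
  rw [← h1, neg_neg]

theorem inner_minusProj (jt : CommutingCCS V) (v w : V) :
    (inner ℂ (minusProj jt v) w : ℂ) = inner ℂ v (minusProj jt w) := by
  simp only [minusProj_apply, inner_smul_left, inner_smul_right, inner_add_left, inner_add_right,
    inner_toLin, map_div₀, map_one, map_ofNat, Complex.conj_I]
  ring

/-- An antilinear map which exchanges `V_-` and its orthogonal complement. -/
def Exchanges (jt : CommutingCCS V) (W : V →L[ℝ] V) : Prop :=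
  ∀ v, W (minusProj jt v) = W v - minusProj jt (W v)

theorem toLin_linPart (jt : CommutingCCS V) (g : pseudoUnitary jt) (v : V) :
    jt.toLin (linPart (g : V ≃L[ℝ] V) v) = linPart (g : V ≃L[ℝ] V) (jt.toLin v) := by
  rw [linPart_apply, linPart_apply, ← map_smul jt.toLin Complex.I v, g.2.2, g.2.2]
  simp only [map_smul, map_sub]

theorem toLin_antiPart (jt : CommutingCCS V) (g : pseudoUnitary jt) (v : V) :
    jt.toLin (antiPart (g : V ≃L[ℝ] V) v) = antiPart (g : V ≃L[ℝ] V) (jt.toLin v) := by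
  rw [antiPart, antiPart, ← map_smul jt.toLin Complex.I v, g.2.2, g.2.2]
  simp only [map_smul, map_add]

theorem minusProj_linPart (jt : CommutingCCS V) (g : pseudoUnitary jt) (v : V) :
    minusProj jt (linPart (g : V ≃L[ℝ] V) v) = linPart (g : V ≃L[ℝ] V) (minusProj jt v) := by
  rw [minusProj_apply, minusProj_apply, toLin_linPart, map_smul, map_add, map_smul]

variable [FiniteDimensional ℂ V]

/-- `Z_g` commutes with `j̃` and anticommutes with `j`, so it exchanges the subspaces where `j̃ =
-j` and `j̃ = j`. -/
theorem exchanges_ZL (jt : CommutingCCS V) (g : pseudoUnitary jt) :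
    Exchanges jt (ZL (g : V ≃L[ℝ] V)) := by
  intro v
  have h1 : jt.toLin (ZL (g : V ≃L[ℝ] V) v) = ZL (g : V ≃L[ℝ] V) (jt.toLin v) := by
    have h2 : linPart (g : V ≃L[ℝ] V) (jt.toLin (ZL (g : V ≃L[ℝ] V) v))
        = linPart (g : V ≃L[ℝ] V) (ZL (g : V ≃L[ℝ] V) (jt.toLin v)) := by
      rw [← toLin_linPart, linPart_ZL g.2.1, linPart_ZL g.2.1, toLin_antiPart]
    rw [← linPartInv_linPart g.2.1 (jt.toLin _), h2, linPartInv_linPart g.2.1]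
  rw [minusProj_apply, minusProj_apply, smul_of_isAnti (isAnti_ZL _), map_add, isAnti_ZL, h1]
  simp only [map_div₀, map_one, map_ofNat]
  module

omit [FiniteDimensional ℂ V] in
/-- The sum of `C` on `V_-` and of the identity on its complement. -/
theorem mul_minus_parts (jt : CommutingCCS V) {A B : Module.End ℂ V}
    (hB : ∀ v, minusProj jt (B v) = B (minusProj jt v)) :
    (A * minusProj jt + (1 - minusProj jt)) * (B * minusProj jt + (1 - minusProj jt))
      = A * B * minusProj jt + (1 - minusProj jt) := by
  refine LinearMap.ext fun v => ?_
  simp only [Module.End.mul_apply, LinearMap.add_apply, LinearMap.sub_apply, Module.End.one_apply,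
    map_add, map_sub, hB, minusProj_minusProj]
  abel

/-- The determinant of the part of `C` on `V_-`. -/
def minusDet (jt : CommutingCCS V) (C : V →ₗ[ℂ] V) : ℂ :=
  LinearMap.det (C * minusProj jt + (1 - minusProj jt) : Module.End ℂ V)

omit [FiniteDimensional ℂ V] in
theorem minusDet_mul (jt : CommutingCCS V) (A : V →ₗ[ℂ] V) {B : V →ₗ[ℂ] V}
    (hB : ∀ v, minusProj jt (B v) = B (minusProj jt v)) :
    minusDet jt (A * B : Module.End ℂ V) = minusDet jt A * minusDet jt B := by
  rw [minusDet, ← mul_minus_parts jt hB, map_mul]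
  rfl

/-- The operator behind `minusDet` preserves `V_-` and is the identity on the quotient, so its
determinant is that of the restriction. Working on all of `V` gives multiplicativity and holomorphy
without a change of space. -/
theorem detMinus_eq (jt : CommutingCCS V) (g : pseudoUnitary jt) :
    detMinus jt g = minusDet jt (linPart (g : V ≃L[ℝ] V)) := by
  set f : Module.End ℂ V :=
    linPart (g : V ≃L[ℝ] V) * minusProj jt + (1 - minusProj jt) with hf
  have hfv : ∀ v, f v = linPart (g : V ≃L[ℝ] V) (minusProj jt v) + (v - minusProj jt v) :=
    fun v => rfl
  have hN : minusSpace jt ≤ (minusSpace jt).comap f := fun v hv => by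
    change f v ∈ minusSpace jt
    rw [hfv, minusProj_of_mem jt hv, sub_self, add_zero]
    exact linPart_minusSpace jt g v hv
  have h1 := LinearMap.det_eq_det_mul_det (minusSpace jt) f hN
  have h2 : (minusSpace jt).mapQ (minusSpace jt) f hN = LinearMap.id := by
    refine Submodule.linearMap_qext _ (LinearMap.ext fun v => ?_)
    change Submodule.Quotient.mk (f v) = Submodule.Quotient.mk v
    rw [Submodule.Quotient.eq, hfv]
    have := (minusSpace jt).sub_mem (linPart_minusSpace jt g _ (minusProj_mem jt v))
      (minusProj_mem jt v)
    convert this using 1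
    abel
  rw [h2, LinearMap.det_id, mul_one] at h1
  rw [minusDet, h1, detMinus]
  congr 1
  refine LinearMap.ext fun v => Subtype.ext ?_
  change linPart (g : V ≃L[ℝ] V) v = f v
  rw [hfv, minusProj_of_mem jt v.2, sub_self, add_zero]

theorem minusDet_inv (jt : CommutingCCS V) (g : pseudoUnitary jt) :
    minusDet jt (linPart (g : V ≃L[ℝ] V)⁻¹) = conj (minusDet jt (linPart (g : V ≃L[ℝ] V))) := by
  refine det_of_adjoint fun v w => ?_
  have h2 : minusProj jt (linPart (g : V ≃L[ℝ] V)⁻¹ w)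
      = linPart (g : V ≃L[ℝ] V)⁻¹ (minusProj jt w) := minusProj_linPart jt g⁻¹ w
  simp only [Module.End.mul_apply, LinearMap.add_apply, LinearMap.sub_apply, Module.End.one_apply,
    inner_add_left, inner_add_right, inner_sub_left, inner_sub_right, inner_linPart g.2.1,
    inner_minusProj]
  rw [← h2]

theorem det_one_sub_mul_comm {R X : Type*} [CommRing R] [AddCommGroup X] [Module R X]
    [Module.Free R X] [Module.Finite R X] (A B : Module.End R X) :
    LinearMap.det (1 - A * B) = LinearMap.det (1 - B * A) := by
  classical
  let b := Module.Free.chooseBasis R X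
  rw [← LinearMap.det_toMatrix b, ← LinearMap.det_toMatrix b, map_sub, map_sub,
    LinearMap.toMatrix_mul, LinearMap.toMatrix_mul, LinearMap.toMatrix_one,
    Matrix.det_one_sub_mul_comm]

/-- `1 - W Z` splits into a block on `V_-` and a block on the complement. As `W` and `Z` exchange
the two subspaces, `det (1 - A B) = det (1 - B A)` turns the second block into one for `Z W` on
`V_-`, which is adjoint to the first. So the two determinants have equal moduli. -/
theorem norm_det_minusProj (jt : CommutingCCS V) {W Z : V →L[ℝ] V} (hW : IsSiegel W)
    (hZ : IsSiegel Z) (hWj : Exchanges jt W) (hZj : Exchanges jt Z) :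
    ‖minusDet jt (1 - cpart (W ∘L Z))‖ ^ 2 = ‖sdet W Z‖ := by
  set T : Module.End ℂ V := cpart (W ∘L Z) with hT
  have hTv : ∀ v, T v = W (Z v) := cpart_comp_apply hW.anti hZ.anti
  set S : Module.End ℂ V := cpart (Z ∘L W) with hS
  have hSv : ∀ v, S v = Z (W v) := cpart_comp_apply hZ.anti hW.anti
  set p : Module.End ℂ V := minusProj jt with hp
  have hpp : ∀ v, p (p v) = p v := minusProj_minusProj jt
  have hTp : ∀ v, p (T v) = T (p v) := fun v => by
    rw [hTv, hTv]
    have h1 := hWj (Z v)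
    have h2 := hZj v
    change Z (p v) = Z v - p (Z v) at h2
    change W (p (Z v)) = W (Z v) - p (W (Z v)) at h1
    rw [h2, map_sub, h1]
    abel
  have hm : minusDet jt (1 - T) = LinearMap.det (1 - T * p) := by
    rw [minusDet]
    congr 1
    change (1 - T) * p + (1 - p) = 1 - T * p
    noncomm_ring
  have hfac : sdet W Z = LinearMap.det (1 - T * p) * LinearMap.det (1 - T * (1 - p)) := by
    rw [← map_mul]
    change LinearMap.det (1 - T) = _
    congr 1
    refine LinearMap.ext fun v => ?_
    simp only [Module.End.mul_apply, LinearMap.sub_apply, Module.End.one_apply, map_sub, hTp, hpp]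
    abel
  have hadj : LinearMap.det (1 - p * S) = conj (LinearMap.det (1 - T * p)) := by
    refine det_of_adjoint fun v w => ?_
    simp only [Module.End.mul_apply, LinearMap.sub_apply, Module.End.one_apply, inner_sub_left,
      inner_sub_right, hTv, hSv]
    congr 1
    rw [← inner_minusProj jt]
    change (inner ℂ (W (Z (p v))) w : ℂ) = inner ℂ (p v) (Z (W w))
    rw [hW.symm, ← inner_conj_symm, hZ.symm, inner_conj_symm]
  -- `W` and `Z` are only real linear, so the factors are interchanged in the real determinant,
  -- which sees squared moduli.
  have hq : ‖LinearMap.det (1 - T * (1 - p))‖ ^ 2 = ‖LinearMap.det (1 - p * S)‖ ^ 2 := by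
    rw [← det_real_restrict, ← det_real_restrict]
    have := det_one_sub_mul_comm (R := ℝ) (W : V →ₗ[ℝ] V)
      ((p.restrictScalars ℝ : V →ₗ[ℝ] V) * (Z : V →ₗ[ℝ] V) : Module.End ℝ V)
    convert this using 2
    · refine LinearMap.ext fun v => ?_
      change v - T (v - p v) = v - W (p (Z v))
      have h2 : Z (p v) = Z v - p (Z v) := hZj v
      rw [hTv, map_sub, h2, sub_sub_cancel]
    · refine LinearMap.ext fun v => ?_
      change v - p (S v) = v - p (Z (W v))
      rw [hSv]
  rw [hadj, Complex.norm_conj] at hq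
  have hq' := (sq_eq_sq₀ (norm_nonneg _) (norm_nonneg _)).1 hq
  rw [hm, hfac, norm_mul, hq', sq]

variable [MeasurableSpace V] [BorelSpace V] {h : ℝ} [hh : Fact (0 < h)]

/-- The modulus is one by `norm_det_minusProj`, and the holomorphic deformation `t W` fixes the
phase. Here the square root of `det (1 - W Z)` is itself a determinant, which is why `(Det C_g^-)⁻¹`
is multiplicative in the required sense. -/
theorem gaussInner_mul_minusDet (jt : CommutingCCS V) {W Z : V →L[ℝ] V} (hW : IsSiegel W)
    (hZ : IsSiegel Z) (hWj : Exchanges jt W) (hZj : Exchanges jt Z) :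
    gaussInner h W Z * minusDet jt (1 - cpart (W ∘L Z)) = 1 := by
  have hm : ∀ t : ℂ, minusDet jt (1 - cpart ((t • W) ∘L Z))
      = LinearMap.det (1 - t • (cpart (W ∘L Z) * minusProj jt : Module.End ℂ V)) := fun t => by
    rw [minusDet, cpart_smul_comp hW.anti hZ.anti]
    congr 1
    refine LinearMap.ext fun v => ?_
    simp
  have hj : ∀ t : ℂ, Exchanges jt (t • W) := fun t v => by
    change t • W (minusProj jt v) = t • W v - minusProj jt (t • W v)
    rw [hWj, smul_sub, map_smul]
  have := eq_one_of_norm_eq_one (W := W) hW.norm_lt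
    (f := fun t : ℂ => gaussInner h (t • W) Z * minusDet jt (1 - cpart ((t • W) ∘L Z))) ?_
    (fun t ht => ?_) ?_
  · simpa using this
  · refine (differentiableOn_gaussInner hW hZ).mul ?_
    simp only [hm]
    obtain ⟨n, b, Q, hQ, hdet⟩ := exists_det_eq V
    simp only [hdet]
    refine ((hQ.differentiable (by simp)).comp (differentiable_pi.2 fun i => ?_)).differentiableOn
    change Differentiable ℂ fun t : ℂ => b i - t • cpart (W ∘L Z) (minusProj jt (b i))
    fun_prop
  · refine (pow_eq_one_iff_of_nonneg (norm_nonneg _) two_ne_zero).1 ?_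
    rw [norm_mul, mul_pow, norm_det_minusProj jt (hW.smul ht) hZ (hj t) hZj,
      sq_norm_gaussInner (hW.smul ht) hZ]
  · simp only [hm]
    simp [gaussInner_zero_left hZ]

theorem exists_pseudoUnitary_lift (jt : CommutingCCS V) : ∃ F : pseudoUnitary jt →* Mpc V h,
    ∀ g, HasParameters (F g) (g : V ≃L[ℝ] V) (detMinus jt g)⁻¹ := by
  have hle : pseudoUnitary jt ≤ Sp V := fun g hg => hg.1
  have hmul : ∀ g k : pseudoUnitary jt, detMinus jt (g * k) = detMinus jt g *
      minusDet jt (1 - cpart (ZL (g : V ≃L[ℝ] V) ∘L ZL (k : V ≃L[ℝ] V)⁻¹)) * detMinus jt k := by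
    intro g k
    have hk := minusProj_linPart jt k
    rw [detMinus_eq, detMinus_eq, detMinus_eq, Subgroup.coe_mul, linPart_mul g.2.1 k.2.1,
      minusDet_mul jt _ hk, minusDet_mul jt]
    intro v
    have h0 := cpart_comp_apply (isAnti_ZL (g : V ≃L[ℝ] V)) (isAnti_ZL (k : V ≃L[ℝ] V)⁻¹)
    have h1 := exchanges_ZL jt g (ZL (k : V ≃L[ℝ] V)⁻¹ v)
    have h2 : ZL (k : V ≃L[ℝ] V)⁻¹ (minusProj jt v)
        = ZL (k : V ≃L[ℝ] V)⁻¹ v - minusProj jt (ZL (k : V ≃L[ℝ] V)⁻¹ v) := exchanges_ZL jt k⁻¹ v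
    simp only [LinearMap.sub_apply, Module.End.one_apply, map_sub, h0, h2, h1]
    abel
  have hG : ∀ g k : pseudoUnitary jt,
      gaussInner h (ZL (g : V ≃L[ℝ] V)) (ZL (k : V ≃L[ℝ] V)⁻¹) *
      minusDet jt (1 - cpart (ZL (g : V ≃L[ℝ] V) ∘L ZL (k : V ≃L[ℝ] V)⁻¹)) = 1 := fun g k =>
    gaussInner_mul_minusDet jt (isSiegel_ZL g.2.1) (isSiegel_ZL ((Sp V).inv_mem k.2.1))
      (exchanges_ZL jt g) (exchanges_ZL jt k⁻¹)
  refine exists_lift_hom (Subgroup.inclusion hle) (fun g => (detMinus jt g)⁻¹) (fun g => ?_)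
    fun g k => ?_
  · change ‖(detMinus jt g)⁻¹‖ ^ 2 * ‖LinearMap.det (linPart (g : V ≃L[ℝ] V))‖ = 1
    have h1 := hmul g g⁻¹
    rw [mul_inv_cancel, detMinus_eq jt 1, detMinus_eq jt g⁻¹] at h1
    have e1 : minusDet jt (linPart ((1 : pseudoUnitary jt) : V ≃L[ℝ] V)) = 1 := by
      rw [Subgroup.coe_one, linPart_one, minusDet, one_mul, add_sub_cancel, map_one]
    have e2 : (((g⁻¹ : pseudoUnitary jt) : V ≃L[ℝ] V))⁻¹ = (g : V ≃L[ℝ] V) := inv_inv _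
    have e3 : ((g⁻¹ : pseudoUnitary jt) : V ≃L[ℝ] V) = (g : V ≃L[ℝ] V)⁻¹ := rfl
    rw [e1, e2, e3, minusDet_inv, ← detMinus_eq] at h1
    have h2 := det_linPart_mul_conj g.2.1
    have h3 := norm_det_minusProj jt (isSiegel_ZL g.2.1) (isSiegel_ZL g.2.1) (exchanges_ZL jt g)
      (exchanges_ZL jt g)
    replace h1 := congrArg norm h1
    replace h2 := congrArg norm h2
    rw [norm_one, norm_mul, norm_mul, Complex.norm_conj] at h1
    rw [norm_one, norm_mul, norm_mul, Complex.norm_conj] at h2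
    rw [← h3] at h2
    rw [norm_inv]
    set m := ‖detMinus jt g‖
    set x := ‖minusDet jt (1 - cpart (ZL (g : V ≃L[ℝ] V) ∘L ZL (g : V ≃L[ℝ] V)))‖
    set d := ‖LinearMap.det (linPart (g : V ≃L[ℝ] V))‖
    have hm : 0 ≤ m := norm_nonneg _
    have hx : 0 ≤ x := norm_nonneg _
    have hd : 0 ≤ d := norm_nonneg _
    have hm0 : m ≠ 0 := by rintro e; rw [e] at h1; simp at h1
    have h4 : (d * x) ^ 2 = 1 := by linear_combination h2
    have h5 : d * x = 1 := (pow_eq_one_iff_of_nonneg (by positivity) two_ne_zero).1 h4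
    -- `|det C_g| = |det C_g^-|²`: the blocks of `C_g` on `V_-` and on its complement contribute the
    -- same modulus.
    have h6 : d = m ^ 2 := by
      have hx0 : x ≠ 0 := by rintro e; rw [e] at h5; simp at h5
      apply mul_right_cancel₀ hx0
      rw [h5]
      linear_combination h1
    rw [h6, inv_pow, inv_mul_cancel₀ (pow_ne_zero _ hm0)]
  · change (detMinus jt (g * k))⁻¹ = (detMinus jt g)⁻¹ * (detMinus jt k)⁻¹ *
      gaussInner h (ZL (g : V ≃L[ℝ] V)) (ZL (k : V ≃L[ℝ] V)⁻¹)
    rw [hmul, mul_inv, mul_inv, ← eq_inv_of_mul_eq_one_left (hG g k)]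
    ring

end PseudoUnitaryLift

/-! ### The splitting `V = F ⊕ jF`, the maps `τ_F(C)` and the conjugation fixing `F` -/

section LagrangianSplitting

open ComplexConjugate

variable {V : Type*} [NormedAddCommGroup V] [InnerProductSpace ℂ V] [FiniteDimensional ℂ V]
  {F : Submodule ℝ V}

theorem projF_re (v : V) {w : V} (hw : w ∈ F) :
    (inner ℂ (v - (projF F v : V)) w : ℂ).re = 0 := by
  let _ : InnerProductSpace ℝ V := InnerProductSpace.complexToReal
  exact F.starProjection_inner_eq_zero v w hw

theorem projF_eq {v : V} {a : F} (h : ∀ w ∈ F, (inner ℂ (v - (a : V)) w : ℂ).re = 0) :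
    projF F v = a := by
  let _ : InnerProductSpace ℝ V := InnerProductSpace.complexToReal
  exact Subtype.ext (Submodule.eq_starProjection_of_mem_of_inner_eq_zero a.2 h)

theorem re_inner_invTranspose (C : F ≃ₗ[ℝ] F) (a b : F) :
    (inner ℂ (invTranspose C a : V) (b : V) : ℂ).re = (inner ℂ (a : V) (C.symm b : V) : ℂ).re := by
  let _ : InnerProductSpace ℝ V := InnerProductSpace.complexToReal
  exact LinearMap.adjoint_inner_left (C.symm : F →ₗ[ℝ] F) b a

omit [FiniteDimensional ℂ V] in
theorem im_inner_of_mem (hF : IsLagrangian F) (a b : F) : (inner ℂ (a : V) (b : V) : ℂ).im = 0 := by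
  rw [← Om_eq_im]
  exact (hF a).1 a.2 b b.2

omit [FiniteDimensional ℂ V] in
theorem re_inner_I_of_mem (hF : IsLagrangian F) (a b : F) :
    (inner ℂ (Complex.I • (a : V)) (b : V) : ℂ).re = 0 := by
  rw [inner_smul_left]
  simp [im_inner_of_mem hF]

omit [FiniteDimensional ℂ V] in
-- The `G_j`-orthogonal complement of `F` is `jF`, because `F` is its own `Ω`-annihilator.
theorem mem_of_re_inner_I (hF : IsLagrangian F) {u : V}
    (hu : ∀ w ∈ F, (inner ℂ u w : ℂ).re = 0) : -(Complex.I • u) ∈ F := by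
  refine (hF _).2 fun w hw => ?_
  rw [Om_eq_im, inner_neg_left, inner_smul_left]
  simp [hu w hw]

theorem projF_add_I (hF : IsLagrangian F) (a b : F) :
    projF F ((a : V) + Complex.I • (b : V)) = a := by
  refine projF_eq fun w hw => ?_
  rw [add_sub_cancel_left]
  exact re_inner_I_of_mem hF b ⟨w, hw⟩

omit [FiniteDimensional ℂ V] in
theorem neg_I_smul_add (a b : V) : -(Complex.I • (a + Complex.I • b)) = b + Complex.I • (-a) := by
  rw [smul_add, smul_smul, Complex.I_mul_I]
  module

theorem exists_eq_add_I (hF : IsLagrangian F) (v : V) :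
    ∃ a b : F, v = (a : V) + Complex.I • (b : V) := by
  refine ⟨projF F v, ⟨_, mem_of_re_inner_I hF fun w hw => projF_re v hw⟩, ?_⟩
  rw [smul_neg, smul_smul, Complex.I_mul_I]
  module

theorem tauF_add_I (hF : IsLagrangian F) (C : F ≃ₗ[ℝ] F) (a b : F) :
    tauF C ((a : V) + Complex.I • (b : V)) = (C a : V) + Complex.I • (invTranspose C b : V) := by
  have h1 : projF F (-(Complex.I • ((a : V) + Complex.I • (b : V)))) = b := by
    rw [neg_I_smul_add]
    exact projF_add_I hF b (-a)
  rw [tauF, projF_add_I hF, h1]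

omit [FiniteDimensional ℂ V] in
theorem inner_add_I (hF : IsLagrangian F) (a b c d : F) :
    (inner ℂ ((a : V) + Complex.I • (b : V)) ((c : V) + Complex.I • (d : V)) : ℂ)
      = (inner ℂ (a : V) (c : V) : ℂ).re + (inner ℂ (b : V) (d : V) : ℂ).re
        + Complex.I * ((inner ℂ (a : V) (d : V) : ℂ).re - (inner ℂ (b : V) (c : V) : ℂ).re) := by
  have e : ∀ x y : F, (inner ℂ (x : V) (y : V) : ℂ) = ((inner ℂ (x : V) (y : V) : ℂ).re : ℂ) :=
    fun x y => Complex.ext rfl (im_inner_of_mem hF x y)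
  simp only [inner_add_left, inner_add_right, inner_smul_left, inner_smul_right, Complex.conj_I]
  rw [e a c, e a d, e b c, e b d]
  simp only [Complex.ofReal_re]
  linear_combination (-((inner ℂ (b : V) (d : V) : ℂ).re : ℂ)) * Complex.I_sq

theorem invTranspose_mul (C D : F ≃ₗ[ℝ] F) (a : F) :
    invTranspose (C * D) a = invTranspose C (invTranspose D a) := by
  let _ : InnerProductSpace ℝ V := InnerProductSpace.complexToReal
  refine ext_inner_right ℝ fun b => ?_
  change (inner ℂ (invTranspose (C * D) a : V) (b : V) : ℂ).re
    = (inner ℂ (invTranspose C (invTranspose D a) : V) (b : V) : ℂ).re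
  rw [re_inner_invTranspose, re_inner_invTranspose, re_inner_invTranspose]
  rfl

theorem invTranspose_one (a : F) : invTranspose (1 : F ≃ₗ[ℝ] F) a = a := by
  let _ : InnerProductSpace ℝ V := InnerProductSpace.complexToReal
  refine ext_inner_right ℝ fun b => ?_
  change (inner ℂ (invTranspose (1 : F ≃ₗ[ℝ] F) a : V) (b : V) : ℂ).re = (inner ℂ (a : V) (b : V) : ℂ).re
  rw [re_inner_invTranspose]
  rfl

theorem tauF_mul (hF : IsLagrangian F) (C D : F ≃ₗ[ℝ] F) (v : V) :
    tauF (C * D) v = tauF C (tauF D v) := by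
  obtain ⟨a, b, rfl⟩ := exists_eq_add_I hF v
  rw [tauF_add_I hF, tauF_add_I hF, tauF_add_I hF, invTranspose_mul]
  rfl

theorem tauF_one (hF : IsLagrangian F) (v : V) : tauF (1 : F ≃ₗ[ℝ] F) v = v := by
  obtain ⟨a, b, rfl⟩ := exists_eq_add_I hF v
  rw [tauF_add_I hF, invTranspose_one]
  rfl

/-- `τ_F(C)` as a linear automorphism. -/
def tauFEquiv (hF : IsLagrangian F) (C : F ≃ₗ[ℝ] F) : V ≃L[ℝ] V :=
  LinearEquiv.toContinuousLinearEquiv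
    { toFun := tauF C
      invFun := tauF C⁻¹
      map_add' := fun v w => by
        simp only [tauF, map_add, smul_add, neg_add, Submodule.coe_add]
        abel
      map_smul' := fun r v => by
        have e : -(Complex.I • r • v) = r • -(Complex.I • v) := by rw [smul_comm, smul_neg]
        simp only [tauF, e, map_smul, Submodule.coe_smul, smul_add, RingHom.id_apply]
        rw [smul_comm Complex.I r]
      left_inv := fun v => by rw [← tauF_mul hF, inv_mul_cancel, tauF_one hF]
      right_inv := fun v => by rw [← tauF_mul hF, mul_inv_cancel, tauF_one hF] }

theorem tauFEquiv_apply (hF : IsLagrangian F) (C : F ≃ₗ[ℝ] F) (v : V) :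
    tauFEquiv hF C v = tauF C v := rfl

theorem tauFEquiv_mem (hF : IsLagrangian F) (C : F ≃ₗ[ℝ] F) : tauFEquiv hF C ∈ Sp V := by
  intro v w
  obtain ⟨a, b, rfl⟩ := exists_eq_add_I hF v
  obtain ⟨c, d, rfl⟩ := exists_eq_add_I hF w
  have e1 : ∀ x y : F, (inner ℂ (C x : V) (invTranspose C y : V) : ℂ).re
      = (inner ℂ (x : V) (y : V) : ℂ).re := fun x y => by
    rw [← inner_conj_symm, Complex.conj_re, re_inner_invTranspose, LinearEquiv.symm_apply_apply,
      ← inner_conj_symm, Complex.conj_re]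
  have e2 : ∀ x y : F, (inner ℂ (invTranspose C y : V) (C x : V) : ℂ).re
      = (inner ℂ (y : V) (x : V) : ℂ).re := fun x y => by
    rw [re_inner_invTranspose, LinearEquiv.symm_apply_apply]
  rw [tauFEquiv_apply, tauFEquiv_apply, tauF_add_I hF, tauF_add_I hF, Om_eq_im, Om_eq_im,
    inner_add_I hF, inner_add_I hF, e1, e2]
  simp

/-- `τ_F` as a homomorphism. -/
def tauFHom (hF : IsLagrangian F) : (F ≃ₗ[ℝ] F) →* Sp V :=
  MonoidHom.mk' (fun C => ⟨tauFEquiv hF C, tauFEquiv_mem hF C⟩) fun C D =>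
    Subtype.ext (ContinuousLinearEquiv.ext (funext fun v => tauF_mul hF C D v))

theorem coe_tauFHom (hF : IsLagrangian F) (C : F ≃ₗ[ℝ] F) :
    (tauFHom hF C : V ≃L[ℝ] V) = tauFEquiv hF C := rfl

variable (F) in
/-- The complex conjugation of `V` with respect to `F`. -/
def conjF : V ≃ₗᵢ[ℝ] V :=
  letI : InnerProductSpace ℝ V := InnerProductSpace.complexToReal
  F.reflection

theorem conjF_add_I (hF : IsLagrangian F) (a b : F) :
    conjF F ((a : V) + Complex.I • (b : V)) = (a : V) - Complex.I • (b : V) := by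
  have h1 : conjF F ((a : V) + Complex.I • (b : V))
      = 2 • (projF F ((a : V) + Complex.I • (b : V)) : V) - ((a : V) + Complex.I • (b : V)) := rfl
  rw [h1, projF_add_I hF]
  module

theorem conjF_add_I' (hF : IsLagrangian F) (a b : F) :
    conjF F ((a : V) + Complex.I • (b : V)) = (a : V) + Complex.I • ((-b : F) : V) := by
  rw [conjF_add_I hF, Submodule.coe_neg, smul_neg, sub_eq_add_neg]

theorem inner_conjF (hF : IsLagrangian F) (v w : V) :
    (inner ℂ (conjF F v) (conjF F w) : ℂ) = conj (inner ℂ v w : ℂ) := by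
  obtain ⟨a, b, rfl⟩ := exists_eq_add_I hF v
  obtain ⟨c, d, rfl⟩ := exists_eq_add_I hF w
  rw [conjF_add_I' hF, conjF_add_I' hF, inner_add_I hF, inner_add_I hF]
  simp only [map_add, map_mul, map_sub, Complex.conj_ofReal, Complex.conj_I, Submodule.coe_neg,
    inner_neg_left, inner_neg_right, neg_neg, Complex.neg_re, Complex.ofReal_neg]
  ring

theorem conjF_I (hF : IsLagrangian F) (v : V) :
    conjF F (Complex.I • v) = -(Complex.I • conjF F v) := by
  obtain ⟨a, b, rfl⟩ := exists_eq_add_I hF v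
  have h1 : Complex.I • ((a : V) + Complex.I • (b : V)) = ((-b : F) : V) + Complex.I • (a : V) := by
    rw [smul_add, smul_smul, Complex.I_mul_I, Submodule.coe_neg]
    module
  rw [h1, conjF_add_I hF, conjF_add_I hF, smul_sub, smul_smul, Complex.I_mul_I, Submodule.coe_neg]
  module

theorem conjF_tauFEquiv (hF : IsLagrangian F) (C : F ≃ₗ[ℝ] F) (v : V) :
    tauFEquiv hF C (conjF F v) = conjF F (tauFEquiv hF C v) := by
  obtain ⟨a, b, rfl⟩ := exists_eq_add_I hF v
  rw [conjF_add_I' hF, tauFEquiv_apply, tauFEquiv_apply, tauF_add_I hF, tauF_add_I hF,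
    conjF_add_I' hF, map_neg]

theorem conjF_smul (hF : IsLagrangian F) (r : ℂ) (v : V) :
    conjF F (r • v) = conj r • conjF F v :=
  smul_of_isAnti (T := (conjF F : V ≃L[ℝ] V).toContinuousLinearMap) (conjF_I hF) r v

/-- `τ_F(C)` preserves `F` and `jF`, hence commutes with the conjugation. So do its linear and
antilinear parts, since conjugating by an antilinear map preserves both types. -/
theorem ZL_conjF (hF : IsLagrangian F) (C : F ≃ₗ[ℝ] F) (v : V) :
    ZL (tauFEquiv hF C) (conjF F v) = conjF F (ZL (tauFEquiv hF C) v) := by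
  have hg := tauFEquiv_mem hF C
  have h1 : ∀ v, linPart (tauFEquiv hF C) (conjF F v) = conjF F (linPart (tauFEquiv hF C) v) :=
    fun v => by
      have e : Complex.I • conjF F v = -conjF F (Complex.I • v) := by rw [conjF_I hF, neg_neg]
      rw [linPart_apply, linPart_apply, conjF_smul hF, e, map_neg, conjF_tauFEquiv,
        conjF_tauFEquiv, map_sub, conjF_I hF]
      simp only [map_div₀, map_one, map_ofNat, smul_neg]
  have h2 : antiPart (tauFEquiv hF C) (conjF F v) = conjF F (antiPart (tauFEquiv hF C) v) := by
    have e : Complex.I • conjF F v = -conjF F (Complex.I • v) := by rw [conjF_I hF, neg_neg]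
    rw [antiPart, antiPart, conjF_smul hF, e, map_neg, conjF_tauFEquiv,
      conjF_tauFEquiv, map_add, conjF_I hF]
    simp only [map_div₀, map_one, map_ofNat, smul_neg]
  rw [← linPartInv_linPart hg (ZL _ (conjF F v)), linPart_ZL hg, h2, ← linPart_ZL hg, ← h1,
    linPartInv_linPart hg]

/-- The isomorphism `F × F → V`, `(a, b) ↦ a + j b`. -/
def splitF (hF : IsLagrangian F) : (F × F) ≃ₗ[ℝ] V :=
  LinearEquiv.ofBijective
    (F.subtype.comp (LinearMap.fst ℝ F F)
      + (DistribSMul.toLinearMap ℝ V Complex.I).comp (F.subtype.comp (LinearMap.snd ℝ F F)))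
    ⟨by
      rw [← LinearMap.ker_eq_bot, LinearMap.ker_eq_bot']
      rintro ⟨a, b⟩ hab
      have h0 : (a : V) + Complex.I • (b : V) = 0 := hab
      have h1 := projF_add_I hF a b
      have h2 := projF_add_I hF b (-a)
      rw [Submodule.coe_neg, ← neg_I_smul_add, h0] at h2
      rw [h0] at h1
      simp only [smul_zero, neg_zero, map_zero] at h1 h2
      rw [← h1, ← h2]
      rfl, fun v => by
      obtain ⟨a, b, rfl⟩ := exists_eq_add_I hF v
      exact ⟨(a, b), rfl⟩⟩

theorem splitF_apply (hF : IsLagrangian F) (a b : F) :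
    splitF hF (a, b) = (a : V) + Complex.I • (b : V) := rfl

theorem linPart_tauFEquiv (hF : IsLagrangian F) (C : F ≃ₗ[ℝ] F) (a : F) :
    linPart (tauFEquiv hF C) (a : V)
      = (((1 / 2 : ℝ) • ((C : F →ₗ[ℝ] F) + invTranspose C) : F →ₗ[ℝ] F) a : V) := by
  have h1 : tauF C (a : V) = (C a : V) := by
    have := tauF_add_I hF C a 0
    simpa using this
  have h2 : tauF C (Complex.I • (a : V)) = Complex.I • (invTranspose C a : V) := by
    have := tauF_add_I hF C 0 a
    simpa using this
  rw [linPart_apply, tauFEquiv_apply, tauFEquiv_apply, h1, h2, smul_smul, Complex.I_mul_I]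
  simp only [LinearMap.smul_apply, LinearMap.add_apply, Submodule.coe_smul, Submodule.coe_add,
    LinearEquiv.coe_coe]
  rw [← Complex.coe_smul]
  push_cast
  module

/-- The linear part of `τ_F(C)` acts on `F` and on `jF` by the same real operator `R`, so its real
determinant is `(det R)²`. -/
theorem norm_det_linPart_tauFEquiv (hF : IsLagrangian F) (C : F ≃ₗ[ℝ] F) :
    ‖LinearMap.det (linPart (tauFEquiv hF C))‖
      = |LinearMap.det ((1 / 2 : ℝ) • ((C : F →ₗ[ℝ] F) + invTranspose C))| := by
  set R : F →ₗ[ℝ] F := (1 / 2 : ℝ) • ((C : F →ₗ[ℝ] F) + invTranspose C) with hR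
  have h1 : (linPart (tauFEquiv hF C)).restrictScalars ℝ
      = (splitF hF : (F × F) →ₗ[ℝ] V) ∘ₗ (R.prodMap R) ∘ₗ ((splitF hF).symm : V →ₗ[ℝ] (F × F)) := by
    refine LinearMap.ext fun v => ?_
    obtain ⟨⟨a, b⟩, rfl⟩ := (splitF hF).surjective v
    rw [LinearMap.comp_apply, LinearMap.comp_apply, LinearEquiv.coe_coe, LinearEquiv.coe_coe,
      LinearEquiv.symm_apply_apply, LinearMap.prodMap_apply, splitF_apply, splitF_apply,
      LinearMap.restrictScalars_apply, map_add, map_smul, linPart_tauFEquiv, linPart_tauFEquiv]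
  have h2 := det_real_restrict (linPart (tauFEquiv hF C))
  rw [h1, LinearMap.det_conj, LinearMap.det_prodMap, ← sq] at h2
  rw [← Real.sqrt_sq (norm_nonneg (LinearMap.det (linPart (tauFEquiv hF C)))), ← h2,
    Real.sqrt_sq_eq_abs]

theorem fF_pos (C : F ≃ₗ[ℝ] F) : 0 < fF C :=
  mul_pos (Real.rpow_pos_of_pos (abs_pos.2 (LinearEquiv.isUnit_det' C).ne_zero) _) (Real.exp_pos _)

/-- Factoring `½ (C + (Cᵀ)⁻¹) = C · ½ (1 + (Cᵀ C)⁻¹)` identifies `f_F(C)` with `|det C_g|^{-1/2}`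
for `g = τ_F(C)`. -/
theorem sq_fF_mul (hF : IsLagrangian F) (C : F ≃ₗ[ℝ] F) :
    fF C ^ 2 * ‖LinearMap.det (linPart (tauFEquiv hF C))‖ = 1 := by
  have hne : LinearMap.det (linPart (tauFEquiv hF C)) ≠ 0 :=
    det_linPart_ne_zero (tauFEquiv_mem hF C)
  have h1 : ((1 / 2 : ℝ) • ((C : F →ₗ[ℝ] F) + invTranspose C)) = (C : F →ₗ[ℝ] F) ∘ₗ
      ((1 / 2 : ℝ) • (LinearMap.id + (C.symm : F →ₗ[ℝ] F) ∘ₗ invTranspose C)) := by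
    refine LinearMap.ext fun a => ?_
    simp
  have h2 := norm_det_linPart_tauFEquiv hF C
  rw [h1, LinearMap.det_comp, abs_mul] at h2
  set d := LinearMap.det ((1 / 2 : ℝ) •
    (LinearMap.id + (C.symm : F →ₗ[ℝ] F) ∘ₗ invTranspose C)) with hd
  set c := LinearMap.det (C : F →ₗ[ℝ] F) with hc
  have hc0 : 0 < |c| := abs_pos.2 (LinearEquiv.isUnit_det' C).ne_zero
  have hd0 : 0 < |d| := by
    refine lt_of_le_of_ne (abs_nonneg d) fun h0 => ?_
    rw [← h0, mul_zero] at h2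
    exact hne (norm_eq_zero.1 h2)
  have h3 : fF C = |c| ^ (-(1 / 2) : ℝ) * Real.exp (-(1 / 2) * Real.log d) := rfl
  -- The real logarithm depends on `|d|` only, so the sign of `d` need not be determined.
  have h4 : Real.exp (-(1 / 2) * Real.log d) = |d| ^ (-(1 / 2) : ℝ) := by
    rw [Real.rpow_def_of_pos hd0, Real.log_abs, mul_comm]
  have h5 : ∀ x : ℝ, 0 < x → (x ^ (-(1 / 2) : ℝ)) ^ 2 = x⁻¹ := fun x hx => by
    rw [← Real.rpow_natCast, ← Real.rpow_mul hx.le]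
    norm_num
    exact Real.rpow_neg_one x
  rw [h3, h4, h2, mul_pow, h5 _ hc0, h5 _ hd0]
  field_simp

end LagrangianSplitting

/-! ### The lift of `GL(F)` -/

section BiLagrangianLift

open ComplexConjugate

variable {V : Type*} [NormedAddCommGroup V] [InnerProductSpace ℂ V] [FiniteDimensional ℂ V]
  [MeasurableSpace V] [BorelSpace V] {h : ℝ} [hh : Fact (0 < h)]

omit [FiniteDimensional ℂ V] [MeasurableSpace V] [BorelSpace V] hh in
theorem gaussFun_conj {c : V ≃ₗᵢ[ℝ] V}
    (hc : ∀ v w, (inner ℂ (c v) (c w) : ℂ) = conj (inner ℂ v w : ℂ)) {Z : V →L[ℝ] V}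
    (hZ : ∀ v, Z (c v) = c (Z v)) (z : V) : gaussFun h Z (c z) = conj (gaussFun h Z z) := by
  rw [gaussFun, gaussFun, ← Complex.exp_conj, hZ, hc]
  simp only [map_neg, map_div₀, map_mul, Complex.conj_ofReal, map_ofNat]

omit hh in
-- The substitution `z ↦ c z` preserves the Gaussian measure and conjugates the integrand.
theorem conj_gaussInner {c : V ≃ₗᵢ[ℝ] V}
    (hc : ∀ v w, (inner ℂ (c v) (c w) : ℂ) = conj (inner ℂ v w : ℂ)) {W Z : V →L[ℝ] V}
    (hW : ∀ v, W (c v) = c (W v)) (hZ : ∀ v, Z (c v) = c (Z v)) :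
    conj (gaussInner h W Z) = gaussInner h W Z := by
  have h1 := (measurePreserving_gauss (h := h) c).integral_comp
    c.toHomeomorph.measurableEmbedding (fun z => gaussFun h Z z * conj (gaussFun h W z))
  rw [gaussInner, ← integral_conj, ← h1]
  simp only [gaussFun_conj hc hW, gaussFun_conj hc hZ, map_mul]

/-- Along `t W`, `t ∈ [0, 1]`, the inner product is real and continuous, has no zero, and starts at
1; by the intermediate value theorem it stays positive. -/
theorem gaussInner_pos {c : V ≃ₗᵢ[ℝ] V}
    (hc : ∀ v w, (inner ℂ (c v) (c w) : ℂ) = conj (inner ℂ v w : ℂ)) {W Z : V →L[ℝ] V}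
    (hW : IsSiegel W) (hZ : IsSiegel Z) (hWc : ∀ v, W (c v) = c (W v))
    (hZc : ∀ v, Z (c v) = c (Z v)) : gaussInner h W Z = ‖gaussInner h W Z‖ := by
  have hsub : ∀ t ∈ Icc (0 : ℝ) 1, ‖(t : ℂ)‖ * ‖W‖ < 1 := fun t ht => by
    rw [Complex.norm_real, Real.norm_of_nonneg ht.1]
    nlinarith [hW.norm_lt, norm_nonneg W, ht.2]
  have hreal : ∀ t : ℝ, conj (gaussInner h ((t : ℂ) • W) Z) = gaussInner h ((t : ℂ) • W) Z :=
    fun t => conj_gaussInner hc (fun v => by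
      change (t : ℂ) • W (c v) = c ((t : ℂ) • W v)
      rw [hWc, Complex.coe_smul, Complex.coe_smul, map_smul]) hZc
  have hre : ∀ t : ℝ, gaussInner h ((t : ℂ) • W) Z = ((gaussInner h ((t : ℂ) • W) Z).re : ℂ) :=
    fun t => (Complex.conj_eq_iff_re.1 (hreal t)).symm
  set f : ℝ → ℝ := fun t => (gaussInner h ((t : ℂ) • W) Z).re with hf
  have hcont : ContinuousOn f (Icc 0 1) := by
    refine Complex.continuous_re.comp_continuousOn ?_
    exact (differentiableOn_gaussInner (h := h) hW hZ).continuousOn.comp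
      Complex.continuous_ofReal.continuousOn hsub
  have hne : ∀ t ∈ Icc (0 : ℝ) 1, f t ≠ 0 := fun t ht h0 => by
    have := gaussInner_ne_zero (h := h) (hW.smul (hsub t ht)) hZ
    rw [hre] at this
    exact this (by exact_mod_cast h0)
  have h0 : f 0 = 1 := by simp [hf, gaussInner_zero_left hZ]
  have h1 : 0 < f 1 := by
    by_contra hneg
    obtain ⟨t, ht, ht0⟩ := intermediate_value_Icc' zero_le_one hcont
      (show (0 : ℝ) ∈ Icc (f 1) (f 0) from ⟨not_lt.1 hneg, by rw [h0]; exact zero_le_one⟩)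
    exact hne t ht ht0
  have h2 := hre 1
  have h3 : f 1 = (gaussInner h W Z).re := by simp [hf]
  rw [Complex.ofReal_one, one_smul, ← h3] at h2
  rw [h2, Complex.norm_real, Real.norm_of_nonneg h1.le]

/-- Both sides of the cocycle relation are nonnegative reals, so it may be checked after squaring,
where it is the product formula for `|det C_g|`. -/
theorem exists_biLagrangian_lift {F : Submodule ℝ V} (hF : IsLagrangian F) :
    ∃ T : (F ≃ₗ[ℝ] F) →* Mpc V h, ∀ C, HasParameters (T C) (tauFEquiv hF C) (fF C) := by
  have hl : ∀ C : F ≃ₗ[ℝ] F,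
      ‖((fF C : ℝ) : ℂ)‖ ^ 2 * ‖LinearMap.det (linPart (tauFEquiv hF C))‖ = 1 := fun C => by
    rw [Complex.norm_real, Real.norm_eq_abs, sq_abs, sq_fF_mul]
  refine exists_lift_hom (tauFHom hF) (fun C => ((fF C : ℝ) : ℂ)) hl fun C D => ?_
  have hinv : (tauFHom hF D : V ≃L[ℝ] V)⁻¹ = tauFEquiv hF D⁻¹ := by
    rw [← coe_tauFHom, map_inv]
    rfl
  rw [hinv, coe_tauFHom]
  have hW := isSiegel_ZL (tauFEquiv_mem hF C)
  have hZ := isSiegel_ZL (tauFEquiv_mem hF D⁻¹)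
  have h1 := gaussInner_pos (h := h) (inner_conjF hF) hW hZ (ZL_conjF hF C) (ZL_conjF hF D⁻¹)
  have h2 := sq_norm_gaussInner (h := h) hW hZ
  have h3 := det_linPart_mul (tauFEquiv_mem hF C) (tauFEquiv_mem hF D)
  have e1 : tauFEquiv hF C * tauFEquiv hF D = tauFEquiv hF (C * D) :=
    congrArg Subtype.val (map_mul (tauFHom hF) C D).symm
  rw [e1, show (tauFEquiv hF D)⁻¹ = tauFEquiv hF D⁻¹ from hinv] at h3
  replace h3 := congrArg norm h3
  rw [norm_mul, norm_mul] at h3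
  rw [h1]
  set x := ‖gaussInner h (ZL (tauFEquiv hF C)) (ZL (tauFEquiv hF D⁻¹))‖
  have h4 := sq_fF_mul hF (C * D)
  have h5 := sq_fF_mul hF C
  have h6 := sq_fF_mul hF D
  rw [h3] at h4
  have hx : 0 ≤ x := norm_nonneg _
  set s := ‖sdet (ZL (tauFEquiv hF C)) (ZL (tauFEquiv hF D⁻¹))‖
  set c := ‖LinearMap.det (linPart (tauFEquiv hF C))‖
  set d := ‖LinearMap.det (linPart (tauFEquiv hF D))‖
  have h7 : fF (C * D) ^ 2 = (fF C * fF D * x) ^ 2 := by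
    have hne : c * s * d ≠ 0 := fun h0 => by rw [h0, mul_zero] at h4; exact zero_ne_one h4
    apply mul_right_cancel₀ hne
    rw [h4]
    calc (1 : ℝ) = (fF C ^ 2 * c) * (fF D ^ 2 * d) * (x ^ 2 * s) := by rw [h5, h6, h2]; norm_num
      _ = _ := by ring
  have h8 := (sq_eq_sq₀ (fF_pos (C * D)).le
    (mul_nonneg (mul_nonneg (fF_pos C).le (fF_pos D).le) hx)).1 h7
  exact_mod_cast h8

end BiLagrangianLift

/-! ### Smoothness of continuous square roots -/

section SquareRoots

open Filter Topology

theorem exp_half_log_sq {z : ℂ} (hz : 0 < z.re) : Complex.exp (Complex.log (z ^ 2) / 2) = z := by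
  have hz0 : z ≠ 0 := fun h0 => by simp [h0] at hz
  have h1 : z ^ 2 = Complex.exp (2 * Complex.log z) := by
    rw [two_mul, Complex.exp_add, Complex.exp_log hz0, sq]
  have h2 := abs_lt.1 (Complex.abs_arg_lt_pi_div_two_iff.2 (Or.inl hz))
  have h3 : (2 * Complex.log z).im = 2 * z.arg := by simp [Complex.log_im]
  rw [h1, Complex.log_exp (by rw [h3]; linarith) (by rw [h3]; linarith),
    mul_div_cancel_left₀ _ two_ne_zero, Complex.exp_log hz0]

/-- A continuous function whose square is smooth and does not vanish is smooth. -/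
theorem contMDiffAt_of_sq {E H N : Type*} [NormedAddCommGroup E] [NormedSpace ℝ E]
    [TopologicalSpace H] {I : ModelWithCorners ℝ E H} [TopologicalSpace N] [ChartedSpace H N]
    {f : N → ℂ} {x : N} (hc : ContinuousAt f x) (h0 : f x ≠ 0)
    (hs : ContMDiffAt I 𝓘(ℝ, ℂ) ∞ (fun y => f y ^ 2) x) : ContMDiffAt I 𝓘(ℝ, ℂ) ∞ f x := by
  have hev : ∀ᶠ y in 𝓝 x, 0 < (f y / f x).re := by
    have hc' : ContinuousAt (fun y => (f y / f x).re) x :=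
      Complex.continuous_re.continuousAt.comp (hc.div_const _)
    refine hc'.eventually (lt_mem_nhds ?_)
    change 0 < (f x / f x).re
    rw [div_self h0]
    exact zero_lt_one
  -- By continuity `f y / f x` stays in the right half-plane near `x`, where the principal branch
  -- returns it from its square.
  have heq : f =ᶠ[𝓝 x] fun y => f x * Complex.exp (Complex.log (f y ^ 2 / f x ^ 2) / 2) := by
    filter_upwards [hev] with y hy
    rw [← div_pow, exp_half_log_sq hy, mul_div_cancel₀ _ h0]
  refine ContMDiffAt.congr_of_eventuallyEq ?_ heq
  have hq : ContDiffAt ℝ ∞ (fun w : ℂ => f x * Complex.exp (Complex.log (w / f x ^ 2) / 2))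
      (f x ^ 2) := by
    have hd : ContDiffAt ℂ ∞ (fun w : ℂ => w / f x ^ 2) (f x ^ 2) := contDiffAt_id.div_const _
    have hl : ContDiffAt ℂ ∞ (fun w : ℂ => Complex.log (w / f x ^ 2)) (f x ^ 2) :=
      (Complex.contDiffAt_log
        (by rw [div_self (pow_ne_zero _ h0)]; exact Complex.one_mem_slitPlane)).comp _ hd
    exact (contDiffAt_const.mul (hl.div_const 2).cexp).restrict_scalars ℝ
  exact ContDiffAt.comp_contMDiffAt (f := fun y => f y ^ 2) hq hs

theorem contMDiffAt_mul_complex {E H N : Type*} [NormedAddCommGroup E] [NormedSpace ℝ E]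
    [TopologicalSpace H] {I : ModelWithCorners ℝ E H} [TopologicalSpace N] [ChartedSpace H N]
    {f g : N → ℂ} {x : N} (hf : ContMDiffAt I 𝓘(ℝ, ℂ) ∞ f x) (hg : ContMDiffAt I 𝓘(ℝ, ℂ) ∞ g x) :
    ContMDiffAt I 𝓘(ℝ, ℂ) ∞ (fun y => f y * g y) x :=
  ContDiffAt.comp_contMDiffAt (f := fun y => (f y, g y)) (g := fun p : ℂ × ℂ => p.1 * p.2)
    (contDiff_fst.mul contDiff_snd).contDiffAt (hf.prodMk_space hg)

end SquareRoots

/-! ### Smoothness of the group operations of `Mp^c` -/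

section Smoothness

open Filter Topology ComplexConjugate

variable {V : Type*} [NormedAddCommGroup V] [InnerProductSpace ℂ V]

variable (V) in
/-- Multiplication by `i` as a real linear map. -/
def mulIL : V →L[ℝ] V := Complex.I • ContinuousLinearMap.id ℝ V

/-- The complex linear part, as a real linear map. -/
def linPartL (T : V →L[ℝ] V) : V →L[ℝ] V := (1 / 2 : ℝ) • (T - mulIL V * T * mulIL V)

/-- The antilinear part, as a real linear map. -/
def antiPartL (T : V →L[ℝ] V) : V →L[ℝ] V := (1 / 2 : ℝ) • (T + mulIL V * T * mulIL V)

theorem linPartL_apply (g : V ≃L[ℝ] V) (v : V) : linPartL (g : V →L[ℝ] V) v = linPart g v := by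
  rw [linPart_apply]
  change (1 / 2 : ℝ) • (g v - Complex.I • g (Complex.I • v)) = _
  rw [← Complex.coe_smul]
  push_cast
  rfl

theorem antiPartL_apply (g : V ≃L[ℝ] V) (v : V) : antiPartL (g : V →L[ℝ] V) v = antiPart g v := by
  change (1 / 2 : ℝ) • (g v + Complex.I • g (Complex.I • v)) = _
  rw [← Complex.coe_smul]
  push_cast
  rfl

theorem contDiff_linPartL : ContDiff ℝ ∞ (linPartL : (V →L[ℝ] V) → V →L[ℝ] V) :=
  (contDiff_id.sub ((contDiff_const.mul contDiff_id).mul contDiff_const)).const_smul _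

theorem contDiff_antiPartL : ContDiff ℝ ∞ (antiPartL : (V →L[ℝ] V) → V →L[ℝ] V) :=
  (contDiff_id.add ((contDiff_const.mul contDiff_id).mul contDiff_const)).const_smul _

variable [FiniteDimensional ℂ V]

theorem isUnit_linPartL {g : V ≃L[ℝ] V} (hg : g ∈ Sp V) : IsUnit (linPartL (g : V →L[ℝ] V)) := by
  have h1 : ∀ v, (Ring.inverse (linPart g : Module.End ℂ V)) v = linPartInv g v := fun _ => rfl
  let B : V →L[ℝ] V := LinearMap.toContinuousLinearMap ((linPartInv g).restrictScalars ℝ)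
  have hB : ∀ v, B v = linPartInv g v := fun _ => rfl
  refine ⟨⟨linPartL (g : V →L[ℝ] V), B, ?_, ?_⟩, rfl⟩
  · ext v
    change linPartL (g : V →L[ℝ] V) (B v) = v
    rw [linPartL_apply, hB, linPart_linPartInv hg]
  · ext v
    change B (linPartL (g : V →L[ℝ] V) v) = v
    rw [linPartL_apply, hB, linPartInv_linPart hg]

/-- `Z_g` as a function of the linear map `g`. -/
def ZLfun (T : V →L[ℝ] V) : V →L[ℝ] V := Ring.inverse (linPartL T) * antiPartL T

theorem ZL_eq_ZLfun {g : V ≃L[ℝ] V} (hg : g ∈ Sp V) : ZL g = ZLfun (g : V →L[ℝ] V) := by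
  have h1 : antiPartL (g : V →L[ℝ] V) = linPartL (g : V →L[ℝ] V) * ZL g := by
    ext v
    change _ = linPartL (g : V →L[ℝ] V) (ZL g v)
    rw [antiPartL_apply, linPartL_apply, linPart_ZL hg]
  rw [ZLfun, h1, Ring.inverse_mul_cancel_left _ _ (isUnit_linPartL hg)]

theorem contDiffAt_ZLfun {g : V ≃L[ℝ] V} (hg : g ∈ Sp V) :
    ContDiffAt ℝ ∞ (ZLfun : (V →L[ℝ] V) → V →L[ℝ] V) (g : V →L[ℝ] V) := by
  obtain ⟨u, hu⟩ := isUnit_linPartL hg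
  have h1 : ContDiffAt ℝ ∞ Ring.inverse (linPartL (g : V →L[ℝ] V)) := by
    rw [← hu]
    exact contDiffAt_ringInverse ℝ u
  exact (h1.comp _ contDiff_linPartL.contDiffAt).mul contDiff_antiPartL.contDiffAt

theorem contDiff_sdet : ContDiff ℝ ∞ fun p : (V →L[ℝ] V) × (V →L[ℝ] V) => sdet p.1 p.2 := by
  obtain ⟨n, b, Q, hQ, hdet⟩ := exists_det_eq V
  simp only [sdet, hdet]
  refine (hQ.restrict_scalars ℝ).comp (contDiff_pi.2 fun i => ?_)
  simp only [LinearMap.sub_apply, Module.End.one_apply, cpart_apply]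
  have h1 : ∀ v : V, ContDiff ℝ ∞ fun p : (V →L[ℝ] V) × (V →L[ℝ] V) => p.1 (p.2 v) := fun v =>
    contDiff_fst.clm_apply (contDiff_snd.clm_apply contDiff_const)
  exact contDiff_const.sub (((h1 _).sub ((h1 _).const_smul Complex.I)).const_smul (1 / 2 : ℂ))

variable [MeasurableSpace V] [BorelSpace V] {h : ℝ} [hh : Fact (0 < h)]

/-- Dominated convergence: for norms below a fixed `r < 1` all integrands are bounded by one
integrable Gaussian. -/
theorem continuousAt_gaussInner {W Z : V →L[ℝ] V} (hW : ‖W‖ < 1) (hZ : ‖Z‖ < 1) :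
    ContinuousAt (fun p : (V →L[ℝ] V) × (V →L[ℝ] V) => gaussInner h p.1 p.2) (W, Z) := by
  obtain ⟨r, hr, hr1⟩ := exists_between (max_lt hW hZ)
  have hb := hbar_pos h
  have hev : ∀ᶠ p : (V →L[ℝ] V) × (V →L[ℝ] V) in 𝓝 (W, Z), ‖p.1‖ < r ∧ ‖p.2‖ < r := by
    have h1 : ContinuousAt (fun p : (V →L[ℝ] V) × (V →L[ℝ] V) => ‖p.1‖) (W, Z) := by fun_prop
    have h2 : ContinuousAt (fun p : (V →L[ℝ] V) × (V →L[ℝ] V) => ‖p.2‖) (W, Z) := by fun_prop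
    exact (h1.eventually_lt_const ((le_max_left _ _).trans_lt hr)).and
      (h2.eventually_lt_const ((le_max_right _ _).trans_lt hr))
  have hcont : ∀ T : V →L[ℝ] V, Continuous (gaussFun h T) := fun T => by
    unfold gaussFun
    exact Complex.continuous_exp.comp (by fun_prop)
  have hcontT : ∀ z : V, Continuous fun T : V →L[ℝ] V => gaussFun h T z := fun z => by
    unfold gaussFun
    have : Continuous fun T : V →L[ℝ] V => (inner ℂ (T z) z : ℂ) :=
      Continuous.inner (by fun_prop) continuous_const
    exact Complex.continuous_exp.comp ((this.div_const _).neg)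
  refine continuousAt_of_dominated (bound := fun z => Real.exp (r * (‖z‖ ^ 2 / (2 * hbar h))))
    (Eventually.of_forall fun p => ?_) (hev.mono fun p hp => Eventually.of_forall fun z => ?_) ?_
    (Eventually.of_forall fun z => ?_)
  · exact ((hcont _).mul (Complex.continuous_conj.comp (hcont _))).aestronglyMeasurable
  · have key : ∀ T : V →L[ℝ] V, ‖T‖ < r →
        ‖gaussFun h T z‖ ^ 2 ≤ Real.exp (r * (‖z‖ ^ 2 / (2 * hbar h))) := fun T hT => by
      have h1 := norm_gaussFun_sq_le (h := h) T z hT.le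
      rw [← le_div_iff₀ (Real.exp_pos _), ← Real.exp_sub] at h1
      refine h1.trans (le_of_eq ?_)
      congr 1
      ring
    have h1 := key _ hp.1
    have h2 := key _ hp.2
    rw [norm_mul, RCLike.norm_conj]
    nlinarith [sq_nonneg (‖gaussFun h p.1 z‖ - ‖gaussFun h p.2 z‖)]
  · rw [integrable_gauss_iff]
    have : 0 < (1 - r) / (2 * hbar h) := div_pos (by linarith) (by positivity)
    refine (integrable_gaussian_lebesgue (V := V) this).congr (Eventually.of_forall fun z => ?_)
    simp only [smul_eq_mul]
    rw [← Real.exp_add]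
    congr 1
    ring
  · exact (((hcontT z).comp continuous_snd).mul
      (Complex.continuous_conj.comp ((hcontT z).comp continuous_fst))).continuousAt

section Pointwise

variable {E H N : Type*} [NormedAddCommGroup E] [NormedSpace ℝ E] [TopologicalSpace H]
  {I : ModelWithCorners ℝ E H} [TopologicalSpace N] [ChartedSpace H N]

omit [FiniteDimensional ℂ V] [MeasurableSpace V] [BorelSpace V] in
theorem contMDiffAt_clm_of_apply [FiniteDimensional ℝ V] {f : N → V →L[ℝ] V} {x : N}
    (hf : ∀ v, ContMDiffAt I 𝓘(ℝ, V) ∞ (fun y => f y v) x) :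
    ContMDiffAt I 𝓘(ℝ, V →L[ℝ] V) ∞ f x := by
  let b := Module.finBasis ℝ V
  have h1 : f = fun y => ∑ i, ContinuousLinearMap.smulRightL ℝ V V
      (LinearMap.toContinuousLinearMap (b.coord i)) (f y (b i)) := by
    funext y
    ext v
    conv_lhs => rw [← b.sum_repr v]
    rw [map_sum, sum_apply]
    simp only [map_smul]
    rfl
  rw [h1]
  refine ContMDiffAt.sum fun i _ => ?_
  exact ContDiffAt.comp_contMDiffAt (ContinuousLinearMap.contDiff _).contDiffAt (hf (b i))

/-- Its square is the inverse of a polynomial determinant, hence smooth and nonzero; continuity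
selects the branch of the root. -/
theorem contMDiffAt_gaussInner {W Z : N → V →L[ℝ] V} {x : N}
    (hW : ContMDiffAt I 𝓘(ℝ, V →L[ℝ] V) ∞ W x) (hZ : ContMDiffAt I 𝓘(ℝ, V →L[ℝ] V) ∞ Z x)
    (hWs : ∀ y, IsSiegel (W y)) (hZs : ∀ y, IsSiegel (Z y)) :
    ContMDiffAt I 𝓘(ℝ, ℂ) ∞ (fun y => gaussInner h (W y) (Z y)) x := by
  have hp := hW.prodMk_space hZ
  refine contMDiffAt_of_sq ?_ (gaussInner_ne_zero (hWs x) (hZs x)) ?_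
  · exact ContinuousAt.comp (f := fun y => (W y, Z y))
      (continuousAt_gaussInner (hWs x).norm_lt (hZs x).norm_lt) hp.continuousAt
  · have h1 : (fun y => gaussInner h (W y) (Z y) ^ 2) = fun y => (sdet (W y) (Z y))⁻¹ := by
      funext y
      exact eq_inv_of_mul_eq_one_left (sq_gaussInner_mul_sdet (hWs y) (hZs y))
    have h0 : sdet (W x) (Z x) ≠ 0 := fun h0 => by
      have := sq_gaussInner_mul_sdet (h := h) (hWs x) (hZs x)
      simp [h0] at this
    rw [h1]
    exact ContDiffAt.comp_contMDiffAt (f := fun y => (W y, Z y))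
      (g := fun p : (V →L[ℝ] V) × (V →L[ℝ] V) => (sdet p.1 p.2)⁻¹)
      (contDiff_sdet.contDiffAt.inv h0) hp

/-- Smoothness at a point of a map to `Mp^c`. -/
def MpcSmoothAt (I : ModelWithCorners ℝ E H) (a : N → Mpc V h) (x : N) : Prop :=
  (∀ v : V, ContMDiffAt I 𝓘(ℝ, V) ∞ (fun x => (sig (a x) : V ≃L[ℝ] V) v) x) ∧
    ContMDiffAt I 𝓘(ℝ, ℂ) ∞ (fun x => param (a x)) x

theorem mpcSmoothOn_iff {a : N → Mpc V h} {O : Set N} (hO : IsOpen O) :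
    MpcSmoothOn I a O ↔ ∀ x ∈ O, MpcSmoothAt I a x := by
  constructor
  · rintro ⟨h1, h2⟩ x hx
    exact ⟨fun v => (h1 v).contMDiffAt (hO.mem_nhds hx), h2.contMDiffAt (hO.mem_nhds hx)⟩
  · intro h1
    exact ⟨fun v x hx => ((h1 x hx).1 v).contMDiffWithinAt, fun x hx => (h1 x hx).2.contMDiffWithinAt⟩

theorem MpcSmoothAt.congr {a b : N → Mpc V h} {x : N} (ha : MpcSmoothAt I a x)
    (hab : ∀ᶠ y in 𝓝 x, b y = a y) : MpcSmoothAt I b x :=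
  ⟨fun v => (ha.1 v).congr_of_eventuallyEq (hab.mono fun y hy => by simp only [hy]),
    ha.2.congr_of_eventuallyEq (hab.mono fun y hy => by simp only [hy])⟩

theorem mpcSmoothAt_const (A : Mpc V h) (x : N) : MpcSmoothAt I (fun _ => A) x :=
  ⟨fun _ => contMDiffAt_const, contMDiffAt_const⟩

theorem MpcSmoothAt.comp {E' H' N' : Type*} [NormedAddCommGroup E'] [NormedSpace ℝ E']
    [TopologicalSpace H'] {I' : ModelWithCorners ℝ E' H'} [TopologicalSpace N'] [ChartedSpace H' N']
    {a : N → Mpc V h} {f : N' → N} {x : N'} (ha : MpcSmoothAt I a (f x))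
    (hf : ContMDiffAt I' I ∞ f x) : MpcSmoothAt I' (fun y => a (f y)) x :=
  ⟨fun v => (ha.1 v).comp x hf, ha.2.comp x hf⟩

theorem MpcSmoothAt.sig_clm {a : N → Mpc V h} {x : N} (ha : MpcSmoothAt I a x) :
    ContMDiffAt I 𝓘(ℝ, V →L[ℝ] V) ∞ (fun y => ((sig (a y) : V ≃L[ℝ] V) : V →L[ℝ] V)) x :=
  contMDiffAt_clm_of_apply ha.1

theorem MpcSmoothAt.sig_inv_clm {a : N → Mpc V h} {x : N} (ha : MpcSmoothAt I a x) :
    ContMDiffAt I 𝓘(ℝ, V →L[ℝ] V) ∞ (fun y => (((sig (a y) : V ≃L[ℝ] V)⁻¹ : V ≃L[ℝ] V) : V →L[ℝ] V)) x := by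
  have : CompleteSpace V := FiniteDimensional.complete ℂ V
  have h1 : (fun y => (((sig (a y) : V ≃L[ℝ] V)⁻¹ : V ≃L[ℝ] V) : V →L[ℝ] V))
      = fun y => ContinuousLinearMap.inverse ((sig (a y) : V ≃L[ℝ] V) : V →L[ℝ] V) := by
    funext y
    rw [ContinuousLinearMap.inverse_equiv]
    rfl
  rw [h1]
  exact ContDiffAt.comp_contMDiffAt
    (f := fun y => ((sig (a y) : V ≃L[ℝ] V) : V →L[ℝ] V)) (contDiffAt_map_inverse (sig (a x) : V ≃L[ℝ] V)) ha.sig_clm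

theorem MpcSmoothAt.inv {a : N → Mpc V h} {x : N} (ha : MpcSmoothAt I a x) :
    MpcSmoothAt I (fun y => (a y)⁻¹) x := by
  refine ⟨fun v => ?_, ?_⟩
  · simp only [map_inv, Subgroup.coe_inv]
    exact ha.sig_inv_clm.clm_apply contMDiffAt_const
  · simp only [param_inv]
    exact ContDiffAt.comp_contMDiffAt Complex.conjCLE.contDiff.contDiffAt ha.2

/-- The parameter of a product contains the Gaussian inner product of `Z_{σ(a)}` and `Z_{σ(b)⁻¹}`,
which depend smoothly on the symplectic parts. -/
theorem MpcSmoothAt.mul {a b : N → Mpc V h} {x : N} (ha : MpcSmoothAt I a x)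
    (hb : MpcSmoothAt I b x) : MpcSmoothAt I (fun y => a y * b y) x := by
  refine ⟨fun v => ?_, ?_⟩
  · simp only [map_mul, Subgroup.coe_mul]
    exact ha.sig_clm.clm_apply (hb.1 v)
  · simp only [param_mul]
    have hs : ∀ y, (sig (a y) : V ≃L[ℝ] V) ∈ Sp V := fun y => (sig (a y)).2
    have hs' : ∀ y, (sig (b y) : V ≃L[ℝ] V)⁻¹ ∈ Sp V := fun y => (Sp V).inv_mem (sig (b y)).2
    have hW : ContMDiffAt I 𝓘(ℝ, V →L[ℝ] V) ∞ (fun y => ZL (sig (a y) : V ≃L[ℝ] V)) x := by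
      simp only [fun y => ZL_eq_ZLfun (hs y)]
      exact ContDiffAt.comp_contMDiffAt
        (f := fun y => ((sig (a y) : V ≃L[ℝ] V) : V →L[ℝ] V)) (contDiffAt_ZLfun (hs x)) ha.sig_clm
    have hZ : ContMDiffAt I 𝓘(ℝ, V →L[ℝ] V) ∞ (fun y => ZL (sig (b y) : V ≃L[ℝ] V)⁻¹) x := by
      simp only [fun y => ZL_eq_ZLfun (hs' y)]
      exact ContDiffAt.comp_contMDiffAt (f := fun y =>
        (((sig (b y) : V ≃L[ℝ] V)⁻¹ : V ≃L[ℝ] V) : V →L[ℝ] V)) (contDiffAt_ZLfun (hs' x))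
        hb.sig_inv_clm
    exact contMDiffAt_mul_complex (contMDiffAt_mul_complex ha.2 hb.2)
      (contMDiffAt_gaussInner hW hZ (fun y => isSiegel_ZL (hs y)) fun y => isSiegel_ZL (hs' y))

end Pointwise

end Smoothness

/-! ### Sections of submersions, and small images of maps of deficient rank -/

section EuclideanSubmersions

open Filter Topology

variable {X Y : Type*} [NormedAddCommGroup X] [NormedSpace ℝ X] [FiniteDimensional ℝ X]
  [NormedAddCommGroup Y] [NormedSpace ℝ Y] [FiniteDimensional ℝ Y]

omit [FiniteDimensional ℝ X] in
/-- A submersion has smooth local sections. -/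
theorem exists_section_of_surjective {f : X → Y} {U : Set X} (hU : IsOpen U) {x₀ : X}
    (hx₀ : x₀ ∈ U) (hf : ContDiffOn ℝ ∞ f U) (hsurj : (fderiv ℝ f x₀ : X →ₗ[ℝ] Y).range = ⊤) :
    ∃ W : Set Y, IsOpen W ∧ f x₀ ∈ W ∧ ∃ s : Y → X, ContDiffOn ℝ ∞ s W ∧
      s (f x₀) = x₀ ∧ ∀ y ∈ W, s y ∈ U ∧ f (s y) = y := by
  have : CompleteSpace Y := FiniteDimensional.complete ℝ Y
  obtain ⟨T₀, hT₀⟩ := LinearMap.exists_rightInverse_of_surjective (fderiv ℝ f x₀ : X →ₗ[ℝ] Y) hsurj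
  set T : Y →L[ℝ] X := LinearMap.toContinuousLinearMap T₀
  -- On the affine slice given by a right inverse `T` of the derivative, `f` has derivative the
  -- identity, so the inverse function theorem applies to `F = f ∘ k`.
  set k : Y → X := fun y => x₀ + T y with hk
  have hk0 : k 0 = x₀ := by simp [hk]
  have hkd : ContDiff ℝ ∞ k := contDiff_const.add T.contDiff
  set F : Y → Y := fun y => f (k y) with hF
  have hU' : IsOpen (k ⁻¹' U) := hU.preimage hkd.continuous
  have h0U : (0 : Y) ∈ k ⁻¹' U := by
    change k 0 ∈ U
    rwa [hk0]
  have hFd : ContDiffOn ℝ ∞ F (k ⁻¹' U) := hf.comp hkd.contDiffOn fun y hy => hy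
  have hFa : ∀ y ∈ k ⁻¹' U, ContDiffAt ℝ ∞ F y := fun y hy => hFd.contDiffAt (hU'.mem_nhds hy)
  have hder : HasFDerivAt F ((ContinuousLinearEquiv.refl ℝ Y : Y ≃L[ℝ] Y) : Y →L[ℝ] Y) 0 := by
    have h1 : HasFDerivAt f (fderiv ℝ f x₀) (k 0) := by
      rw [hk0]
      exact ((hf.contDiffAt (hU.mem_nhds hx₀)).differentiableAt (by simp)).hasFDerivAt
    have h2 : HasFDerivAt k T 0 := T.hasFDerivAt.const_add x₀
    have h3 := h1.comp 0 h2
    have h4 : (fderiv ℝ f x₀).comp T = ((ContinuousLinearEquiv.refl ℝ Y : Y ≃L[ℝ] Y) : Y →L[ℝ] Y) := by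
      ext y
      exact LinearMap.congr_fun hT₀ y
    rw [h4] at h3
    exact h3
  have hn : (∞ : WithTop ℕ∞) ≠ 0 := by simp
  set e := (hFa 0 h0U).toOpenPartialHomeomorph F hder hn with he
  have hecoe : (e : Y → Y) = F := (hFa 0 h0U).toOpenPartialHomeomorph_coe hder hn
  have h0e : (0 : Y) ∈ e.source := (hFa 0 h0U).mem_toOpenPartialHomeomorph_source hder hn
  -- The derivative stays invertible nearby, so the local inverse is smooth on a whole neighbourhood
  -- and not only at one point.
  have hgood : {y | y ∈ k ⁻¹' U ∧ fderiv ℝ F y ∈ range ((↑) : (Y ≃L[ℝ] Y) → Y →L[ℝ] Y)} ∈ 𝓝 (0 : Y) := by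
    change (k ⁻¹' U) ∩ {y | fderiv ℝ F y ∈ range ((↑) : (Y ≃L[ℝ] Y) → Y →L[ℝ] Y)} ∈ 𝓝 (0 : Y)
    refine inter_mem (hU'.mem_nhds h0U) ?_
    have hc : ContinuousAt (fderiv ℝ F) 0 :=
      (hFd.continuousOn_fderiv_of_isOpen hU' (by simp)).continuousAt (hU'.mem_nhds h0U)
    refine hc.preimage_mem_nhds ?_
    rw [hder.fderiv]
    exact ContinuousLinearEquiv.nhds _
  obtain ⟨O, hO, hOo, h0O⟩ := mem_nhds_iff.1 hgood
  have hF0 : F 0 = f x₀ := by rw [hF]; simp only [hk0]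
  have hsymm0 : e.symm (f x₀) = 0 := by
    rw [← hF0, ← hecoe]
    exact e.left_inv h0e
  refine ⟨e.target ∩ e.symm ⁻¹' O, e.isOpen_inter_preimage_symm hOo, ⟨?_, ?_⟩,
    fun y => k (e.symm y), ?_, ?_, fun y hy => ⟨(hO hy.2).1, ?_⟩⟩
  · rw [← hF0, ← hecoe]
    exact e.map_source h0e
  · change e.symm (f x₀) ∈ O
    rwa [hsymm0]
  · intro y hy
    obtain ⟨hyU, e', he'⟩ := hO hy.2
    have h1 : HasFDerivAt e (e' : Y →L[ℝ] Y) (e.symm y) := by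
      rw [hecoe, he']
      exact ((hFa _ hyU).differentiableAt (by simp)).hasFDerivAt
    have h2 := e.contDiffAt_symm (n := ∞) hy.1 h1 (by rw [hecoe]; exact hFa _ hyU)
    exact (hkd.contDiffAt.comp y h2).contDiffWithinAt
  · simp only [hsymm0, hk0]
  · have h1 := e.right_inv hy.1
    rw [hecoe] at h1
    exact h1

/-- If the rank of the derivative is maximal at a point, and is not the dimension of the target, then
the image of a neighbourhood is small. -/
theorem exists_nhds_dimH_image_lt {f : X → Y} {U : Set X} (hU : IsOpen U) {x₀ : X}
    (hx₀ : x₀ ∈ U) (hf : ContDiffOn ℝ ∞ f U)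
    (hrank : ∀ x ∈ U, Module.finrank ℝ (fderiv ℝ f x : X →ₗ[ℝ] Y).range
      ≤ Module.finrank ℝ (fderiv ℝ f x₀ : X →ₗ[ℝ] Y).range)
    (hlt : Module.finrank ℝ (fderiv ℝ f x₀ : X →ₗ[ℝ] Y).range < Module.finrank ℝ Y) :
    ∃ N ∈ 𝓝 x₀, dimH (f '' N) < Module.finrank ℝ Y := by
  have : CompleteSpace X := FiniteDimensional.complete ℝ X
  have hfa : ∀ x ∈ U, ContDiffAt ℝ ∞ f x := fun x hx => hf.contDiffAt (hU.mem_nhds hx)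
  have hfd : ∀ x ∈ U, HasFDerivAt f (fderiv ℝ f x) x := fun x hx =>
    ((hfa x hx).differentiableAt (by simp)).hasFDerivAt
  set L : X →ₗ[ℝ] Y := (fderiv ℝ f x₀ : X →ₗ[ℝ] Y) with hL
  set R : Submodule ℝ Y := L.range with hR
  set K : Submodule ℝ X := L.ker with hK
  obtain ⟨P₀, hP₀⟩ := LinearMap.exists_leftInverse_of_injective R.subtype R.ker_subtype
  obtain ⟨Q₀, hQ₀⟩ := LinearMap.exists_leftInverse_of_injective K.subtype K.ker_subtype
  set P : Y →L[ℝ] R := LinearMap.toContinuousLinearMap P₀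
  set Q : X →L[ℝ] K := LinearMap.toContinuousLinearMap Q₀
  have hP : ∀ r : R, P r = r := fun r => LinearMap.congr_fun hP₀ r
  have hQ : ∀ r : K, Q r = r := fun r => LinearMap.congr_fun hQ₀ r
  -- A chart as in the constant rank theorem: the first coordinate is the projection of `f` to the
  -- image of its derivative at `x₀`.
  set Φ : X → R × K := fun x => (P (f x), Q x) with hΦ
  set Φ' : X →L[ℝ] R × K := (P.comp (fderiv ℝ f x₀)).prod Q with hΦ'
  have hinj : Function.Injective (Φ' : X →ₗ[ℝ] R × K) := by
    rw [← LinearMap.ker_eq_bot, LinearMap.ker_eq_bot']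
    intro x hx
    have h1 : P (L x) = 0 := congrArg Prod.fst hx
    have h2 : Q x = 0 := congrArg Prod.snd hx
    have h3 : (⟨L x, LinearMap.mem_range_self L x⟩ : R) = 0 := by
      rw [← hP ⟨L x, LinearMap.mem_range_self L x⟩]
      exact h1
    have h4 : x ∈ K := congrArg Subtype.val h3
    have h5 := hQ ⟨x, h4⟩
    rw [h2] at h5
    exact congrArg Subtype.val h5.symm
  have hdim : Module.finrank ℝ X = Module.finrank ℝ (R × K) := by
    rw [Module.finrank_prod]
    exact L.finrank_range_add_finrank_ker.symm
  let E' : X ≃L[ℝ] R × K :=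
    ((Φ' : X →ₗ[ℝ] R × K).linearEquivOfInjective hinj hdim).toContinuousLinearEquiv
  have hE' : (E' : X →L[ℝ] R × K) = Φ' := by
    ext x : 1
    rfl
  have hΦa : ∀ x ∈ U, ContDiffAt ℝ ∞ Φ x := fun x hx =>
    (P.contDiff.contDiffAt.comp x (hfa x hx)).prodMk Q.contDiff.contDiffAt
  have hΦd : HasFDerivAt Φ (E' : X →L[ℝ] R × K) x₀ := by
    rw [hE']
    exact (P.hasFDerivAt.comp x₀ (hfd x₀ hx₀)).prodMk Q.hasFDerivAt
  have hn : (∞ : WithTop ℕ∞) ≠ 0 := by simp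
  set e := (hΦa x₀ hx₀).toOpenPartialHomeomorph Φ hΦd hn with he
  have hecoe : (e : X → R × K) = Φ := (hΦa x₀ hx₀).toOpenPartialHomeomorph_coe hΦd hn
  have h0e : x₀ ∈ e.source := (hΦa x₀ hx₀).mem_toOpenPartialHomeomorph_source hΦd hn
  set ψ : R × K → X := ⇑e.symm with hψ
  have hψ0 : ψ (Φ x₀) = x₀ := by
    rw [hψ, ← hecoe]
    exact e.left_inv h0e
  have htgt : Φ x₀ ∈ e.target := by
    rw [← hecoe]
    exact e.map_source h0e
  -- Order 1 suffices, and unlike order `∞` it passes from a point to a neighbourhood.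
  have hψa : ContDiffAt ℝ 1 ψ (Φ x₀) := by
    refine e.contDiffAt_symm htgt (f₀' := E') ?_ ?_
    · rw [hecoe]
      change HasFDerivAt Φ _ (ψ (Φ x₀))
      rwa [hψ0]
    · rw [hecoe]
      change ContDiffAt ℝ 1 Φ (ψ (Φ x₀))
      rw [hψ0]
      exact (hΦa x₀ hx₀).of_le (by simp)
  have hev : ∀ᶠ w in 𝓝 (Φ x₀), w ∈ e.target ∧ ContDiffAt ℝ 1 ψ w ∧ ψ w ∈ U := by
    refine (e.open_target.eventually_mem htgt).and ((hψa.eventually (by simp)).and ?_)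
    refine hψa.continuousAt.preimage_mem_nhds ?_
    rw [hψ0]
    exact hU.mem_nhds hx₀
  obtain ⟨ε, hε, hball⟩ := Metric.eventually_nhds_iff_ball.1 hev
  set u₀ := (Φ x₀).1
  set k₀ := (Φ x₀).2
  set F : R × K → Y := fun w => f (ψ w) with hF
  have hFa : ∀ w ∈ Metric.ball (Φ x₀) ε, ContDiffAt ℝ 1 F w := fun w hw =>
    ((hfa _ (hball w hw).2.2).of_le (by simp)).comp w (hball w hw).2.1
  have hFd : ∀ w ∈ Metric.ball (Φ x₀) ε, HasFDerivAt F (fderiv ℝ F w) w := fun w hw =>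
    ((hFa w hw).differentiableAt (by simp)).hasFDerivAt
  have hPF : ∀ w ∈ Metric.ball (Φ x₀) ε, P (F w) = w.1 := fun w hw => by
    have h1 : Φ (ψ w) = w := by
      rw [← hecoe]
      exact e.right_inv (hball w hw).1
    exact congrArg Prod.fst h1
  have hPF' : ∀ w ∈ Metric.ball (Φ x₀) ε, ∀ t, P (fderiv ℝ F w t) = t.1 := fun w hw t => by
    have h1 : HasFDerivAt (fun w => P (F w)) (P.comp (fderiv ℝ F w)) w :=
      P.hasFDerivAt.comp w (hFd w hw)
    have h2 : HasFDerivAt (fun w : R × K => P (F w)) (ContinuousLinearMap.fst ℝ R K) w :=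
      (ContinuousLinearMap.fst ℝ R K).hasFDerivAt.congr_of_eventuallyEq (by
        filter_upwards [Metric.isOpen_ball.mem_nhds hw] with v hv using hPF v hv)
    exact congrArg (fun A : R × K →L[ℝ] R => A t) (h1.unique h2)
  -- `P` maps the image of the derivative of `f` at `ψ w` onto `R`; as the rank there is at most
  -- `dim R`, it is injective on that image. Vectors `(0, k)` go to 0 under `P ∘ dF`, hence already
  -- under `dF`.
  have hzero : ∀ w ∈ Metric.ball (Φ x₀) ε, ∀ k : K, fderiv ℝ F w (0, k) = 0 := by
    intro w hw k
    have hU' := (hball w hw).2.2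
    have h1 : fderiv ℝ F w = (fderiv ℝ f (ψ w)).comp (fderiv ℝ ψ w) :=
      (hFd w hw).unique ((hfd _ hU').comp w
        ((hball w hw).2.1.differentiableAt (by simp)).hasFDerivAt)
    set S : Submodule ℝ Y := (fderiv ℝ f (ψ w) : X →ₗ[ℝ] Y).range
    have hmem : ∀ t, fderiv ℝ F w t ∈ S := fun t => by
      rw [h1]
      exact LinearMap.mem_range_self _ _
    set PS : S →ₗ[ℝ] R := (P : Y →ₗ[ℝ] R).comp S.subtype
    have hs : Function.Surjective PS := fun r =>
      ⟨⟨fderiv ℝ F w (r, 0), hmem _⟩, hPF' w hw (r, 0)⟩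
    have hd : Module.finrank ℝ S = Module.finrank ℝ R :=
      le_antisymm (hrank _ hU') (PS.finrank_le_finrank_of_surjective hs)
    have hi := (LinearMap.injective_iff_surjective_of_finrank_eq_finrank hd).2 hs
    have h2 : (⟨fderiv ℝ F w (0, k), hmem _⟩ : S) = 0 := hi (by
      rw [map_zero]
      exact hPF' w hw (0, k))
    exact congrArg Subtype.val h2
  have hballmem : ∀ w : R × K, w ∈ Metric.ball (Φ x₀) ε ↔
      w.1 ∈ Metric.ball u₀ ε ∧ w.2 ∈ Metric.ball k₀ ε := fun w => by
    rw [← ball_prod_same]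
    rfl
  have hconst : ∀ w ∈ Metric.ball (Φ x₀) ε, F w = F (w.1, k₀) := by
    intro w hw
    obtain ⟨hw1, hw2⟩ := (hballmem w).1 hw
    have h1 : ∀ t ∈ Metric.ball k₀ ε,
        HasFDerivWithinAt (fun t : K => F (w.1, t)) (0 : K →L[ℝ] Y) (Metric.ball k₀ ε) t := by
      intro t ht
      have hm : (w.1, t) ∈ Metric.ball (Φ x₀) ε := (hballmem _).2 ⟨hw1, ht⟩
      have h2 : HasFDerivAt (fun t : K => (w.1, t)) (ContinuousLinearMap.inr ℝ R K) t :=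
        hasFDerivAt_prodMk_right w.1 t
      have h3 := (hFd _ hm).comp t h2
      have h4 : (fderiv ℝ F (w.1, t)).comp (ContinuousLinearMap.inr ℝ R K) = 0 := by
        ext k
        exact hzero _ hm k
      rw [h4] at h3
      exact h3.hasFDerivWithinAt
    have h5 := (convex_ball k₀ ε).norm_image_sub_le_of_norm_hasFDerivWithin_le (C := 0) h1
      (fun t _ => by simp) (Metric.mem_ball_self hε) hw2
    rw [zero_mul, norm_le_zero_iff, sub_eq_zero] at h5
    exact h5
  have hN : {x | x ∈ e.source ∧ Φ x ∈ Metric.ball (Φ x₀) ε} ∈ 𝓝 x₀ :=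
    inter_mem (e.open_source.mem_nhds h0e)
      ((hΦa x₀ hx₀).continuousAt.preimage_mem_nhds (Metric.ball_mem_nhds _ hε))
  refine ⟨_, hN, ?_⟩
  have hsub : f '' {x | x ∈ e.source ∧ Φ x ∈ Metric.ball (Φ x₀) ε}
      ⊆ (fun u : R => F (u, k₀)) '' Metric.ball u₀ ε := by
    rintro _ ⟨x, ⟨hxs, hxb⟩, rfl⟩
    refine ⟨(Φ x).1, ((hballmem _).1 hxb).1, ?_⟩
    change F ((Φ x).1, k₀) = f x
    rw [← hconst _ hxb, hF]
    change f (ψ (Φ x)) = f x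
    have : ψ (Φ x) = x := by
      rw [hψ, ← hecoe]
      exact e.left_inv hxs
    rw [this]
  have hC1 : ContDiffOn ℝ 1 (fun u : R => F (u, k₀)) (Metric.ball u₀ ε) := fun u hu => by
    have hm : (u, k₀) ∈ Metric.ball (Φ x₀) ε := (hballmem _).2 ⟨hu, Metric.mem_ball_self hε⟩
    exact ((hFa _ hm).comp u (contDiffAt_id.prodMk contDiffAt_const)).contDiffWithinAt
  -- In these coordinates `F` does not depend on `K`, so the image of the neighbourhood is a `C¹`
  -- image of part of `R`.
  calc dimH _ ≤ dimH ((fun u : R => F (u, k₀)) '' Metric.ball u₀ ε) := dimH_mono hsub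
    _ ≤ dimH (Metric.ball u₀ ε) := hC1.dimH_image_le (convex_ball _ _) Subset.rfl
    _ ≤ dimH (univ : Set R) := dimH_mono (subset_univ _)
    _ = Module.finrank ℝ R := Real.dimH_univ_eq_finrank R
    _ < Module.finrank ℝ Y := by exact_mod_cast hlt

end EuclideanSubmersions

/-! ### The orbit map is a submersion -/

section OrbitMap

open Filter Topology

variable {E : Type*} [NormedAddCommGroup E] [NormedSpace ℝ E] [FiniteDimensional ℝ E]
  {M : Type*} [TopologicalSpace M] [T2Space M] [ChartedSpace E M] [IsManifold 𝓘(ℝ, E) ∞ M]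
  {EG : Type*} [NormedAddCommGroup EG] [NormedSpace ℝ EG] [FiniteDimensional ℝ EG]
  {G : Type*} [Group G] [TopologicalSpace G] [T2Space G] [SecondCountableTopology G]
  [ChartedSpace EG G] [LieGroup 𝓘(ℝ, EG) ∞ G]
  [MulAction G M] [ContMDiffSMul 𝓘(ℝ, EG) 𝓘(ℝ, E) ∞ G M] [MulAction.IsPretransitive G M]

omit [FiniteDimensional ℝ E] [T2Space M] [IsManifold 𝓘(ℝ, E) ∞ M] [FiniteDimensional ℝ EG]
  [T2Space G] [SecondCountableTopology G] [LieGroup 𝓘(ℝ, EG) ∞ G] [MulAction.IsPretransitive G M] in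
variable (E EG G M) in
theorem contMDiff_smul_pair :
    ContMDiff (𝓘(ℝ, EG).prod 𝓘(ℝ, E)) 𝓘(ℝ, E) ∞ (fun p : G × M => p.1 • p.2) :=
  ContMDiffSMul.contMDiff_smul

omit [FiniteDimensional ℝ E] [T2Space M] [IsManifold 𝓘(ℝ, E) ∞ M] [FiniteDimensional ℝ EG]
  [T2Space G] [SecondCountableTopology G] [LieGroup 𝓘(ℝ, EG) ∞ G] [MulAction.IsPretransitive G M] in
variable (E EG) in
theorem contMDiff_orbit (p : M) : ContMDiff 𝓘(ℝ, EG) 𝓘(ℝ, E) ∞ (fun g : G => g • p) :=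
  (contMDiff_smul_pair E M EG G).comp (contMDiff_id.prodMk contMDiff_const)

omit [FiniteDimensional ℝ E] [T2Space M] [IsManifold 𝓘(ℝ, E) ∞ M] [FiniteDimensional ℝ EG]
  [T2Space G] [SecondCountableTopology G] [LieGroup 𝓘(ℝ, EG) ∞ G] [MulAction.IsPretransitive G M] in
variable (E EG) in
include EG in
theorem contMDiff_translate (g : G) : ContMDiff 𝓘(ℝ, E) 𝓘(ℝ, E) ∞ (fun p : M => g • p) :=
  (contMDiff_smul_pair E M EG G).comp (contMDiff_const.prodMk contMDiff_id)

omit [IsManifold 𝓘(ℝ, E) ∞ M] [T2Space G] in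
variable (E EG) in
include E EG in
/-- The orbit map is open. -/
theorem isOpenMap_orbit (p : M) : IsOpenMap (fun g : G => g • p) := by
  have : IsTopologicalGroup G := topologicalGroup_of_lieGroup 𝓘(ℝ, EG) ∞
  have : LocallyCompactSpace G := ChartedSpace.locallyCompactSpace EG G
  have : LocallyCompactSpace M := ChartedSpace.locallyCompactSpace E M
  have : ContinuousSMul G M := ⟨(contMDiff_smul_pair E M EG G).continuous⟩
  exact isOpenMap_smul_of_sigmaCompact p

variable (E EG G) in
/-- The orbit map in charts. -/
def orbitChart (p : M) (x : EG) : E :=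
  extChartAt 𝓘(ℝ, E) p ((extChartAt 𝓘(ℝ, EG) (1 : G)).symm x • p)

variable (E EG G) in
/-- The domain of the orbit map in charts. -/
def orbitDomain (p : M) : Set EG :=
  (extChartAt 𝓘(ℝ, EG) (1 : G)).target ∩
    (extChartAt 𝓘(ℝ, EG) (1 : G)).symm ⁻¹' {g | g • p ∈ (extChartAt 𝓘(ℝ, E) p).source}

omit [FiniteDimensional ℝ E] [T2Space M] [IsManifold 𝓘(ℝ, E) ∞ M] [FiniteDimensional ℝ EG]
  [T2Space G] [SecondCountableTopology G] [LieGroup 𝓘(ℝ, EG) ∞ G] [MulAction.IsPretransitive G M] in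
theorem isOpen_orbitDomain (p : M) : IsOpen (orbitDomain E EG G p) :=
  (continuousOn_extChartAt_symm (I := 𝓘(ℝ, EG)) (1 : G)).isOpen_inter_preimage
    (isOpen_extChartAt_target _)
    ((isOpen_extChartAt_source _).preimage (contMDiff_orbit E EG p).continuous)

omit [FiniteDimensional ℝ E] [T2Space M] [IsManifold 𝓘(ℝ, E) ∞ M] [FiniteDimensional ℝ EG]
  [T2Space G] [SecondCountableTopology G] [LieGroup 𝓘(ℝ, EG) ∞ G] [MulAction.IsPretransitive G M]
  [ContMDiffSMul 𝓘(ℝ, EG) 𝓘(ℝ, E) ∞ G M] in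
theorem mem_orbitDomain (p : M) :
    extChartAt 𝓘(ℝ, EG) (1 : G) 1 ∈ orbitDomain E EG G p := by
  refine ⟨mem_extChartAt_target _, ?_⟩
  change (extChartAt 𝓘(ℝ, EG) (1 : G)).symm (extChartAt 𝓘(ℝ, EG) (1 : G) 1) • p ∈ (extChartAt 𝓘(ℝ, E) p).source
  rw [extChartAt_to_inv, one_smul]
  exact mem_extChartAt_source _

omit [FiniteDimensional ℝ E] [T2Space M] [FiniteDimensional ℝ EG]
  [T2Space G] [SecondCountableTopology G] [MulAction.IsPretransitive G M] in
theorem contDiffOn_orbitChart (p : M) : ContDiffOn ℝ ∞ (orbitChart E EG G p) (orbitDomain E EG G p) := by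
  intro x hx
  have h1 : ContMDiffAt 𝓘(ℝ, EG) 𝓘(ℝ, EG) ∞ (extChartAt 𝓘(ℝ, EG) (1 : G)).symm x :=
    (contMDiffOn_extChartAt_symm (1 : G)).contMDiffAt
      ((isOpen_extChartAt_target (1 : G)).mem_nhds hx.1)
  have h2 : ContMDiffAt 𝓘(ℝ, E) 𝓘(ℝ, E) ∞ (extChartAt 𝓘(ℝ, E) p)
      ((extChartAt 𝓘(ℝ, EG) (1 : G)).symm x • p) := contMDiffAt_extChartAt' (by
    have := hx.2
    rwa [mem_preimage, mem_ofPred_eq, extChartAt_source] at this)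
  have h3 := h2.comp x (((contMDiff_orbit E EG p).contMDiffAt).comp x h1)
  exact h3.contDiffAt.contDiffWithinAt

omit [FiniteDimensional ℝ E] [T2Space M] [T2Space G] [SecondCountableTopology G]
  [MulAction.IsPretransitive G M] in
/-- By homogeneity, the rank of the orbit map is maximal at the identity. -/
theorem finrank_orbitChart_le (p : M) {x : EG} (hx : x ∈ orbitDomain E EG G p) :
    Module.finrank ℝ (fderiv ℝ (orbitChart E EG G p) x : EG →ₗ[ℝ] E).range ≤ Module.finrank ℝ
      (fderiv ℝ (orbitChart E EG G p) (extChartAt 𝓘(ℝ, EG) (1 : G) 1) : EG →ₗ[ℝ] E).range := by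
  set φ := extChartAt 𝓘(ℝ, EG) (1 : G) with hφ
  set χ := extChartAt 𝓘(ℝ, E) p with hχ
  set g : G := φ.symm x with hg
  set x₀ : EG := φ 1 with hx₀
  have hmul : ContMDiff 𝓘(ℝ, EG) 𝓘(ℝ, EG) ∞ (fun k : G => g⁻¹ * k) := contMDiff_mul_left
  have hsymm : ContMDiffAt 𝓘(ℝ, EG) 𝓘(ℝ, EG) ∞ φ.symm x :=
    (contMDiffOn_extChartAt_symm (1 : G)).contMDiffAt
      ((isOpen_extChartAt_target (1 : G)).mem_nhds hx.1)
  have hinner : ContMDiffAt 𝓘(ℝ, EG) 𝓘(ℝ, EG) ∞ (fun y => g⁻¹ * φ.symm y) x :=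
    hmul.contMDiffAt.comp x hsymm
  have hval : g⁻¹ * φ.symm x = 1 := inv_mul_cancel g
  set β : EG → EG := fun y => φ (g⁻¹ * φ.symm y) with hβ
  have hβx : β x = x₀ := by rw [hβ]; simp only [hval]; rfl
  have hβd : DifferentiableAt ℝ β x := by
    have h1 : ContMDiffAt 𝓘(ℝ, EG) 𝓘(ℝ, EG) ∞ φ (g⁻¹ * φ.symm x) := by
      rw [hval]
      exact contMDiffAt_extChartAt
    exact (h1.comp x hinner).contDiffAt.differentiableAt (by simp)
  set α : E → E := fun z => χ (g • χ.symm z) with hα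
  have hf0 : orbitChart E EG G p x₀ = χ p := by
    rw [orbitChart, hx₀, ← hφ, extChartAt_to_inv, one_smul]
  have hαd : DifferentiableAt ℝ α (orbitChart E EG G p x₀) := by
    rw [hf0]
    have h1 : ContMDiffAt 𝓘(ℝ, E) 𝓘(ℝ, E) ∞ χ.symm (χ p) :=
      (contMDiffOn_extChartAt_symm p).contMDiffAt (extChartAt_target_mem_nhds p)
    have h2 : ContMDiffAt 𝓘(ℝ, E) 𝓘(ℝ, E) ∞ (fun z => g • χ.symm z) (χ p) :=
      (contMDiff_translate E EG g).contMDiffAt.comp _ h1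
    have h3 : ContMDiffAt 𝓘(ℝ, E) 𝓘(ℝ, E) ∞ χ (g • χ.symm (χ p)) := by
      rw [extChartAt_to_inv]
      refine contMDiffAt_extChartAt' ?_
      have := hx.2
      rwa [mem_preimage, mem_ofPred_eq, extChartAt_source] at this
    exact (ContMDiffAt.comp (g := χ) (f := fun z => g • χ.symm z) (χ p) h3 h2).contDiffAt.differentiableAt (by simp)
  -- `k p = g ((g⁻¹ k) p)`: near `x` the orbit map factors through its germ at the identity, so its
  -- rank at `x` is bounded by that at the identity.
  have hev : orbitChart E EG G p =ᶠ[𝓝 x] fun y => α (orbitChart E EG G p (β y)) := by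
    have h1 : ∀ᶠ y in 𝓝 x, g⁻¹ * φ.symm y ∈ φ.source := by
      refine hinner.continuousAt.preimage_mem_nhds ?_
      rw [hval]
      exact extChartAt_source_mem_nhds 1
    have h2 : ∀ᶠ y in 𝓝 x, (g⁻¹ * φ.symm y) • p ∈ χ.source := by
      have hc : ContinuousAt (fun y => (g⁻¹ * φ.symm y) • p) x :=
        (contMDiff_orbit E EG p).continuous.continuousAt.comp hinner.continuousAt
      refine hc.preimage_mem_nhds ?_
      rw [hval, one_smul]
      exact extChartAt_source_mem_nhds p
    filter_upwards [h1, h2] with y hy1 hy2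
    change χ (φ.symm y • p) = χ (g • χ.symm (χ (φ.symm (φ (g⁻¹ * φ.symm y)) • p)))
    rw [φ.left_inv hy1, χ.left_inv hy2, ← mul_smul, mul_inv_cancel_left]
  have hfd : DifferentiableAt ℝ (orbitChart E EG G p) x₀ :=
    ((contDiffOn_orbitChart p).contDiffAt
      ((isOpen_orbitDomain p).mem_nhds (mem_orbitDomain p))).differentiableAt (by simp)
  have hchain : fderiv ℝ (orbitChart E EG G p) x = (fderiv ℝ α (orbitChart E EG G p x₀)).comp
      ((fderiv ℝ (orbitChart E EG G p) x₀).comp (fderiv ℝ β x)) := by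
    rw [hev.fderiv_eq]
    refine HasFDerivAt.fderiv ?_
    refine HasFDerivAt.comp x (g := α) (f := fun y => orbitChart E EG G p (β y)) ?_ ?_
    · rw [hβx]
      exact hαd.hasFDerivAt
    · refine HasFDerivAt.comp x (g := orbitChart E EG G p) (f := β) ?_ hβd.hasFDerivAt
      rw [hβx]
      exact hfd.hasFDerivAt
  rw [hchain]
  have hle : ((((fderiv ℝ α (orbitChart E EG G p x₀)).comp
      ((fderiv ℝ (orbitChart E EG G p) x₀).comp (fderiv ℝ β x)) : EG →L[ℝ] E) : EG →ₗ[ℝ] E)).range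
      ≤ Submodule.map (fderiv ℝ α (orbitChart E EG G p x₀) : E →ₗ[ℝ] E)
        (fderiv ℝ (orbitChart E EG G p) x₀ : EG →ₗ[ℝ] E).range := by
    rintro _ ⟨v, rfl⟩
    exact ⟨_, ⟨fderiv ℝ β x v, rfl⟩, rfl⟩
  exact (Submodule.finrank_mono hle).trans (Submodule.finrank_map_le _ _)

omit [T2Space G] in
/-- The orbit map is a submersion at the identity. -/
theorem range_fderiv_orbitChart (p : M) : (fderiv ℝ (orbitChart E EG G p)
    (extChartAt 𝓘(ℝ, EG) (1 : G) 1) : EG →ₗ[ℝ] E).range = ⊤ := by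
  by_contra hne
  have hlt : Module.finrank ℝ (fderiv ℝ (orbitChart E EG G p)
      (extChartAt 𝓘(ℝ, EG) (1 : G) 1) : EG →ₗ[ℝ] E).range < Module.finrank ℝ E :=
    Submodule.finrank_lt hne
  -- A deficient rank gives some neighbourhood of the identity an image of dimension less than `dim
  -- M`, although openness of the orbit map makes this image a neighbourhood of `p`.
  obtain ⟨N, hN, hdim⟩ := exists_nhds_dimH_image_lt (isOpen_orbitDomain p) (mem_orbitDomain p)
    (contDiffOn_orbitChart p) (fun x hx => finrank_orbitChart_le p hx) hlt
  set φ := extChartAt 𝓘(ℝ, EG) (1 : G) with hφ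
  set χ := extChartAt 𝓘(ℝ, E) p with hχ
  have hA : {g : G | g ∈ φ.source ∧ φ g ∈ N} ∈ 𝓝 (1 : G) :=
    inter_mem (extChartAt_source_mem_nhds 1) ((continuousAt_extChartAt (1 : G)).preimage_mem_nhds hN)
  have hB : (fun g : G => g • p) '' {g : G | g ∈ φ.source ∧ φ g ∈ N} ∈ 𝓝 p := by
    have := (isOpenMap_orbit E EG p).image_mem_nhds hA
    rwa [one_smul] at this
  have hC : orbitChart E EG G p '' N ∈ 𝓝 (χ p) := by
    have h1 : χ.target ∩ χ.symm ⁻¹' ((fun g : G => g • p) '' {g : G | g ∈ φ.source ∧ φ g ∈ N})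
        ∈ 𝓝 (χ p) := by
      refine inter_mem (extChartAt_target_mem_nhds p) ?_
      refine (continuousAt_extChartAt_symm p).preimage_mem_nhds ?_
      rwa [extChartAt_to_inv]
    refine mem_of_superset h1 ?_
    rintro z ⟨hz, g, ⟨hg, hgN⟩, hgz⟩
    refine ⟨φ g, hgN, ?_⟩
    change χ (φ.symm (φ g) • p) = z
    rw [φ.left_inv hg]
    change g • p = χ.symm z at hgz
    rw [hgz, χ.right_inv hz]
  rw [Real.dimH_of_mem_nhds hC] at hdim
  exact lt_irrefl _ hdim

omit [T2Space G] in
variable (E EG G) in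
/-- A transitive smooth action has smooth local sections. -/
theorem exists_smooth_section (p x : M) : ∃ W : Set M, IsOpen W ∧ x ∈ W ∧ ∃ s : M → G,
    ContMDiffOn 𝓘(ℝ, E) 𝓘(ℝ, EG) ∞ s W ∧ ∀ y ∈ W, s y • p = y := by
  obtain ⟨W', hW', h0, s', hs', hs0, hsec⟩ := exists_section_of_surjective
    (isOpen_orbitDomain (E := E) (EG := EG) (G := G) p) (mem_orbitDomain p) (contDiffOn_orbitChart p)
    (range_fderiv_orbitChart p)
  set φ := extChartAt 𝓘(ℝ, EG) (1 : G) with hφ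
  set χ := extChartAt 𝓘(ℝ, E) p with hχ
  have hf0 : orbitChart E EG G p (φ 1) = χ p := by
    rw [orbitChart, ← hφ, extChartAt_to_inv, one_smul]
  rw [hf0] at h0
  -- The section exists near `p` and is carried to `g p` by translation with `g`.
  obtain ⟨g, rfl⟩ := MulAction.exists_smul_eq G p x
  set W₀ : Set M := χ.source ∩ χ ⁻¹' W' with hW₀
  have hW₀o : IsOpen W₀ := (continuousOn_extChartAt p).isOpen_inter_preimage
    (isOpen_extChartAt_source p) hW'
  refine ⟨(fun y : M => g⁻¹ • y) ⁻¹' W₀, hW₀o.preimage (contMDiff_translate E EG g⁻¹).continuous,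
    ?_, fun y => g * φ.symm (s' (χ (g⁻¹ • y))), ?_, ?_⟩
  · rw [mem_preimage, inv_smul_smul]
    exact ⟨mem_extChartAt_source p, h0⟩
  · intro y hy
    have hy' : g⁻¹ • y ∈ W₀ := hy
    have h1 : ContMDiffAt 𝓘(ℝ, E) 𝓘(ℝ, E) ∞ χ (g⁻¹ • y) := contMDiffAt_extChartAt' (by
      have := hy'.1
      rwa [extChartAt_source] at this)
    have h2 : ContMDiffAt 𝓘(ℝ, E) 𝓘(ℝ, E) ∞ (fun y => χ (g⁻¹ • y)) y :=
      h1.comp y (contMDiff_translate E EG g⁻¹).contMDiffAt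
    have h3 : ContMDiffAt 𝓘(ℝ, E) 𝓘(ℝ, EG) ∞ s' (χ (g⁻¹ • y)) :=
      (hs'.contDiffAt (hW'.mem_nhds hy'.2)).contMDiffAt
    have h4 : ContMDiffAt 𝓘(ℝ, EG) 𝓘(ℝ, EG) ∞ φ.symm (s' (χ (g⁻¹ • y))) :=
      (contMDiffOn_extChartAt_symm (1 : G)).contMDiffAt
        ((isOpen_extChartAt_target (1 : G)).mem_nhds (hsec _ hy'.2).1.1)
    have h5 : ContMDiffAt 𝓘(ℝ, E) 𝓘(ℝ, EG) ∞ (fun y => φ.symm (s' (χ (g⁻¹ • y)))) y :=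
      h4.comp y (h3.comp y h2)
    have h6 : ContMDiff 𝓘(ℝ, EG) 𝓘(ℝ, EG) ∞ (fun k : G => g * k) := contMDiff_mul_left
    exact (h6.contMDiffAt.comp y h5).contMDiffWithinAt
  · intro y hy
    have hy' : g⁻¹ • y ∈ W₀ := hy
    obtain ⟨hU, hv⟩ := hsec _ hy'.2
    have h1 : φ.symm (s' (χ (g⁻¹ • y))) • p = g⁻¹ • y := χ.injOn hU.2 hy'.1 hv
    rw [mul_smul, h1, smul_inv_smul]

end OrbitMap

/-! ### Fibres as torsors, and smooth maps into the total space -/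

section Torsor

open Filter Topology

variable {E : Type*} [NormedAddCommGroup E] [NormedSpace ℝ E]
  {M : Type*} [TopologicalSpace M] [ChartedSpace E M] [IsManifold 𝓘(ℝ, E) ∞ M]
  {w : SymplecticForm E M} {V : Type*} [NormedAddCommGroup V]
  [InnerProductSpace ℂ V] [FiniteDimensional ℂ V] [MeasurableSpace V] [BorelSpace V]
  {h : ℝ} [hh : Fact (0 < h)]

omit [FiniteDimensional ℂ V] [MeasurableSpace V] [BorelSpace V] in
theorem SympFrame.exists_sp_of_base_eq {f f' : SympFrame w V} (hb : f.base = f'.base) :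
    ∃ g : Sp V, ∀ v, f'.app v = f.app ((g : V ≃L[ℝ] V) v) := by
  obtain ⟨x, b, hs⟩ := f
  obtain ⟨x', b', hs'⟩ := f'
  obtain rfl : x = x' := hb
  refine ⟨⟨b'.trans b.symm, fun u v => ?_⟩, fun v => ?_⟩
  · rw [← hs, ← hs' u v, ContinuousLinearEquiv.trans_apply, ContinuousLinearEquiv.trans_apply,
      b.apply_symm_apply, b.apply_symm_apply]
  · change (⟨x, b' v⟩ : TangentBundle 𝓘(ℝ, E) M) = ⟨x, b (b.symm (b' v))⟩
    rw [b.apply_symm_apply]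

namespace MpcStructure

variable {P : Type*} (S : MpcStructure w V h P)

/-- The element of `Mp^c` which maps `q` to `p`, for `q` and `p` in the same fibre. -/
def diff (q p : P) : Mpc V h :=
  open Classical in
  if hq : S.proj q = S.proj p then (S.simply_transitive q p hq).choose else 1

theorem act_diff {q p : P} (hq : S.proj q = S.proj p) : S.act q (S.diff q p) = p := by
  rw [diff, dif_pos hq]
  exact (S.simply_transitive q p hq).choose_spec.1

theorem act_left_cancel {q : P} {A B : Mpc V h} (hAB : S.act q A = S.act q B) : A = B :=
  (S.simply_transitive q (S.act q B) (S.proj_act q B).symm).unique hAB rfl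

theorem diff_act (q : P) (A : Mpc V h) : S.diff q (S.act q A) = A :=
  S.act_left_cancel (S.act_diff (S.proj_act q A).symm)

theorem diff_mul_diff {p q r : P} (hpq : S.proj p = S.proj q) (hqr : S.proj q = S.proj r) :
    S.diff p q * S.diff q r = S.diff p r := by
  apply S.act_left_cancel (q := p)
  rw [S.act_mul, S.act_diff hpq, S.act_diff hqr, S.act_diff (hpq.trans hqr)]

theorem inv_diff {p q : P} (hpq : S.proj p = S.proj q) : (S.diff p q)⁻¹ = S.diff q p := by
  rw [inv_eq_iff_mul_eq_one, S.diff_mul_diff hpq hpq.symm]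
  apply S.act_left_cancel (q := p)
  rw [S.act_diff rfl, S.act_one]

/-- Every symplectic frame of the base is the image of a point of the total space. -/
theorem exists_phi_app_eq (f₀ : SympFrame w V) :
    ∃ q, S.proj q = f₀.base ∧ ∀ v, (S.phi q).app v = f₀.app v := by
  obtain ⟨c, hc, hx⟩ := S.cover f₀.base
  have hp := S.proj_section c hc _ hx
  obtain ⟨g, hg⟩ := SympFrame.exists_sp_of_base_eq (f := S.phi (c.2 f₀.base)) (f' := f₀)
    ((S.phi_base _).trans hp)
  obtain ⟨A, rfl⟩ := sig_surjective h g
  exact ⟨S.act (c.2 f₀.base) A, (S.proj_act _ _).trans hp, fun v => by rw [S.phi_act, hg]⟩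

section Smooth

variable {E' H' N : Type*} [NormedAddCommGroup E'] [NormedSpace ℝ E'] [TopologicalSpace H']
  {I' : ModelWithCorners ℝ E' H'} [TopologicalSpace N] [ChartedSpace H' N]

/-- Smoothness at a point of a map to the total space of an `Mp^c`-structure. -/
def SmoothAt (I' : ModelWithCorners ℝ E' H') (f : N → P) (y : N) : Prop :=
  ContMDiffAt I' 𝓘(ℝ, E) ∞ (fun z => S.proj (f z)) y ∧
    ∀ c ∈ S.atlas, S.proj (f y) ∈ c.1 →
      MpcSmoothAt I' (fun z => S.diff (c.2 (S.proj (f z))) (f z)) y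

/-- The definition quantifies over all component functions in a trivialisation; where the projection
lies in the domain of the chart they are forced to be `diff`, so testing this one is enough. -/
theorem smoothOn_iff {f : N → P} {O : Set N} (hO : IsOpen O) :
    S.SmoothOn I' f O ↔ ∀ y ∈ O, S.SmoothAt I' f y := by
  constructor
  · rintro ⟨h1, h2⟩ y hy
    refine ⟨h1.contMDiffAt (hO.mem_nhds hy), fun c hc hyc => ?_⟩
    have h3 : IsOpen (O ∩ {z | S.proj (f z) ∈ c.1}) :=
      h1.continuousOn.isOpen_inter_preimage hO (S.isOpen_of_mem c hc)
    exact (mpcSmoothOn_iff h3).1 (h2 c hc (fun z => S.diff (c.2 (S.proj (f z))) (f z))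
      fun z _ hz => (S.act_diff (S.proj_section c hc _ hz)).symm) y ⟨hy, hyc⟩
  · intro h1
    have h2 : ContMDiffOn I' 𝓘(ℝ, E) ∞ (fun y => S.proj (f y)) O :=
      fun y hy => (h1 y hy).1.contMDiffWithinAt
    refine ⟨h2, fun c hc a ha => ?_⟩
    have h3 : IsOpen (O ∩ {z | S.proj (f z) ∈ c.1}) :=
      h2.continuousOn.isOpen_inter_preimage hO (S.isOpen_of_mem c hc)
    refine (mpcSmoothOn_iff h3).2 fun y hy => ((h1 y hy.1).2 c hc hy.2).congr ?_
    filter_upwards [h3.mem_nhds hy] with z hz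
    conv_rhs => rw [ha z hz.1 hz.2]
    rw [S.proj_act, S.proj_section c hc _ hz.2, S.diff_act]

variable {S}

theorem SmoothAt.congr {f f' : N → P} {y : N} (hf : S.SmoothAt I' f y)
    (hff : ∀ᶠ z in 𝓝 y, f' z = f z) : S.SmoothAt I' f' y := by
  refine ⟨hf.1.congr_of_eventuallyEq (hff.mono fun z hz => by simp only [hz]), fun c hc hy => ?_⟩
  rw [hff.self_of_nhds] at hy
  exact (hf.2 c hc hy).congr (hff.mono fun z hz => by simp only [hz])

theorem SmoothAt.comp {E'' H'' N' : Type*} [NormedAddCommGroup E''] [NormedSpace ℝ E'']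
    [TopologicalSpace H''] {I'' : ModelWithCorners ℝ E'' H''} [TopologicalSpace N']
    [ChartedSpace H'' N'] {f : N → P} {k : N' → N} {y : N'} (hf : S.SmoothAt I' f (k y))
    (hk : ContMDiffAt I'' I' ∞ k y) : S.SmoothAt I'' (fun z => f (k z)) y :=
  ⟨hf.1.comp y hk, fun c hc hy => (hf.2 c hc hy).comp hk⟩

theorem SmoothAt.eventually_mem {f : N → P} {y : N} (hf : S.SmoothAt I' f y)
    {c : Set M × (M → P)} (hc : c ∈ S.atlas) (hy : S.proj (f y) ∈ c.1) :
    ∀ᶠ z in 𝓝 y, S.proj (f z) ∈ c.1 :=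
  hf.1.continuousAt.preimage_mem_nhds ((S.isOpen_of_mem c hc).mem_nhds hy)

theorem SmoothAt.act {f : N → P} {a : N → Mpc V h} {y : N} (hf : S.SmoothAt I' f y)
    (ha : MpcSmoothAt I' a y) : S.SmoothAt I' (fun z => S.act (f z) (a z)) y := by
  simp only [SmoothAt, S.proj_act]
  refine ⟨hf.1, fun c hc hy => ((hf.2 c hc hy).mul ha).congr ?_⟩
  filter_upwards [hf.eventually_mem hc hy] with z hz
  have h1 := S.proj_section c hc _ hz
  conv_rhs => rw [← S.diff_act (f z) (a z)]
  rw [S.diff_mul_diff h1 (S.proj_act _ _).symm]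

/-- With `s` the section of a chart, the difference is `diff(s, f)⁻¹ diff(s, f')`; smoothness of
products and inverses in `Mp^c` enters here. -/
theorem SmoothAt.diff {f f' : N → P} {y : N} (hf : S.SmoothAt I' f y) (hf' : S.SmoothAt I' f' y)
    (hff : ∀ᶠ z in 𝓝 y, S.proj (f z) = S.proj (f' z)) :
    MpcSmoothAt I' (fun z => S.diff (f z) (f' z)) y := by
  obtain ⟨c, hc, hy⟩ := S.cover (S.proj (f y))
  have hy' : S.proj (f' y) ∈ c.1 := hff.self_of_nhds ▸ hy
  refine ((hf.2 c hc hy).inv.mul (hf'.2 c hc hy')).congr ?_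
  filter_upwards [hff, hf.eventually_mem hc hy] with z hz hzc
  have h1 := S.proj_section c hc _ hzc
  rw [S.inv_diff h1, ← hz, S.diff_mul_diff h1.symm (h1.trans hz)]

end Smooth

end MpcStructure

end Torsor

/-! ### The action of the stabilizer on a fibre -/

section Homogeneous

open Filter Topology

variable {E : Type*} [NormedAddCommGroup E] [NormedSpace ℝ E]
  {M : Type*} [TopologicalSpace M] [ChartedSpace E M] [IsManifold 𝓘(ℝ, E) ∞ M]
  {w : SymplecticForm E M} {V : Type*} [NormedAddCommGroup V]
  [InnerProductSpace ℂ V] [FiniteDimensional ℂ V] [MeasurableSpace V] [BorelSpace V]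
  {h : ℝ} [hh : Fact (0 < h)]
  {EG : Type*} [NormedAddCommGroup EG] [NormedSpace ℝ EG]
  {G : Type*} [Group G] [TopologicalSpace G] [ChartedSpace EG G] [MulAction G M]
  {P : Type*} [MulAction G P] {S : MpcStructure w V h P}

/-- The orbit maps in the total space of an invariant `Mp^c`-structure are smooth. -/
theorem MpcStructure.IsInvariant.smoothAt_orbit (hS : S.IsInvariant (EG := EG) (G := G)) (q : P)
    (g₀ : G) : S.SmoothAt 𝓘(ℝ, EG) (fun g : G => g • q) g₀ := by
  obtain ⟨c, hc, hy⟩ := S.cover (S.proj q)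
  have h1 := (S.smoothOn_iff (isOpen_univ.prod (S.isOpen_of_mem c hc))).1 (hS.smooth c hc)
    (g₀, S.proj q) ⟨mem_univ _, hy⟩
  have h2 : ContMDiffAt 𝓘(ℝ, EG) (𝓘(ℝ, EG).prod 𝓘(ℝ, E)) ∞ (fun g : G => (g, S.proj q)) g₀ :=
    contMDiffAt_id.prodMk contMDiffAt_const
  -- Invariance gives smoothness along local sections only; `q` differs from the section by a fixed
  -- element of `Mp^c`, which commutes with the action of `G`.
  have h3 := (MpcStructure.SmoothAt.comp (k := fun g : G => (g, S.proj q)) (y := g₀) h1 h2).act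
    (mpcSmoothAt_const (S.diff (c.2 (S.proj q)) q) g₀)
  refine h3.congr (Eventually.of_forall fun g => ?_)
  change g • q = S.act (g • c.2 (S.proj q)) _
  rw [← hS.smul_act, S.act_diff (S.proj_section c hc _ hy)]

variable [ContMDiffSMul 𝓘(ℝ, EG) 𝓘(ℝ, E) ∞ G M] {f₀ : SympFrame w V} {q : P}

omit [FiniteDimensional ℂ V] [MeasurableSpace V] [BorelSpace V] in
theorem iso_tau (f₀ : SympFrame w V) (k : MulAction.stabilizer G f₀.base) (v : V) :
    f₀.iso (tau EG f₀ k v) = isotropy EG f₀.base k (f₀.iso v) :=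
  f₀.iso.apply_symm_apply _

/-- Compute `φ(k q)` twice: by equivariance under `G` it is `k_* ∘ f₀`, and by equivariance under
`Mp^c` it is `f₀ ∘ σ(μ(k))`. -/
theorem MpcStructure.IsInvariant.sig_diff (hS : S.IsInvariant (EG := EG) (G := G))
    (hq : S.proj q = f₀.base) (hphi : ∀ v, (S.phi q).app v = f₀.app v)
    (k : MulAction.stabilizer G f₀.base) :
    (sig (S.diff q ((k : G) • q)) : V ≃L[ℝ] V) = tau EG f₀ k := by
  have hk : (k : G) • f₀.base = f₀.base := k.2
  -- The base points `k p₀` and `p₀` are equal only by a proof, so vectors are compared through the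
  -- common model space `E`.
  have key : ∀ (y x : M), y = x → ∀ a b : E,
      (⟨y, a⟩ : TangentBundle 𝓘(ℝ, E) M) = ⟨x, b⟩ → a = b := by
    rintro y _ rfl a b hab
    exact eq_of_heq (Bundle.TotalSpace.mk.inj hab).2
  ext v
  have h1 : (S.phi ((k : G) • q)).app v
      = (⟨(k : G) • f₀.base, dAct E (k : G) f₀.base (f₀.iso v)⟩ : TangentBundle 𝓘(ℝ, E) M) := by
    rw [hS.phi_smul, hphi]
    rfl
  have h2 : S.proj q = S.proj ((k : G) • q) := by rw [hS.proj_smul, hq, hk]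
  have h3 : (S.phi ((k : G) • q)).app v
      = (⟨f₀.base, f₀.iso ((sig (S.diff q ((k : G) • q)) : V ≃L[ℝ] V) v)⟩ :
        TangentBundle 𝓘(ℝ, E) M) := by
    conv_lhs => rw [← S.act_diff h2]
    rw [S.phi_act, hphi]
    rfl
  apply f₀.iso.injective
  rw [iso_tau]
  exact (key _ _ hk _ _ (h1.symm.trans h3)).symm

omit [ContMDiffSMul 𝓘(ℝ, EG) 𝓘(ℝ, E) ∞ G M] in
theorem MpcStructure.IsInvariant.diff_mul (hS : S.IsInvariant (EG := EG) (G := G))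
    (hq : S.proj q = f₀.base) (a b : MulAction.stabilizer G f₀.base) :
    S.diff q (((a * b : MulAction.stabilizer G f₀.base) : G) • q)
      = S.diff q ((a : G) • q) * S.diff q ((b : G) • q) := by
  have h2 : ∀ k : MulAction.stabilizer G f₀.base, S.proj q = S.proj ((k : G) • q) := fun k => by
    have hk : (k : G) • f₀.base = f₀.base := k.2
    rw [hS.proj_smul, hq, hk]
  apply S.act_left_cancel (q := q)
  rw [S.act_diff (h2 _), S.act_mul, S.act_diff (h2 a), ← hS.smul_act, S.act_diff (h2 b)]
  exact mul_smul _ _ _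

omit [ContMDiffSMul 𝓘(ℝ, EG) 𝓘(ℝ, E) ∞ G M] in
-- The component of `g q` in a chart is smooth in `g ∈ G`; on the stabilizer it differs from `μ` by
-- a constant left factor. This gives continuity of `μ` without a manifold structure on the
-- stabilizer.
theorem MpcStructure.IsInvariant.exists_smooth_extension (hS : S.IsInvariant (EG := EG) (G := G))
    (hq : S.proj q = f₀.base) (k : MulAction.stabilizer G f₀.base) :
    ∃ b : G → Mpc V h, MpcSmoothAt 𝓘(ℝ, EG) b k ∧
      ∀ k' : MulAction.stabilizer G f₀.base, b k' = S.diff q ((k' : G) • q) := by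
  obtain ⟨c, hc, hy⟩ := S.cover f₀.base
  have hp := S.proj_section c hc _ hy
  have hk : ∀ k : MulAction.stabilizer G f₀.base, S.proj ((k : G) • q) = f₀.base := fun k => by
    have hk : (k : G) • f₀.base = f₀.base := k.2
    rw [hS.proj_smul, hq, hk]
  refine ⟨_, (mpcSmoothAt_const (S.diff q (c.2 f₀.base)) _).mul
    ((hS.smoothAt_orbit q k).2 c hc (by rw [hk]; exact hy)), fun k' => ?_⟩
  change _ * S.diff (c.2 (S.proj ((k' : G) • q))) ((k' : G) • q) = _
  rw [hk, S.diff_mul_diff (hq.trans hp.symm) (hp.trans (hk k').symm)]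

omit [ContMDiffSMul 𝓘(ℝ, EG) 𝓘(ℝ, E) ∞ G M] in
theorem MpcStructure.IsInvariant.continuous_param_diff (hS : S.IsInvariant (EG := EG) (G := G))
    (hq : S.proj q = f₀.base) :
    Continuous fun k : MulAction.stabilizer G f₀.base => param (S.diff q ((k : G) • q)) := by
  refine continuous_iff_continuousAt.2 fun k => ?_
  obtain ⟨b, hb, hbk⟩ := hS.exists_smooth_extension hq k
  simp only [← hbk]
  exact hb.2.continuousAt.comp continuous_subtype_val.continuousAt

/-- Continuity of `τ` is read off from that of its lift `μ`. -/
theorem MpcStructure.IsInvariant.continuous_tau (hS : S.IsInvariant (EG := EG) (G := G))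
    (f₀ : SympFrame w V) (v : V) :
    Continuous fun k : MulAction.stabilizer G f₀.base => tau EG f₀ k v := by
  obtain ⟨q, hq, hphi⟩ := S.exists_phi_app_eq f₀
  refine continuous_iff_continuousAt.2 fun k => ?_
  obtain ⟨b, hb, hbk⟩ := hS.exists_smooth_extension hq k
  simp only [← hS.sig_diff hq hphi, ← hbk]
  exact (hb.1 v).continuousAt.comp continuous_subtype_val.continuousAt

end Homogeneous

/-! ### The isomorphism with an associated bundle -/

section AssociatedIso

open Filter Topology

variable {E : Type*} [NormedAddCommGroup E] [NormedSpace ℝ E] [FiniteDimensional ℝ E]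
  {M : Type*} [TopologicalSpace M] [T2Space M] [ChartedSpace E M] [IsManifold 𝓘(ℝ, E) ∞ M]
  {w : SymplecticForm E M} {V : Type*} [NormedAddCommGroup V]
  [InnerProductSpace ℂ V] [FiniteDimensional ℂ V] [MeasurableSpace V] [BorelSpace V]
  {h : ℝ} [hh : Fact (0 < h)]
  {EG : Type*} [NormedAddCommGroup EG] [NormedSpace ℝ EG] [FiniteDimensional ℝ EG]
  {G : Type*} [Group G] [TopologicalSpace G] [SecondCountableTopology G]
  [ChartedSpace EG G] [LieGroup 𝓘(ℝ, EG) ∞ G]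
  [MulAction G M] [ContMDiffSMul 𝓘(ℝ, EG) 𝓘(ℝ, E) ∞ G M] [MulAction.IsPretransitive G M]
  {P : Type*} [MulAction G P] {S : MpcStructure w V h P} {f₀ : SympFrame w V} {q : P}

theorem scalar_mul_right_cancel {c d : Circle} {A : Mpc V h} (hcd : scalar c * A = scalar d * A) :
    c = d := by
  have h1 := congrArg param hcd
  rw [param_scalar_mul, param_scalar_mul] at h1
  exact Circle.ext (mul_right_cancel₀ (param_ne_zero A) h1)

/-- An invariant `Mp^c`-structure is associated to the action of the stabilizer on a fibre. -/
theorem MpcStructure.IsInvariant.exists_isAssocIso_of_act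
    (hS : S.IsInvariant (EG := EG) (G := G)) (hq : S.proj q = f₀.base)
    (hphi : ∀ v, (S.phi q).app v = f₀.app v) (mu : MulAction.stabilizer G f₀.base →* Mpc V h)
    (hmu : ∀ k : MulAction.stabilizer G f₀.base, S.act q (mu k) = (k : G) • q) :
    ∃ Psi : AssocBundle mu ≃ P, IsAssocIso EG S f₀ mu Psi := by
  have hmk : ∀ (g : G) (k : MulAction.stabilizer G f₀.base) (A : Mpc V h),
      S.act ((g * (k : G)) • q) A = S.act (g • q) (mu k * A) := fun g k A => by
    rw [mul_smul, ← hmu, hS.smul_act, S.act_mul]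
  -- The isomorphism is `[g, A] ↦ (g q) · A`; the hypothesis on `mu` makes it independent of the
  -- representative.
  let F : AssocBundle mu → P := Quotient.lift (fun a : G × Mpc V h => S.act (a.1 • q) a.2) (by
    rintro a b ⟨k, rfl⟩
    change _ = S.act ((a.1 * (k : G)) • q) ((mu k)⁻¹ * a.2)
    rw [hmk, mul_inv_cancel_left])
  have hF : ∀ g A, F (AssocBundle.mk mu g A) = S.act (g • q) A := fun _ _ => rfl
  have hproj : ∀ g A, S.proj (S.act (g • q) A) = g • f₀.base := fun g A => by
    rw [S.proj_act, hS.proj_smul, hq]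
  have hinj : Function.Injective F := by
    intro x y
    induction x using Quotient.inductionOn with | _ a => ?_
    induction y using Quotient.inductionOn with | _ b => ?_
    intro hab
    obtain ⟨g, A⟩ := a
    obtain ⟨g', B⟩ := b
    change S.act (g • q) A = S.act (g' • q) B at hab
    have h1 : g • f₀.base = g' • f₀.base := by rw [← hproj g A, hab, hproj]
    have hk : g⁻¹ * g' ∈ MulAction.stabilizer G f₀.base := by
      rw [MulAction.mem_stabilizer_iff, mul_smul, ← h1, inv_smul_smul]
    refine Quotient.sound ⟨⟨g⁻¹ * g', hk⟩, ?_⟩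
    have h2 : g' = g * ((⟨g⁻¹ * g', hk⟩ : MulAction.stabilizer G f₀.base) : G) :=
      (mul_inv_cancel_left g g').symm
    refine Prod.ext h2 ?_
    rw [h2, hmk] at hab
    exact eq_inv_mul_of_mul_eq (S.act_left_cancel hab).symm
  have hsurj : Function.Surjective F := by
    intro p
    obtain ⟨g, hg⟩ := MulAction.exists_smul_eq G f₀.base (S.proj p)
    exact ⟨AssocBundle.mk mu g (S.diff (g • q) p),
      S.act_diff (by rw [hS.proj_smul, hq, hg])⟩
  refine ⟨Equiv.ofBijective F ⟨hinj, hsurj⟩, hproj, fun g A B => ?_, fun g' g A => ?_,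
    fun g A v => ?_, fun O s hO hs => ?_⟩
  · exact (S.act_mul (g • q) A B).symm
  · change g' • S.act (g • q) A = S.act ((g' * g) • q) A
    rw [hS.smul_act, mul_smul]
  · change (S.phi (S.act (g • q) A)).app v = _
    rw [S.phi_act, hS.phi_smul, hphi]
  · change ∀ x ∈ O, S.proj (F (s x)) = x at hs
    change _ ↔ S.SmoothOn 𝓘(ℝ, E) (fun x => F (s x)) O
    rw [S.smoothOn_iff hO]
    constructor
    · intro hsm x hx
      obtain ⟨W, hW, hxW, g, a, hg, ha, hga⟩ := hsm x hx
      have h1 := (MpcStructure.SmoothAt.comp (k := g) (y := x) (hS.smoothAt_orbit q (g x))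
        (hg.contMDiffAt (hW.mem_nhds hxW))).act ((mpcSmoothOn_iff hW).1 ha x hxW)
      refine h1.congr ?_
      filter_upwards [hW.mem_nhds hxW, hO.mem_nhds hx] with y hyW hyO
      rw [hga y ⟨hyW, hyO⟩, hF]
    · intro hsm x hx
      -- A smooth section of `G → M` gives the `G`-component of the lift; the `Mp^c`-component is
      -- then the difference between the moved point `g(y) q` and the given section.
      obtain ⟨W, hW, hxW, g, hg, hgs⟩ := exists_smooth_section E EG G f₀.base x
      have hp : ∀ y ∈ W ∩ O, S.proj (g y • q) = S.proj (F (s y)) := fun y hy => by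
        rw [hS.proj_smul, hq, hgs y hy.1, hs y hy.2]
      have hWO : IsOpen (W ∩ O) := hW.inter hO
      refine ⟨W ∩ O, hWO, ⟨hxW, hx⟩, g, fun y => S.diff (g y • q) (F (s y)),
        hg.mono inter_subset_left, (mpcSmoothOn_iff hWO).2 fun y hy => ?_, fun y hy => hinj ?_⟩
      · refine MpcStructure.SmoothAt.diff ?_ (hsm y hy.2) ?_
        · exact MpcStructure.SmoothAt.comp (k := g) (y := y) (hS.smoothAt_orbit q (g y))
            (hg.contMDiffAt (hW.mem_nhds hy.1))
        · filter_upwards [hWO.mem_nhds hy] with z hz using hp z hz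
      · rw [hF, S.act_diff (hp y hy.1)]

/-- An invariant `Mp^c`-structure is determined, up to a unitary character, by any continuous lift
of the isotropy representation to `Mp^c`. -/
theorem MpcStructure.IsInvariant.exists_isAssocIso
    (hS : S.IsInvariant (EG := EG) (G := G)) (f₀ : SympFrame w V)
    (l : MulAction.stabilizer G f₀.base →* Mpc V h)
    (hsig : ∀ k, (sig (l k) : V ≃L[ℝ] V) = tau EG f₀ k)
    (hcont : Continuous fun k => param (l k)) :
    ∃ (chi : MulAction.stabilizer G f₀.base →ₜ* Circle)
      (Psi : AssocBundle (twist chi.toMonoidHom l) ≃ P),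
      IsAssocIso EG S f₀ (twist chi.toMonoidHom l) Psi := by
  obtain ⟨q, hq, hphi⟩ := S.exists_phi_app_eq f₀
  have h1 : ∀ k : MulAction.stabilizer G f₀.base,
      ∃ c : Circle, S.diff q ((k : G) • q) = scalar c * l k := fun k =>
    exists_scalar_mul_of_sig_eq (Subtype.ext ((hS.sig_diff hq hphi k).trans (hsig k).symm))
  choose c hc using h1
  -- Both `μ` and `l` are homomorphisms and scalars are central, so their quotient is a character.
  have hmul : ∀ a b, c (a * b) = c a * c b := fun a b => by
    apply scalar_mul_right_cancel (A := l (a * b))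
    rw [← hc, hS.diff_mul hq, hc, hc, map_mul l, map_mul scalar, mul_assoc, mul_assoc]
    congr 1
    rw [← mul_assoc, ← mul_assoc, scalar_comm]
  -- The character is the quotient of the parameters of `μ(k)` and `l(k)`, both continuous and
  -- nonzero.
  have hcc : Continuous c := by
    have h2 : (fun k => (c k : ℂ)) = fun k : MulAction.stabilizer G f₀.base =>
        param (S.diff q ((k : G) • q)) / param (l k) := by
      funext k
      rw [hc, param_scalar_mul, mul_div_cancel_right₀ _ (param_ne_zero _)]
    refine continuous_induced_rng.2 ?_
    change Continuous fun k => (c k : ℂ)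
    rw [h2]
    exact (hS.continuous_param_diff hq).div hcont fun k => param_ne_zero _
  let chi : MulAction.stabilizer G f₀.base →ₜ* Circle :=
    { toMonoidHom := MonoidHom.mk' c hmul
      continuous_toFun := hcc }
  refine ⟨chi, hS.exists_isAssocIso_of_act hq hphi _ fun k => ?_⟩
  change S.act q (scalar (c k) * l k) = _
  rw [← hc, S.act_diff]
  have hk : (k : G) • f₀.base = f₀.base := k.2
  rw [hS.proj_smul, hq, hk]

end AssociatedIso

/-! ### The isotropy representation and continuity of the explicit parameters -/

section Isotropy

open Filter Topology

variable {E : Type*} [NormedAddCommGroup E] [NormedSpace ℝ E]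
  {M : Type*} [TopologicalSpace M] [ChartedSpace E M] [IsManifold 𝓘(ℝ, E) ∞ M]
  {w : SymplecticForm E M} {V : Type*} [NormedAddCommGroup V]
  [InnerProductSpace ℂ V] [FiniteDimensional ℂ V]
  {EG : Type*} [NormedAddCommGroup EG] [NormedSpace ℝ EG]
  {G : Type*} [Group G] [TopologicalSpace G] [ChartedSpace EG G] [MulAction G M]
  [ContMDiffSMul 𝓘(ℝ, EG) 𝓘(ℝ, E) ∞ G M]

theorem continuous_det_linPart {X : Type*} [TopologicalSpace X] {g : X → V ≃L[ℝ] V}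
    (hg : ∀ v, Continuous fun x => g x v) :
    Continuous fun x => LinearMap.det (linPart (g x)) := by
  obtain ⟨n, b, Q, hQ, hdet⟩ := exists_det_eq V
  simp only [hdet, linPart_apply]
  exact hQ.continuous.comp (continuous_pi fun i =>
    ((hg _).sub ((hg _).const_smul Complex.I)).const_smul (1 / 2 : ℂ))

theorem continuous_detMinus {X : Type*} [TopologicalSpace X] {jt : CommutingCCS V}
    {g : X → pseudoUnitary jt} (hg : ∀ v, Continuous fun x => (g x : V ≃L[ℝ] V) v) :
    Continuous fun x => detMinus jt (g x) := by
  obtain ⟨n, b, Q, hQ, hdet⟩ := exists_det_eq V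
  simp only [detMinus_eq, minusDet, hdet, LinearMap.add_apply, Module.End.mul_apply, linPart_apply]
  exact hQ.continuous.comp (continuous_pi fun i =>
    (((hg _).sub ((hg _).const_smul Complex.I)).const_smul (1 / 2 : ℂ)).add continuous_const)

omit [FiniteDimensional ℂ V] in
theorem tau_mem_sp (hw : IsSymplecticAction G w) (f₀ : SympFrame w V)
    (k : MulAction.stabilizer G f₀.base) : tau EG f₀ k ∈ Sp V := fun u v => by
  rw [← f₀.symp, ← f₀.symp u v, iso_tau, iso_tau]
  exact isotropy_symp hw _ k _ _

/-- In the frame the isotropy action preserves `F` and `jF`, the two eigenspaces. On `F` it is `ρ_+`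
by definition, and on `jF` invariance of the pairing `Ω` between `F` and `jF` forces the inverse
transpose. -/
theorem tau_eq_tauFEquiv (hw : IsSymplecticAction G w) {A : EndoField E M}
    (hAG : A.IsInvariant G) {F : Submodule ℝ V} (hF : IsLagrangian F)
    (f₀ : SympFrame w V) (fp : F ≃ₗ[ℝ] plusSpace A f₀.base)
    (hfp : ∀ a : F, f₀.iso (a : V) = fp a)
    (hfm : ∀ a : F, A.toFun f₀.base (f₀.iso (Complex.I • (a : V)))
      = -f₀.iso (Complex.I • (a : V))) (k : MulAction.stabilizer G f₀.base) :
    tau EG f₀ k = tauFEquiv hF (rhoPlus EG hAG f₀.base fp k) := by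
  set C := rhoPlus EG hAG f₀.base fp k with hC
  have hplus : ∀ a : F, A.toFun f₀.base (f₀.iso (a : V)) = f₀.iso (a : V) := fun a => by
    rw [hfp]
    exact sub_eq_zero.1 (fp a).2
  have h1 : ∀ a : F, tau EG f₀ k (a : V) = C a := fun a => by
    apply f₀.iso.injective
    rw [iso_tau, hfp, hfp]
    have h2 : fp (C a) = isotropyPlus EG hAG f₀.base k (fp a) := fp.apply_symm_apply _
    rw [h2]
    rfl
  have h2 : ∀ b : F, tau EG f₀ k (Complex.I • (b : V)) = Complex.I • (invTranspose C b : V) :=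
    fun b => by
    obtain ⟨c, d, hcd⟩ := exists_eq_add_I hF (tau EG f₀ k (Complex.I • (b : V)))
    have h3 : A.toFun f₀.base (f₀.iso (tau EG f₀ k (Complex.I • (b : V))))
        = -f₀.iso (tau EG f₀ k (Complex.I • (b : V))) := by
      rw [iso_tau, ← isotropy_field hAG, hfm, map_neg]
    have h4 : c = 0 := by
      rw [hcd, map_add, map_add, hplus, hfm, neg_add, add_left_inj] at h3
      have h5 : (2 : ℝ) • (c : V) = 0 := by
        rw [← map_neg] at h3
        rw [two_smul]
        exact add_eq_zero_iff_eq_neg.2 (f₀.iso.injective h3)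
      exact Subtype.ext ((smul_eq_zero.1 h5).resolve_left two_ne_zero)
    rw [h4, Submodule.coe_zero, zero_add] at hcd
    have h5 : ∀ a : F, (inner ℂ (C a : V) (d : V) : ℂ).re = (inner ℂ (a : V) (b : V) : ℂ).re :=
      fun a => by
      have := tau_mem_sp (EG := EG) hw f₀ k (a : V) (Complex.I • (b : V))
      rw [h1, hcd, Om_eq_im, Om_eq_im, inner_smul_right, inner_smul_right] at this
      simpa using this
    have h6 : d = invTranspose C b := by
      let _ : InnerProductSpace ℝ V := InnerProductSpace.complexToReal
      refine ext_inner_right ℝ fun a => ?_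
      change (inner ℂ (d : V) (a : V) : ℂ).re = (inner ℂ (invTranspose C b : V) (a : V) : ℂ).re
      have h7 := h5 (C.symm a)
      rw [LinearEquiv.apply_symm_apply] at h7
      rw [re_inner_invTranspose, ← inner_conj_symm, Complex.conj_re, h7, ← inner_conj_symm,
        Complex.conj_re]
    rw [hcd, h6]
  ext v
  obtain ⟨a, b, rfl⟩ := exists_eq_add_I hF v
  rw [tauFEquiv_apply, tauF_add_I hF, map_add, h1, h2]

/-- Continuity is inherited from `det C_g` through `f_F = |det C_g|^{-1/2}`, which avoids the
logarithm. -/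
theorem continuous_fF {X : Type*} [TopologicalSpace X] {F : Submodule ℝ V} (hF : IsLagrangian F)
    {C : X → F ≃ₗ[ℝ] F} (hC : ∀ v, Continuous fun x => tauFEquiv hF (C x) v) :
    Continuous fun x => fF (C x) := by
  have h1 : (fun x => fF (C x))
      = fun x => Real.sqrt ‖LinearMap.det (linPart (tauFEquiv hF (C x)))‖⁻¹ := by
    funext x
    rw [← eq_inv_of_mul_eq_one_left (sq_fF_mul hF (C x)), Real.sqrt_sq (fF_pos (C x)).le]
  rw [h1]
  exact ((continuous_det_linPart hC).norm.inv₀ fun x =>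
    norm_ne_zero_iff.2 (det_linPart_ne_zero (tauFEquiv_mem hF (C x)))).sqrt

end Isotropy

end MpcGeom

end

theorem mainTheorem11
    -- the model symplectic vector space `(V, Ω)` with its positive compatible complex structure
    {V : Type*} [NormedAddCommGroup V] [InnerProductSpace ℂ V] [FiniteDimensional ℂ V]
    [MeasurableSpace V] [BorelSpace V] (h : ℝ) [Fact (0 < h)]
    -- the symplectic manifold `(M, ω)`
    {E : Type*} [NormedAddCommGroup E] [NormedSpace ℝ E] [FiniteDimensional ℝ E]
    {M : Type*} [TopologicalSpace M] [T2Space M] [ChartedSpace E M] [IsManifold 𝓘(ℝ, E) ∞ M]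
    (w : MpcGeom.SymplecticForm E M)
    -- the Lie group `G` with its transitive symplectic action on `M`
    {EG : Type*} [NormedAddCommGroup EG] [NormedSpace ℝ EG] [FiniteDimensional ℝ EG]
    {G : Type*} [Group G] [TopologicalSpace G] [T2Space G] [SecondCountableTopology G]
    [ChartedSpace EG G] [LieGroup 𝓘(ℝ, EG) ∞ G]
    [MulAction G M] [ContMDiffSMul 𝓘(ℝ, EG) 𝓘(ℝ, E) ∞ G M] [MulAction.IsPretransitive G M]
    (hw : MpcGeom.IsSymplecticAction G w) :
    -- the pseudo-Hermitean case
    (∀ jt : MpcGeom.CommutingCCS V,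
      ∃ Fjj : MpcGeom.pseudoUnitary jt →* MpcGeom.Mpc V h,
        (∀ g, MpcGeom.HasParameters (Fjj g) (g : V ≃L[ℝ] V) (MpcGeom.detMinus jt g)⁻¹) ∧
        ∀ (J : MpcGeom.EndoField E M) (_ : J.IsCompatibleACS w) (hJG : J.IsInvariant G)
          (f₀ : MpcGeom.SympFrame w V) (hf : MpcGeom.IsPseudoUnitaryFrame f₀ jt J)
          {P : Type*} [MulAction G P] (S : MpcGeom.MpcStructure w V h P)
          (_ : S.IsInvariant (EG := EG) (G := G)),
          ∃ (chi : MulAction.stabilizer G f₀.base →ₜ* Circle)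
            (Psi : MpcGeom.AssocBundle (MpcGeom.twist chi.toMonoidHom
              (Fjj.comp (MpcGeom.tauPU EG hw hJG jt f₀ hf))) ≃ P),
            MpcGeom.IsAssocIso EG S f₀ _ Psi) ∧
    -- the bi-Lagrangian case
    (∀ F : Submodule ℝ V, MpcGeom.IsLagrangian F →
      ∃ tF : (F ≃ₗ[ℝ] F) →* MpcGeom.Mpc V h,
        (∀ C, ∃ g : V ≃L[ℝ] V, (∀ v, g v = MpcGeom.tauF C v) ∧
          MpcGeom.HasParameters (tF C) g (MpcGeom.fF C)) ∧
        ∀ (A : MpcGeom.EndoField E M) (_ : A.IsBiLagrangian w) (hAG : A.IsInvariant G)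
          (f₀ : MpcGeom.SympFrame w V) (fp : F ≃ₗ[ℝ] MpcGeom.plusSpace A f₀.base)
          (_ : ∀ a : F, f₀.iso (a : V) = fp a)
          (_ : ∀ a : F, A.toFun f₀.base (f₀.iso (Complex.I • (a : V)))
            = -f₀.iso (Complex.I • (a : V)))
          {P : Type*} [MulAction G P] (S : MpcGeom.MpcStructure w V h P)
          (_ : S.IsInvariant (EG := EG) (G := G)),
          ∃ (chi : MulAction.stabilizer G f₀.base →ₜ* Circle)
            (Psi : MpcGeom.AssocBundle (MpcGeom.twist chi.toMonoidHom
              (tF.comp (MpcGeom.rhoPlus EG hAG f₀.base fp))) ≃ P),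
            MpcGeom.IsAssocIso EG S f₀ _ Psi) := by
  refine ⟨fun jt => ?_, fun F hF => ?_⟩
  · obtain ⟨Fjj, hFjj⟩ := MpcGeom.exists_pseudoUnitary_lift (h := h) jt
    refine ⟨Fjj, hFjj, fun J _ hJG f₀ hf P _ S hS => ?_⟩
    refine hS.exists_isAssocIso f₀ _ (fun k => (hFjj _).1) ?_
    have h1 : ∀ k, MpcGeom.param ((Fjj.comp (MpcGeom.tauPU EG hw hJG jt f₀ hf)) k)
        = (MpcGeom.detMinus jt (MpcGeom.tauPU EG hw hJG jt f₀ hf k))⁻¹ := fun k => (hFjj _).param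
    simp only [h1]
    -- `Det C_k^-` cannot vanish: its inverse is a parameter of an element of `Mp^c`, which is
    -- nonzero.
    refine (MpcGeom.continuous_detMinus fun v => hS.continuous_tau f₀ v).inv₀ fun k hk => ?_
    have h2 := MpcGeom.param_ne_zero ((Fjj.comp (MpcGeom.tauPU EG hw hJG jt f₀ hf)) k)
    rw [h1, hk, inv_zero] at h2
    exact h2 rfl
  · obtain ⟨tF, htF⟩ := MpcGeom.exists_biLagrangian_lift (h := h) hF
    refine ⟨tF, fun C => ⟨MpcGeom.tauFEquiv hF C, fun v => rfl, htF C⟩,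
      fun A _ hAG f₀ fp hfp hfm P _ S hS => ?_⟩
    have h1 := MpcGeom.tau_eq_tauFEquiv (EG := EG) hw hAG hF f₀ fp hfp hfm
    refine hS.exists_isAssocIso f₀ _ (fun k => (htF _).1.trans (h1 k).symm) ?_
    have h2 : ∀ k, MpcGeom.param ((tF.comp (MpcGeom.rhoPlus EG hAG f₀.base fp)) k)
        = MpcGeom.fF (MpcGeom.rhoPlus EG hAG f₀.base fp k) := fun k => (htF _).param
    simp only [h2]
    refine Complex.continuous_ofReal.comp (MpcGeom.continuous_fF hF fun v => ?_)
    simp only [← h1]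
    exact hS.continuous_tau f₀ v
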